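/- Let $\alpha:[0,1]\to(1,2)$ be a $C^1$ function, $c=\inf_{[0,1]}\alpha$ and $d=\sup_{[0,1]}\alpha$. Let $(\Gamma_i)_{i\ge1}$ be the arrival times of a Poisson process with unit rate, $(V_i)_{i\ge1}$ i.i.d. uniform on $[0,1]$, and $(\gamma_i)_{i\ge1}$ i.i.d. with $P(\gamma_i=1)=P(\gamma_i=-1)=1/2$, the three sequences being independent. With $C_u=\left(\int_0^\infty x^{-u}\sin x\,dx\right)^{-1}$, the independent-increments multistable Lévy motion is $$B(t)=\sum_{i=1}^{\infty}\gamma_i\,C_{\alpha(V_i)}^{1/\alpha(V_i)}\,\Gamma_i^{-1/\alpha(V_i)}\,\mathbf 1_{\{V_i\le t\}},\qquad t\in[0,1],$$ the limit of the partial sums, which almost surely converge for all $t\in[0,1]$. For $X:[0,1]\to\mathbb R$ put $\Delta_{n,j}=X(\frac{j+1}n)-X(\frac jn)$ and, with the convention $\log 0=-\infty$, $$N_n^\varepsilon(\beta)=\#\Big\{0\le j<n:\ \beta-\varepsilon\le\frac{\log|\Delta_{n,j}|}{-\log n}\le\beta+\varepsilon\Big\},\qquad f_g(\beta)=\lim_{\varepsilon\to0^+}\liminf_{n\to\infty}\frac{\log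 N_n^\varepsilon(\beta)}{\log n}$$ (the increment-based large deviation spectrum), $$S_n(q)=\sum_{j:\,\Delta_{n,j}\ne0}|\Delta_{n,j}|^q,\qquad f_l(\beta)=\inf_{q\in\mathbb R}\Big(q\beta+\liminf_{n\to\infty}\frac{\log S_n(q)}{\log n}\Big)$$ (the Legendre spectrum), and $f_H(h)=\dim_H\{t\in[0,1]:h_X(t)=h\}$ (the Hausdorff spectrum), where $h_X(t)$ is the pointwise Hölder exponent of $X$ at $t$ and $\dim_H\varnothing=-\infty$. Theorem. Almost surely, the spectra of $X=B$ satisfy, for all $\beta\in\mathbb R$, $$f_g(\beta)=f_l(\beta)=\begin{cases}-\infty&\text{if }\beta<0,\\ \beta d&\text{if }\beta\in[0,\frac1d],\\ 1&\text{if }\beta\in(\frac1d,\frac1c],\\ 1+\frac1c-\beta&\text{if }\beta\in(\frac1c,1+\frac1c],\\ -\infty&\text{if }\beta>1+\frac1c.\end{cases}$$ In particular, almost surely, $f_g$ is concave, and $f_H\ne f_g$, i.e. the strong multifractal formalism fails for $B$. -/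

import Mathlib

open MeasureTheory ProbabilityTheory Filter Topology Set
open scoped ENNReal

noncomputable section

/-! ### Spectra of a function on the unit interval -/

/-- The increment of `X` over the `j`-th interval of the subdivision of `[0,1]` into `n` intervals
of equal length. -/
def gridIncrement (X : ℝ → ℝ) (n j : ℕ) : ℝ :=
  X (((j : ℝ) + 1) / (n : ℝ)) - X ((j : ℝ) / (n : ℝ))

/-- The number of `j < n` with `β - ε ≤ log |Δ_j| / (-log n) ≤ β + ε`, where `Δ_j` is the `j`-th
increment. A vanishing increment has coarse exponent `+∞` and is never counted. -/
def coarseCount (X : ℝ → ℝ) (ε β : ℝ) (n : ℕ) : ℕ :=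
  {j : ℕ | j < n ∧ gridIncrement X n j ≠ 0 ∧
    β - ε ≤ Real.log |gridIncrement X n j| / (-Real.log n) ∧
    Real.log |gridIncrement X n j| / (-Real.log n) ≤ β + ε}.ncard

/-- `liminf_n log N_n^ε(β) / log n`, with `log 0 = -∞`. -/
def coarseGrowth (X : ℝ → ℝ) (β ε : ℝ) : EReal :=
  liminf (fun n : ℕ => ENNReal.log (coarseCount X ε β n : ℝ≥0∞) / ((Real.log n : ℝ) : EReal)) atTop

/-- The increment-based large deviation spectrum
`f_g(β) = lim_{ε → 0+} liminf_n log N_n^ε(β) / log n`. The quantity under the limit is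
nondecreasing in `ε`, so the limit is an infimum
(see `tendsto_coarseGrowth`). -/
def largeDeviationSpectrum (X : ℝ → ℝ) (β : ℝ) : EReal :=
  ⨅ ε ∈ Ioi (0 : ℝ), coarseGrowth X β ε

theorem coarseCount_mono (X : ℝ → ℝ) (β : ℝ) (n : ℕ) {ε ε' : ℝ} (h : ε ≤ ε') :
    coarseCount X ε β n ≤ coarseCount X ε' β n := by
  refine Set.ncard_le_ncard ?_ ((Set.finite_lt_nat n).subset fun j hj => hj.1)
  rintro j ⟨h1, h2, h3, h4⟩
  exact ⟨h1, h2, by linarith, by linarith⟩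

theorem coarseGrowth_mono (X : ℝ → ℝ) (β : ℝ) : Monotone (coarseGrowth X β) := by
  intro ε ε' h
  refine liminf_le_liminf (Eventually.of_forall fun n => ?_)
  refine EReal.div_le_div_right_of_nonneg ?_ ?_
  · exact_mod_cast Real.log_natCast_nonneg n
  · exact ENNReal.log_monotone (by exact_mod_cast coarseCount_mono X β n h)

/-- The large deviation spectrum is the limit as `ε → 0+`. -/
theorem tendsto_coarseGrowth (X : ℝ → ℝ) (β : ℝ) :
    Tendsto (coarseGrowth X β) (𝓝[>] 0) (𝓝 (largeDeviationSpectrum X β)) := by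
  have h := (coarseGrowth_mono X β).tendsto_nhdsGT 0
  rwa [sInf_image] at h

/-- The partition function `S_n(q) = ∑_j |Δ_j|^q`, the sum being over the nonzero increments. -/
def partitionSum (X : ℝ → ℝ) (q : ℝ) (n : ℕ) : ℝ :=
  ∑ j ∈ Finset.range n, if gridIncrement X n j = 0 then 0 else |gridIncrement X n j| ^ q

/-- The moment growth exponent `liminf_n log S_n(q) / log n`, with `log 0 = -∞`. -/
def momentExponent (X : ℝ → ℝ) (q : ℝ) : EReal :=
  liminf (fun n : ℕ =>
    ENNReal.log (ENNReal.ofReal (partitionSum X q n)) / ((Real.log n : ℝ) : EReal)) atTop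

/-- The Legendre spectrum: the Legendre transform of the moment growth exponent,
`f_l(β) = inf_q (q β + liminf_n log S_n(q) / log n)`. -/
def legendreSpectrum (X : ℝ → ℝ) (β : ℝ) : EReal :=
  ⨅ q : ℝ, ((q * β : ℝ) : EReal) + momentExponent X q

/-- `X`, as a function on `[0,1]`, belongs to the pointwise Hölder class `C^l(t)`. -/
def PointwiseHolder (X : ℝ → ℝ) (l t : ℝ) : Prop :=
  ∃ (P : Polynomial ℝ) (K : ℝ), P.natDegree ≤ ⌊l⌋₊ ∧
    ∀ᶠ s in 𝓝[Icc (0 : ℝ) 1] t, |X s - P.eval (s - t)| ≤ K * |s - t| ^ l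

/-- The pointwise Hölder exponent at `t` of `X` as a function on `[0,1]`. -/
def pointwiseExponent (X : ℝ → ℝ) (t : ℝ) : EReal :=
  ⨆ l : {l : ℝ // 0 ≤ l ∧ PointwiseHolder X l t}, ((l : ℝ) : EReal)

open Classical in
/-- The Hausdorff multifractal spectrum `h ↦ dim_H {t ∈ [0,1] : h_X(t) = h}`,
with `dim_H ∅ = -∞`. -/
def hausdorffSpectrum (X : ℝ → ℝ) (h : ℝ) : EReal :=
  if {t ∈ Icc (0 : ℝ) 1 | pointwiseExponent X t = (h : EReal)} = ∅ then ⊥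
  else ((dimH {t ∈ Icc (0 : ℝ) 1 | pointwiseExponent X t = (h : EReal)} : ℝ≥0∞) : EReal)

/-- Concavity of an extended-real-valued function on the line: its hypograph is convex. -/
def IsConcaveEReal (f : ℝ → EReal) : Prop :=
  Convex ℝ {p : ℝ × ℝ | (p.2 : EReal) ≤ f p.1}

/-! ### The independent-increments multistable Lévy motion -/

/-- The stable normalization constant `C_u = (∫_0^∞ x^{-u} sin x dx)^{-1}`. -/
def stableConst (u : ℝ) : ℝ :=
  (∫ x in Ioi (0 : ℝ), x ^ (-u) * Real.sin x)⁻¹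

/-- The sum of the first `N` terms of the series
`∑_i γ_i C_{α(V_i)}^{1/α(V_i)} Γ_i^{-1/α(V_i)} 1_{V_i ≤ t}`
(the sequences are indexed from `0`). -/
def multistablePartialSum (α : ℝ → ℝ) (Γ V γ : ℕ → ℝ) (N : ℕ) (t : ℝ) : ℝ :=
  ∑ i ∈ Finset.range N,
    if V i ≤ t then
      γ i * stableConst (α (V i)) ^ (1 / α (V i)) * Γ i ^ (-(1 / α (V i)))
    else 0

/-- The sum of the series, as the limit of its partial sums (the convergence is only
conditional). -/
def multistableMotion (α : ℝ → ℝ) (Γ V γ : ℕ → ℝ) (t : ℝ) : ℝ :=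
  limUnder atTop fun N : ℕ => multistablePartialSum α Γ V γ N t

/-- The interarrival times of a sequence of arrival times. -/
def interarrival {Ω : Type*} (Γ : ℕ → Ω → ℝ) (i : ℕ) (ω : Ω) : ℝ :=
  if i = 0 then Γ 0 ω else Γ i ω - Γ (i - 1) ω

/-- `Γ` is the sequence of arrival times of a Poisson process of unit rate, `V` is i.i.d. uniform
on `[0,1]`, `γ` is i.i.d. with `P(γ_i = 1) = P(γ_i = -1) = 1/2`, and the three sequences are
independent. -/
structure IsMultistableInput {Ω : Type*} [MeasurableSpace Ω] (P : Measure Ω)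
    (Γ V γ : ℕ → Ω → ℝ) : Prop where
  measurable_arrival : ∀ i, Measurable (Γ i)
  measurable_position : ∀ i, Measurable (V i)
  measurable_sign : ∀ i, Measurable (γ i)
  law_interarrival : ∀ i, P.map (interarrival Γ i) = expMeasure 1
  indep_interarrival : iIndepFun (interarrival Γ) P
  law_position : ∀ i, P.map (V i) = volume.restrict (Icc (0 : ℝ) 1)
  indep_position : iIndepFun V P
  sign_pos : ∀ i, P {ω | γ i ω = 1} = 1 / 2
  sign_neg : ∀ i, P {ω | γ i ω = -1} = 1 / 2
  indep_sign : iIndepFun γ P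
  indep_sequences :
    iIndepFun (β := fun _ : Fin 3 => ℕ → ℝ)
      ![fun ω i => Γ i ω, fun ω i => V i ω, fun ω i => γ i ω] P

/-- The path of the multistable motion associated with the outcome `ω`. -/
def multistablePath {Ω : Type*} (α : ℝ → ℝ) (Γ V γ : ℕ → Ω → ℝ) (ω : Ω) : ℝ → ℝ :=
  multistableMotion α (fun i => Γ i ω) (fun i => V i ω) (fun i => γ i ω)

/-- The explicit spectrum, in terms of `c = inf α` and `d = sup α`. -/
def multistableSpectrum (c d β : ℝ) : EReal :=
  if β < 0 then ⊥
  else if β ≤ 1 / d then ((β * d : ℝ) : EReal)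
  else if β ≤ 1 / c then 1
  else if β ≤ 1 + 1 / c then ((1 + 1 / c - β : ℝ) : EReal)
  else ⊥

end

/-!
The proof rests on one description of the law of `B`: over every regular subdivision of `[0,1]`
the increments of `B` are independent, and the increment over a cell `I` has characteristic
function `θ ↦ exp (-∫_I |θ| ^ α(v) dv)` (`HasMultistableIncrements`,
`IsMultistableInput.hasMultistableIncrements`). Everything said about the spectra follows from it
(`HasMultistableIncrements.ae_spectra`).

*The law.* Integrating out the signs and then the positions turns the characteristic function of
a linear combination of increments of the `N`-th partial sum into the expectation of
`∏_{i < N} H (Γ_i)`, where `H` is an explicit function with `|H| ≤ 1`. The function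
`F t = exp (-∫_t^∞ (1 - H))` satisfies `E (H (t + e) * F (t + e)) = F t` for an exponential
variable `e`, so the expectation of `F (Γ_{N-1}) * ∏_{i < N} H (Γ_i)` does not depend on `N`, and as
`Γ_N → ∞` the expectation of the product tends to `F 0` (`tendsto_integral_prod_arrival`). The
normalization by `C_u` makes `∫_0^∞ (1 - H)` equal to `∫ |θ(v)| ^ α(v) dv`.

*Convergence at all `t`.* Conditionally on the arrivals and positions, the partial sums are sums of
independent signs with weights `O (i ^ (-1/d))`, and `1/d > 1/2`. On the dyadic block
`[2^k, 2^(k+1))` only polynomially many (in `2^k`) sums occur when `t` varies, and Hoeffding's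
inequality bounds all of them by a negative power of `2^k` (`ae_eventually_dyadicBlockBound`).

*The spectra.* Let `ψ` be the characteristic exponent of an increment `Δ` over a cell of length
`1/n`. Then `P (|Δ| > x)` is of order `ψ (1/x)`, while near `0` the law of `Δ` has a density whose
order is the frequency at which `ψ` equals `1`. Near a point `t` this frequency is about
`n ^ (1/α(t))`, so about `n ^ (β α(t))` increments are of order `n ^ (-β)` when `β < 1/α(t)`, and
about `n ^ (1 + 1/α(t) - β)` when `β > 1/α(t)`. Optimizing over `t` gives the lower bound for `f_g`
at each `β`; Chernoff's inequality makes the counts hold for all large `n`, and the nesting of the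
windows extends the bound from a countable dense set of `β` to all of them. The inequality
`f_g ≤ f_l` is deterministic. For the upper bound on `f_l` it is enough to bound the moments
along the subsequence `n = 2^k`, because `f_l` is defined with a lower limit, and Markov's
inequality does this: the exponents `q = d, 0, -1` give the three linear pieces, and `q → ±∞` gives
`-∞` outside `[0, 1 + 1/c]`. The resulting function is a minimum of three affine functions, hence
concave.

*Failure of the strong formalism.* If `h_X(t) = h` with `1/c < h < 1`, then for large `n` all the
increments close to `t` are at most `n ^ (-l)` for some fixed `l > 1/c`. Such an increment has
probability at most of order `n ^ (1/c - l)`, and by independence a long enough run of them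
does not occur. So `f_H = -∞` on `(1/c, 1)`, where `f_g` is finite.
-/

/-! ### Laws with a scaling characteristic exponent -/

/-- `ψ` is an even nonnegative function on the line growing at least like `|θ|^c` and at most like
`|θ|^d`, in the sense that dilating the argument by `r ≥ 1` multiplies `ψ` by a factor between
`r ^ c` and `r ^ d`. -/
structure IsScalingExponent (ψ : ℝ → ℝ) (c d : ℝ) : Prop where
  nonneg : ∀ θ, 0 ≤ ψ θ
  even : ∀ θ, ψ (-θ) = ψ θ
  lower : ∀ r θ, 1 ≤ r → r ^ c * ψ θ ≤ ψ (r * θ)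
  upper : ∀ r θ, 1 ≤ r → ψ (r * θ) ≤ r ^ d * ψ θ

namespace IsScalingExponent

variable {ψ : ℝ → ℝ} {c d : ℝ}

theorem abs_eq (h : IsScalingExponent ψ c d) (θ : ℝ) : ψ |θ| = ψ θ := by
  rcases abs_cases θ with ⟨h1, _⟩ | ⟨h1, _⟩ <;> rw [h1]
  exact h.even θ

theorem map_zero (h : IsScalingExponent ψ c d) (hc : 0 < c) : ψ 0 = 0 := by
  have h1 := h.lower 2 0 (by norm_num)
  have h2 : (1 : ℝ) < 2 ^ c := Real.one_lt_rpow (by norm_num) hc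
  have h3 := h.nonneg 0
  rw [mul_zero] at h1
  nlinarith

theorem mono (h : IsScalingExponent ψ c d) (hc : 0 < c) {θ θ' : ℝ} (h0 : |θ| ≤ θ') :
    ψ θ ≤ ψ θ' := by
  rw [← h.abs_eq θ]
  rcases (abs_nonneg θ).eq_or_lt with h1 | h1
  · rw [← h1, h.map_zero hc]; exact h.nonneg _
  · have h2 : 1 ≤ θ' / |θ| := by rwa [one_le_div h1]
    have h3 := h.lower _ |θ| h2
    rw [div_mul_cancel₀ _ h1.ne'] at h3
    have h4 : 1 ≤ (θ' / |θ|) ^ c := Real.one_le_rpow h2 hc.le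
    nlinarith [h.nonneg |θ|]

end IsScalingExponent

section Estimates

variable {ψ : ℝ → ℝ} {c d : ℝ} {μ : Measure ℝ} [IsProbabilityMeasure μ]

/-- Parseval's identity against a centred Gaussian law. -/
theorem integral_exp_neg_sq_eq_gaussian (hφ : ∀ θ, charFun μ θ = (Real.exp (-ψ θ) : ℝ))
    (v : NNReal) :
    ∫ y, Real.exp (-(v * y ^ 2 / 2)) ∂μ = ∫ z, Real.exp (-ψ z) ∂(gaussianReal 0 v) := by
  have h1 : ∫ y, charFun (gaussianReal 0 v) y ∂μ = ∫ z, charFun μ z ∂(gaussianReal 0 v) := by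
    simp_rw [charFun_apply_real]
    rw [integral_integral_swap]
    · refine integral_congr_ae (Eventually.of_forall fun z => ?_)
      refine integral_congr_ae (Eventually.of_forall fun y => ?_)
      simp only [mul_comm (y : ℂ) (z : ℂ)]
    · refine Integrable.mono' (integrable_const (1 : ℝ)) ?_ (Eventually.of_forall fun p => ?_)
      · exact Continuous.aestronglyMeasurable (by unfold Function.uncurry; fun_prop)
      · simp only [Function.uncurry]
        rw [← Complex.ofReal_mul, Complex.norm_exp_ofReal_mul_I]
  simp_rw [charFun_gaussianReal, hφ] at h1
  rw [integral_complex_ofReal] at h1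
  apply Complex.ofReal_injective
  rw [← h1, ← integral_complex_ofReal]
  refine integral_congr_ae (Eventually.of_forall fun y => ?_)
  push_cast
  congr 1
  ring

/-- The large deviations of a law are controlled by its characteristic exponent near `0`. -/
theorem measureReal_abs_gt_le (hφ : ∀ θ, charFun μ θ = (Real.exp (-ψ θ) : ℝ))
    (h : IsScalingExponent ψ c d) (hc : 0 < c) (hd : d < 2) {x : ℝ} (hx : 0 < x) :
    μ.real {y | x < |y|} ≤ 8 * ψ x⁻¹ := by
  have h1 := measureReal_abs_gt_le_integral_charFun (μ := μ) hx
  have hbound : ψ (2 * x⁻¹) ≤ 4 * ψ x⁻¹ := by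
    refine (h.upper 2 x⁻¹ (by norm_num)).trans ?_
    have : (2 : ℝ) ^ d ≤ 2 ^ (2 : ℝ) := Real.rpow_le_rpow_of_exponent_le (by norm_num) hd.le
    norm_num at this
    nlinarith [h.nonneg x⁻¹]
  have h2 : ‖∫ t in (-2 * x⁻¹)..(2 * x⁻¹), 1 - charFun μ t‖
      ≤ (4 * ψ x⁻¹) * |2 * x⁻¹ - (-2 * x⁻¹)| := by
    refine intervalIntegral.norm_integral_le_of_norm_le_const fun t ht => ?_
    rw [hφ, ← Complex.ofReal_one, ← Complex.ofReal_sub, Complex.norm_real, Real.norm_eq_abs]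
    have ht' : |t| ≤ 2 * x⁻¹ := by
      rw [uIoc_of_le (by nlinarith [inv_pos.2 hx])] at ht
      exact abs_le.2 ⟨by linarith [ht.1], ht.2⟩
    have h3 := h.mono hc ht'
    have h4 := Real.add_one_le_exp (-ψ t)
    have h5 : Real.exp (-ψ t) ≤ 1 := Real.exp_le_one_iff.2 (by linarith [h.nonneg t])
    rw [abs_of_nonneg (by linarith)]
    linarith
  refine h1.trans ?_
  calc 2⁻¹ * x * ‖∫ t in (-2 * x⁻¹)..(2 * x⁻¹), 1 - charFun μ t‖
      ≤ 2⁻¹ * x * ((4 * ψ x⁻¹) * |2 * x⁻¹ - (-2 * x⁻¹)|) := by gcongr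
    _ = 8 * ψ x⁻¹ := by
        rw [abs_of_pos (by nlinarith [inv_pos.2 hx])]
        field_simp
        ring

theorem integral_cos_eq (hφ : ∀ θ, charFun μ θ = (Real.exp (-ψ θ) : ℝ)) (θ : ℝ) :
    ∫ y, Real.cos (θ * y) ∂μ = Real.exp (-ψ θ) := by
  have h1 : (charFun μ θ).re = Real.exp (-ψ θ) := by rw [hφ, Complex.ofReal_re]
  rw [← h1, charFun_apply_real]
  have h2 : Integrable (fun x : ℝ => Complex.exp (θ * x * Complex.I)) μ := by
    refine Integrable.mono' (integrable_const (1 : ℝ)) ?_ (Eventually.of_forall fun p => ?_)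
    · exact Continuous.aestronglyMeasurable (by fun_prop)
    · rw [← Complex.ofReal_mul, Complex.norm_exp_ofReal_mul_I]
  have h3 := integral_re h2
  simp only [RCLike.re_to_complex] at h3
  rw [← h3]
  refine integral_congr_ae (Eventually.of_forall fun y => ?_)
  simp only []
  rw [← Complex.ofReal_mul, Complex.exp_ofReal_mul_I_re]

theorem sq_le_five_mul_one_sub_cos {u : ℝ} (hu : |u| ≤ 1) : u ^ 2 ≤ 5 * (1 - Real.cos u) := by
  have h1 := Real.cos_le_one_sub_mul_cos_sq (x := u) (by linarith [Real.pi_gt_three])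
  have h2 : (1 : ℝ) / 5 ≤ 2 / Real.pi ^ 2 := by
    rw [div_le_div_iff₀ (by norm_num) (by positivity)]
    nlinarith [Real.pi_lt_d2, Real.pi_pos]
  nlinarith [sq_nonneg u]

/-- The upper bound on the tail is sharp up to a constant. The truncated second moment of `Y` at
level `x` is at most a multiple of `x ^ 2 * E (1 - cos (Y / x))`, so at the frequency `η / x` it
contributes `O (η ^ 2)` to `1 - E cos (η Y / x)`, which is at least of order `η ^ d`. -/
theorem exists_le_measureReal_abs_gt (d : ℝ) (hd : d < 2) : ∃ κ : ℝ, 0 < κ ∧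
    ∀ (ψ : ℝ → ℝ) (c : ℝ) (μ : Measure ℝ), IsProbabilityMeasure μ →
      (∀ θ, charFun μ θ = (Real.exp (-ψ θ) : ℝ)) → IsScalingExponent ψ c d → 0 < c →
      ∀ x : ℝ, 0 < x → ψ x⁻¹ ≤ 1 → κ * ψ x⁻¹ ≤ μ.real {y | x < |y|} := by
  set η : ℝ := (1 / 10 : ℝ) ^ (1 / (2 - d)) with hη
  have hd' : 0 < 2 - d := by linarith
  have hη0 : 0 < η := Real.rpow_pos_of_pos (by norm_num) _
  have hη1 : η ≤ 1 := Real.rpow_le_one (by norm_num) (by norm_num) (by positivity)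
  have hη2 : η ^ 2 = η ^ d / 10 := by
    have : η ^ (2 - d) = 1 / 10 := by
      rw [hη, ← Real.rpow_mul (by norm_num), one_div_mul_cancel hd'.ne', Real.rpow_one]
    have h2 : η ^ 2 = η ^ (d + (2 - d)) := by
      rw [← Real.rpow_natCast]; norm_num
    rw [h2, Real.rpow_add hη0, this]; ring
  have hηd : 0 < η ^ d := Real.rpow_pos_of_pos hη0 _
  refine ⟨η ^ d / 8, by positivity, fun ψ c μ _ hφ h hc x hx hψ => ?_⟩
  set A : Set ℝ := {y | x < |y|}
  have hA : MeasurableSet A := measurableSet_lt measurable_const measurable_abs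
  have hint : ∀ θ : ℝ, Integrable (fun y : ℝ => Real.cos (θ * y)) μ := fun θ => by
    refine Integrable.mono' (integrable_const (1 : ℝ)) ?_ (Eventually.of_forall fun p => ?_)
    · exact Continuous.aestronglyMeasurable (by fun_prop)
    · exact Real.abs_cos_le_one _
  have hpt : ∀ y : ℝ, 1 - Real.cos (η * x⁻¹ * y)
      ≤ 2 * A.indicator 1 y + 5 / 2 * η ^ 2 * (1 - Real.cos (x⁻¹ * y)) := by
    intro y
    by_cases hy : y ∈ A
    · rw [indicator_of_mem hy, Pi.one_apply]
      have h1 := Real.neg_one_le_cos (η * x⁻¹ * y)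
      have h2 := Real.cos_le_one (x⁻¹ * y)
      nlinarith [mul_nonneg (sq_nonneg η) (sub_nonneg.2 h2)]
    · rw [indicator_of_notMem hy]
      have h1 : |x⁻¹ * y| ≤ 1 := by
        rw [abs_mul, abs_of_pos (inv_pos.2 hx), inv_mul_le_iff₀ hx, mul_one]
        exact not_lt.1 hy
      have h2 := sq_le_five_mul_one_sub_cos h1
      have h3 := Real.one_sub_sq_div_two_le_cos (x := η * x⁻¹ * y)
      have h4 : (η * x⁻¹ * y) ^ 2 = η ^ 2 * (x⁻¹ * y) ^ 2 := by ring
      nlinarith [sq_nonneg η]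
  have hI : 1 - Real.exp (-ψ (η * x⁻¹))
      ≤ 2 * μ.real A + 5 / 2 * η ^ 2 * (1 - Real.exp (-ψ x⁻¹)) := by
    have hi1 : ∀ θ : ℝ, Integrable (fun y : ℝ => 1 - Real.cos (θ * y)) μ := fun θ =>
      (integrable_const _).sub (hint _)
    have hi2 : Integrable (fun y => 2 * A.indicator (1 : ℝ → ℝ) y) μ :=
      ((integrable_const (1 : ℝ)).indicator hA).const_mul 2
    have hi3 : ∀ θ, ∫ y : ℝ, (1 - Real.cos (θ * y)) ∂μ = 1 - Real.exp (-ψ θ) := fun θ => by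
      rw [integral_sub (integrable_const _) (hint _), integral_cos_eq hφ]; simp
    have h1 := integral_mono (hi1 _) (hi2.add ((hi1 x⁻¹).const_mul (5 / 2 * η ^ 2))) hpt
    simp only [Pi.add_apply] at h1
    rwa [hi3, integral_add hi2 ((hi1 x⁻¹).const_mul (5 / 2 * η ^ 2)), integral_const_mul,
      integral_const_mul, hi3, integral_indicator_one hA] at h1
  have h1 : η ^ d * ψ x⁻¹ ≤ ψ (η * x⁻¹) := by
    have h2 := h.upper η⁻¹ (η * x⁻¹) ((one_le_inv₀ hη0).2 hη1)
    rw [inv_mul_cancel_left₀ hη0.ne', Real.inv_rpow hη0.le] at h2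
    rwa [← le_inv_mul_iff₀ hηd]
  have h2 : ψ (η * x⁻¹) ≤ 1 := by
    refine (h.mono hc ?_).trans hψ
    rw [abs_of_pos (by positivity)]
    exact mul_le_of_le_one_left (by positivity) hη1
  have h3 := h.nonneg (η * x⁻¹)
  have h4 : Real.exp (-ψ (η * x⁻¹)) ≤ 1 - ψ (η * x⁻¹) / 2 := by
    have h5 := Real.add_one_le_exp (ψ (η * x⁻¹))
    rw [Real.exp_neg, inv_le_iff_one_le_mul₀ (Real.exp_pos _)]
    nlinarith
  have h5 := Real.add_one_le_exp (-ψ x⁻¹)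
  have h6 := h.nonneg x⁻¹
  nlinarith [sq_nonneg η]

/-- Small ball upper bound: a law with exponent `ψ` has a density of order at most `θ₀` as soon as
`ψ θ₀ ≥ 1`. -/
theorem measureReal_abs_le_le (hφ : ∀ θ, charFun μ θ = (Real.exp (-ψ θ) : ℝ))
    (h : IsScalingExponent ψ c d) (hc : 1 ≤ c) {x θ₀ : ℝ} (hx : 0 < x) (hθ₀ : 0 < θ₀)
    (hψ : 1 ≤ ψ θ₀) : μ.real {y | |y| ≤ x} ≤ 10 * x * θ₀ := by
  set v : NNReal := ⟨(x⁻¹) ^ 2, by positivity⟩ with hv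
  have hv' : (v : ℝ) = x⁻¹ ^ 2 := rfl
  have hv0 : v ≠ 0 := fun h0 => by
    rw [h0, NNReal.coe_zero] at hv'
    exact (pow_pos (inv_pos.2 hx) 2).ne hv'
  have hA : MeasurableSet {y : ℝ | |y| ≤ x} := measurableSet_le measurable_abs measurable_const
  have h1 : μ.real {y | |y| ≤ x} ≤ ∫ y, Real.exp (1 / 2) * Real.exp (-(v * y ^ 2 / 2)) ∂μ := by
    rw [← integral_indicator_one hA]
    refine integral_mono_of_nonneg (Eventually.of_forall fun y => ?_) ?_
      (Eventually.of_forall fun y => ?_)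
    · exact indicator_nonneg (fun _ _ => zero_le_one) _
    · refine Integrable.const_mul (Integrable.mono' (integrable_const (1 : ℝ)) ?_
        (Eventually.of_forall fun p => ?_)) _
      · exact Continuous.aestronglyMeasurable (by fun_prop)
      · rw [Real.norm_eq_abs, Real.abs_exp]
        exact Real.exp_le_one_iff.2 (by have := v.2; nlinarith [mul_nonneg v.2 (sq_nonneg p)])
    · by_cases hy : |y| ≤ x
      · rw [indicator_of_mem (by exact hy), Pi.one_apply]
        simp only
        rw [← Real.exp_add, Real.one_le_exp_iff, hv']
        have : x⁻¹ ^ 2 * y ^ 2 ≤ 1 := by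
          rw [← mul_pow, ← sq_abs, abs_mul, abs_of_pos (inv_pos.2 hx)]
          refine pow_le_one₀ (by positivity) ?_
          rwa [inv_mul_le_iff₀ hx, mul_one]
        linarith
      · rw [indicator_of_notMem (by exact hy)]; positivity
  have hIabs : ∫ z : ℝ, Real.exp (-θ₀⁻¹ * |z|) = 2 * θ₀ := by
    rw [integral_comp_abs (f := fun z => Real.exp (-θ₀⁻¹ * z)),
      integral_exp_mul_Ioi (by simpa using hθ₀)]
    simp
  have hIint : Integrable (fun z : ℝ => Real.exp (-θ₀⁻¹ * |z|)) := by
    by_contra hne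
    rw [integral_undef hne] at hIabs
    linarith
  -- the exponent exceeds the affine function `|z| / θ₀ - 1`, by the lower growth with `c ≥ 1`
  have hψz : ∀ z, θ₀⁻¹ * |z| - 1 ≤ ψ z := by
    intro z
    rcases le_total |z| θ₀ with hz | hz
    · have : θ₀⁻¹ * |z| ≤ 1 := by rwa [inv_mul_le_iff₀ hθ₀, mul_one]
      linarith [h.nonneg z]
    · have h2 : 1 ≤ θ₀⁻¹ * |z| := by rwa [le_inv_mul_iff₀ hθ₀, mul_one]
      have h3 := h.lower _ θ₀ h2
      rw [show θ₀⁻¹ * |z| * θ₀ = |z| by field_simp, h.abs_eq] at h3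
      have h4 : θ₀⁻¹ * |z| ≤ (θ₀⁻¹ * |z|) ^ c := Real.self_le_rpow_of_one_le h2 hc
      nlinarith
  have hs : 1 / √(2 * Real.pi * v) ≤ x := by
    rw [div_le_iff₀ (by rw [hv']; positivity), hv', Real.sqrt_mul (by positivity),
      Real.sqrt_sq (by positivity)]
    have : 1 ≤ √(2 * Real.pi) := Real.one_le_sqrt.2 (by linarith [Real.pi_gt_three])
    field_simp
    exact this
  have h2 : ∫ z, Real.exp (-ψ z) ∂(gaussianReal 0 v) ≤ x * Real.exp 1 * (2 * θ₀) := by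
    rw [integral_gaussianReal_eq_integral_smul hv0, ← hIabs, ← integral_const_mul]
    refine integral_mono_of_nonneg (Eventually.of_forall fun y => ?_) (hIint.const_mul _)
      (Eventually.of_forall fun z => ?_)
    · exact mul_nonneg (gaussianPDFReal_nonneg _ _ _) (Real.exp_pos _).le
    · simp only [smul_eq_mul, mul_assoc]
      refine mul_le_mul ?_ ?_ (Real.exp_pos _).le hx.le
      · rw [gaussianPDFReal, ← one_div]
        refine (mul_le_of_le_one_right (by positivity) ?_).trans hs
        refine Real.exp_le_one_iff.2 ?_
        exact div_nonpos_of_nonpos_of_nonneg (by nlinarith [sq_nonneg (z - 0)]) (by positivity)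
      · rw [← Real.exp_add]
        exact Real.exp_le_exp.2 (by linarith [hψz z])
  rw [integral_const_mul, integral_exp_neg_sq_eq_gaussian hφ] at h1
  have h3 : Real.exp (1 / 2) * Real.exp 1 ≤ 5 := by
    rw [← Real.exp_add]
    refine abs_le_of_sq_le_sq' ?_ (by norm_num) |>.2
    rw [← Real.exp_nat_mul]
    have h4 : Real.exp 1 ^ 3 ≤ 2.7182818286 ^ 3 :=
      pow_le_pow_left₀ (Real.exp_pos _).le Real.exp_one_lt_d9.le 3
    rw [← Real.exp_nat_mul] at h4
    norm_num at h4 ⊢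
    linarith
  calc μ.real {y | |y| ≤ x} ≤ Real.exp (1 / 2) * (x * Real.exp 1 * (2 * θ₀)) :=
        h1.trans (by gcongr)
    _ = (Real.exp (1 / 2) * Real.exp 1) * (2 * x * θ₀) := by ring
    _ ≤ 5 * (2 * x * θ₀) := by gcongr
    _ = 10 * x * θ₀ := by ring

/-- Small ball lower bound: smoothing at scale `1 / s` with a Gaussian kernel costs the mass that
the kernel puts outside the ball. -/
theorem le_measureReal_abs_le (hφ : ∀ θ, charFun μ θ = (Real.exp (-ψ θ) : ℝ))
    (h : IsScalingExponent ψ c d) (hc : 0 < c) {x θ₁ s : ℝ} (hx : 0 ≤ x) (hθ₁ : 0 < θ₁)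
    (hs : θ₁ ≤ s) (hψ : ψ θ₁ ≤ 1) :
    θ₁ / (10 * s) - Real.exp (-(s ^ 2 * x ^ 2 / 2)) ≤ μ.real {y | |y| ≤ x} := by
  have hs0 : 0 < s := hθ₁.trans_le hs
  set v : NNReal := ⟨s ^ 2, by positivity⟩ with hv
  have hv' : (v : ℝ) = s ^ 2 := rfl
  have hv0 : v ≠ 0 := fun h0 => by
    rw [h0, NNReal.coe_zero] at hv'
    exact (pow_pos hs0 2).ne hv'
  have hA : MeasurableSet {y : ℝ | |y| ≤ x} := measurableSet_le measurable_abs measurable_const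
  have h1 : ∫ y, Real.exp (-(v * y ^ 2 / 2)) ∂μ
      ≤ μ.real {y | |y| ≤ x} + Real.exp (-(s ^ 2 * x ^ 2 / 2)) := by
    have hi : Integrable ({y : ℝ | |y| ≤ x}.indicator (1 : ℝ → ℝ)) μ :=
      (integrable_const (1 : ℝ)).indicator hA
    have h2 : ∫ y, Real.exp (-(v * y ^ 2 / 2)) ∂μ
        ≤ ∫ y, ({y : ℝ | |y| ≤ x}.indicator 1 y + Real.exp (-(s ^ 2 * x ^ 2 / 2))) ∂μ := by
      refine integral_mono_of_nonneg (Eventually.of_forall fun y => (Real.exp_pos _).le) ?_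
        (Eventually.of_forall fun y => ?_)
      · exact hi.add (integrable_const _)
      · simp only [hv']
        by_cases hy : |y| ≤ x
        · rw [indicator_of_mem (by exact hy), Pi.one_apply]
          have : Real.exp (-(s ^ 2 * y ^ 2 / 2)) ≤ 1 := Real.exp_le_one_iff.2 (by
            have : 0 ≤ s ^ 2 * y ^ 2 := by positivity
            linarith)
          linarith [Real.exp_pos (-(s ^ 2 * x ^ 2 / 2))]
        · rw [indicator_of_notMem (by exact hy), zero_add]
          refine Real.exp_le_exp.2 (neg_le_neg ?_)
          have : x ^ 2 ≤ y ^ 2 := by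
            rw [← sq_abs y]
            exact pow_le_pow_left₀ hx (not_le.1 hy).le 2
          gcongr
    rwa [integral_add hi (integrable_const _),
      integral_indicator_one hA, integral_const, probReal_univ, one_smul] at h2
  rw [integral_exp_neg_sq_eq_gaussian hφ, integral_gaussianReal_eq_integral_smul hv0] at h1
  set m : ℝ := 1 / (4 * s) * Real.exp (-1 / 2) * Real.exp (-1) with hm
  have h2 : ∫ z, (Icc (-θ₁) θ₁).indicator (fun _ => m) z
      ≤ ∫ z, gaussianPDFReal 0 v z • Real.exp (-ψ z) := by
    refine integral_mono_of_nonneg (Eventually.of_forall fun y => ?_) ?_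
      (Eventually.of_forall fun z => ?_)
    · exact indicator_nonneg (fun _ _ => by positivity) _
    · refine Integrable.mono' (integrable_gaussianPDFReal 0 v) ?_
        (Eventually.of_forall fun z => ?_)
      · have h : (fun z => Real.exp (-ψ z)) = fun z => (charFun μ z).re := by
          ext z; rw [hφ, Complex.ofReal_re]
        refine (stronglyMeasurable_gaussianPDFReal 0 v).aestronglyMeasurable.mul ?_
        rw [h]
        exact (Complex.measurable_re.comp measurable_charFun).aestronglyMeasurable
      · rw [norm_smul, Real.norm_eq_abs, Real.norm_eq_abs, Real.abs_exp,
          abs_of_nonneg (gaussianPDFReal_nonneg _ _ _)]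
        exact mul_le_of_le_one_right (gaussianPDFReal_nonneg _ _ _)
          (Real.exp_le_one_iff.2 (by linarith [h.nonneg z]))
    · by_cases hz : z ∈ Icc (-θ₁) θ₁
      · rw [indicator_of_mem hz]
        have hz' : |z| ≤ θ₁ := abs_le.2 hz
        simp only [smul_eq_mul, hm]
        refine mul_le_mul ?_ ?_ (Real.exp_pos _).le (gaussianPDFReal_nonneg _ _ _)
        · rw [gaussianPDFReal, ← one_div]
          refine mul_le_mul ?_ ?_ (Real.exp_pos _).le (by positivity)
          · refine one_div_le_one_div_of_le (by rw [hv']; positivity) ?_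
            rw [hv', Real.sqrt_mul (by positivity), Real.sqrt_sq hs0.le]
            have : √(2 * Real.pi) ≤ 4 :=
              Real.sqrt_le_iff.2 ⟨by norm_num, by linarith [Real.pi_lt_four]⟩
            gcongr
          · refine Real.exp_le_exp.2 ?_
            rw [hv', sub_zero, neg_div, neg_div, neg_le_neg_iff, div_le_div_iff₀ (by positivity)
              (by norm_num), ← sq_abs z]
            have := pow_le_pow_left₀ (abs_nonneg z) (hz'.trans hs) 2
            linarith
        · exact Real.exp_le_exp.2 (by linarith [h.mono hc hz'])
      · rw [indicator_of_notMem hz]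
        exact mul_nonneg (gaussianPDFReal_nonneg _ _ _) (Real.exp_pos _).le
  rw [integral_indicator measurableSet_Icc, setIntegral_const, Real.volume_real_Icc_of_le
    (by linarith), smul_eq_mul] at h2
  have h3 : 1 / 5 ≤ Real.exp (-1 / 2) * Real.exp (-1) := by
    rw [← Real.exp_add, show (-1 / 2 + -1 : ℝ) = -(3 / 2) by norm_num, Real.exp_neg, ← one_div]
    refine one_div_le_one_div_of_le (Real.exp_pos _) ?_
    refine abs_le_of_sq_le_sq' ?_ (by norm_num) |>.2
    rw [← Real.exp_nat_mul]
    have h4 : Real.exp 1 ^ 3 ≤ 2.7182818286 ^ 3 :=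
      pow_le_pow_left₀ (Real.exp_pos _).le Real.exp_one_lt_d9.le 3
    rw [← Real.exp_nat_mul] at h4
    norm_num at h4 ⊢
    linarith
  have h4 : θ₁ / (10 * s) ≤ (θ₁ - -θ₁) * m := by
    rw [hm, show (θ₁ - -θ₁) * (1 / (4 * s) * Real.exp (-1 / 2) * Real.exp (-1))
      = (θ₁ / (2 * s)) * (Real.exp (-1 / 2) * Real.exp (-1)) by field_simp; ring,
      show θ₁ / (10 * s) = (θ₁ / (2 * s)) * (1 / 5) by field_simp; ring]
    gcongr
  linarith

end Estimates

/-! ### Concentration and Borel–Cantelli -/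

section BorelCantelli

variable {Ω : Type*} [MeasurableSpace Ω] {P : Measure Ω} [IsProbabilityMeasure P]

theorem ae_eventually_notMem_of_le_summable {s : ℕ → Set Ω} {u : ℕ → ℝ} (hu : Summable u)
    (h : ∀ᶠ n in atTop, P.real (s n) ≤ u n) : ∀ᵐ ω ∂P, ∀ᶠ n in atTop, ω ∉ s n := by
  obtain ⟨n₀, hn₀⟩ := eventually_atTop.1 h
  have h1 : ∑' n, P (s (n + n₀)) ≠ ∞ := by
    have h2 : Summable fun n => u (n + n₀) := (summable_nat_add_iff n₀).2 hu
    have h0 : ∀ n, 0 ≤ u (n + n₀) := fun n =>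
      measureReal_nonneg.trans (hn₀ (n + n₀) (Nat.le_add_left _ _))
    have h3 : ∑' n, P (s (n + n₀)) ≤ ∑' n, ENNReal.ofReal (u (n + n₀)) := by
      refine ENNReal.tsum_le_tsum fun n => ?_
      rw [← ofReal_measureReal]
      exact ENNReal.ofReal_le_ofReal (hn₀ _ (Nat.le_add_left _ _))
    rw [← ENNReal.ofReal_tsum_of_nonneg h0 h2] at h3
    exact ne_top_of_le_ne_top ENNReal.ofReal_ne_top h3
  filter_upwards [ae_eventually_notMem h1] with ω hω
  obtain ⟨n₁, hn₁⟩ := eventually_atTop.1 hω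
  refine eventually_atTop.2 ⟨n₁ + n₀, fun n hn => ?_⟩
  have := hn₁ (n - n₀) (by omega)
  rwa [Nat.sub_add_cancel (by omega)] at this

theorem summable_exp_neg_rpow {γ : ℝ} (hγ : 0 < γ) :
    Summable fun n : ℕ => Real.exp (-((n : ℝ) ^ γ)) := by
  have h1 := (isLittleO_exp_neg_mul_rpow_atTop (zero_lt_one (α := ℝ)) (-2 / γ)).isBigO
  have h2 : Tendsto (fun n : ℕ => (n : ℝ) ^ γ) atTop atTop :=
    (tendsto_rpow_atTop hγ).comp tendsto_natCast_atTop_atTop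
  have h3 := h1.comp_tendsto h2
  refine summable_of_isBigO_nat (g := fun n : ℕ => ((n : ℝ) ^ γ) ^ (-2 / γ)) ?_
    (by simpa [Function.comp_def] using h3)
  have : (fun n : ℕ => ((n : ℝ) ^ γ) ^ (-2 / γ)) = fun n : ℕ => (n : ℝ) ^ (-2 : ℝ) := by
    ext n
    rw [← Real.rpow_mul (Nat.cast_nonneg n)]
    congr 1
    field_simp
  rw [this]
  exact Real.summable_nat_rpow.2 (by norm_num)

/-- Chernoff's lower tail bound for the number of independent variables falling into a set. -/
theorem measureReal_sum_indicator_lt_le {n : ℕ} {Y : ℕ → Ω → ℝ} (hY : ∀ j < n, Measurable (Y j))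
    (hind : iIndepFun (fun (j : Fin n) => Y j) P) {B : Set ℝ} (hB : MeasurableSet B) {m : ℝ}
    (hm : 4 * m ≤ ∑ j ∈ Finset.range n, P.real {ω | Y j ω ∈ B}) :
    P.real {ω | ∑ j ∈ Finset.range n, B.indicator (1 : ℝ → ℝ) (Y j ω) < m} ≤ Real.exp (-m) := by
  set N : Ω → ℝ := fun ω => ∑ j ∈ Finset.range n, B.indicator (1 : ℝ → ℝ) (Y j ω)
  have hNm : Measurable N := Finset.measurable_sum _ fun j hj =>
    (measurable_one.indicator hB).comp (hY j (Finset.mem_range.1 hj))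
  have hprod : ∫ ω, Real.exp (-N ω) ∂P
      = ∏ j : Fin n, ∫ ω, Real.exp (-B.indicator (1 : ℝ → ℝ) (Y j ω)) ∂P := by
    rw [← hind.integral_fun_prod_comp (f := fun _ y => Real.exp (-B.indicator (1 : ℝ → ℝ) y))
      (fun j => (hY j j.2).aemeasurable)
      (fun j => (Real.measurable_exp.comp (measurable_one.indicator hB).neg).aestronglyMeasurable)]
    refine integral_congr_ae (Eventually.of_forall fun ω => ?_)
    simp only [N]
    rw [← Finset.sum_neg_distrib, Real.exp_sum, Finset.prod_range]
  have hfac : ∀ j : Fin n, ∫ ω, Real.exp (-B.indicator (1 : ℝ → ℝ) (Y j ω)) ∂P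
      ≤ Real.exp (-(P.real {ω | Y j ω ∈ B} / 2)) := by
    intro j
    have hS : MeasurableSet {ω | Y j ω ∈ B} := hY j j.2 hB
    have h1 : ∀ ω, Real.exp (-B.indicator (1 : ℝ → ℝ) (Y j ω))
        ≤ 1 - 1 / 2 * {ω | Y j ω ∈ B}.indicator 1 ω := by
      intro ω
      by_cases hω : Y j ω ∈ B
      · rw [indicator_of_mem hω, indicator_of_mem (by exact hω)]
        have h2 : Real.exp (-1) ≤ 1 / 2 := by
          rw [Real.exp_neg, ← one_div]
          exact one_div_le_one_div_of_le (by norm_num) (by linarith [Real.add_one_le_exp (1 : ℝ)])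
        simp only [Pi.one_apply]
        linarith
      · rw [indicator_of_notMem hω, indicator_of_notMem (by exact hω)]
        simp
    have hi : Integrable ({ω | Y j ω ∈ B}.indicator (1 : Ω → ℝ)) P :=
      (integrable_const (1 : ℝ)).indicator hS
    have h2 := integral_mono_of_nonneg (μ := P) (Eventually.of_forall fun ω =>
      (Real.exp_pos (-B.indicator (1 : ℝ → ℝ) (Y j ω))).le)
      ((integrable_const (1 : ℝ)).sub (hi.const_mul (1 / 2))) (Eventually.of_forall h1)
    simp only [Pi.sub_apply] at h2
    rw [integral_sub (integrable_const _) (hi.const_mul _), integral_const_mul,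
      integral_indicator_one hS, integral_const, probReal_univ, one_smul] at h2
    have h3 := Real.add_one_le_exp (-(P.real {ω | Y j ω ∈ B} / 2))
    linarith
  have hE : ∫ ω, Real.exp (-N ω) ∂P ≤ Real.exp (-(2 * m)) := by
    rw [hprod]
    refine (Finset.prod_le_prod (fun j _ => integral_nonneg fun ω => (Real.exp_pos _).le)
      fun j _ => hfac j).trans ?_
    rw [← Real.exp_sum, Real.exp_le_exp, Finset.sum_neg_distrib, neg_le_neg_iff, ← Finset.sum_div]
    rw [Finset.sum_range] at hm
    linarith
  have hint : Integrable (fun ω => Real.exp (-N ω)) P := by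
    refine Integrable.mono' (integrable_const (1 : ℝ))
      (Real.measurable_exp.comp hNm.neg).aestronglyMeasurable (Eventually.of_forall fun ω => ?_)
    rw [Real.norm_eq_abs, Real.abs_exp, Real.exp_le_one_iff, neg_nonpos]
    exact Finset.sum_nonneg fun j _ => indicator_nonneg (fun _ _ => zero_le_one) _
  have hmk := mul_meas_ge_le_integral_of_nonneg (μ := P)
    (Eventually.of_forall fun ω => (Real.exp_pos (-N ω)).le) hint (Real.exp (-m))
  have hsub : P.real {ω | N ω < m} ≤ P.real {ω | Real.exp (-m) ≤ Real.exp (-N ω)} :=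
    measureReal_mono fun ω hω => Real.exp_le_exp.2 (neg_le_neg (le_of_lt hω))
  have h5 : Real.exp (-m) * P.real {ω | N ω < m} ≤ Real.exp (-m) * Real.exp (-m) := by
    rw [← Real.exp_add, show -m + -m = -(2 * m) by ring]
    exact (mul_le_mul_of_nonneg_left hsub (Real.exp_pos _).le).trans (hmk.trans hE)
  exact le_of_mul_le_mul_left h5 (Real.exp_pos _)

/-- If the expected number of independent variables falling into `B n` grows like a power of `n`,
so does that number, almost surely. -/
theorem ae_eventually_rpow_le_sum_indicator {Y : ℕ → ℕ → Ω → ℝ}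
    (hY : ∀ n, ∀ j < n, Measurable (Y n j))
    (hind : ∀ n, iIndepFun (fun (j : Fin n) => Y n j) P) {B : ℕ → Set ℝ}
    (hB : ∀ n, MeasurableSet (B n)) {γ : ℝ} (hγ : 0 < γ)
    (h : ∀ᶠ n : ℕ in atTop,
      4 * (n : ℝ) ^ γ ≤ ∑ j ∈ Finset.range n, P.real {ω | Y n j ω ∈ B n}) :
    ∀ᵐ ω ∂P, ∀ᶠ n : ℕ in atTop,
      (n : ℝ) ^ γ ≤ ∑ j ∈ Finset.range n, (B n).indicator (1 : ℝ → ℝ) (Y n j ω) := by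
  have h1 := ae_eventually_notMem_of_le_summable (P := P) (summable_exp_neg_rpow hγ)
    (h.mono fun n hn => measureReal_sum_indicator_lt_le (hY n) (hind n) (hB n) hn)
  filter_upwards [h1] with ω hω
  filter_upwards [hω] with n hn
  exact not_lt.1 hn

/-- Along the powers of `2`, the number of variables falling into `B n` almost surely exceeds the
order of its expectation by at most any small power. -/
theorem ae_eventually_sum_indicator_le_rpow {Y : ℕ → ℕ → Ω → ℝ}
    (hY : ∀ n, ∀ j < n, Measurable (Y n j)) {B : ℕ → Set ℝ} (hB : ∀ n, MeasurableSet (B n))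
    {g η C : ℝ} (hη : 0 < η)
    (h : ∀ n : ℕ, 1 ≤ n →
      ∑ j ∈ Finset.range n, P.real {ω | Y n j ω ∈ B n} ≤ C * (n : ℝ) ^ g) :
    ∀ᵐ ω ∂P, ∀ᶠ k : ℕ in atTop,
      ∑ j ∈ Finset.range (2 ^ k), (B (2 ^ k)).indicator (1 : ℝ → ℝ) (Y (2 ^ k) j ω)
        ≤ ((2 ^ k : ℕ) : ℝ) ^ (g + η) := by
  have hsum : Summable fun k : ℕ => C * ((2 : ℝ) ^ (-η)) ^ k :=
    (summable_geometric_of_lt_one (by positivity)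
      (Real.rpow_lt_one_of_one_lt_of_neg (by norm_num) (by linarith))).mul_left C
  have h1 := ae_eventually_notMem_of_le_summable (P := P) (s := fun k : ℕ =>
    {ω | ((2 ^ k : ℕ) : ℝ) ^ (g + η) ≤
      ∑ j ∈ Finset.range (2 ^ k), (B (2 ^ k)).indicator (1 : ℝ → ℝ) (Y (2 ^ k) j ω)}) hsum
    (Eventually.of_forall fun k => ?_)
  · filter_upwards [h1] with ω hω
    filter_upwards [hω] with k hk
    exact (not_le.1 hk).le
  · set n : ℕ := 2 ^ k with hn
    have hn1 : 1 ≤ n := Nat.one_le_two_pow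
    have hn0 : (0 : ℝ) < n := by exact_mod_cast hn1
    have hi : ∀ j ∈ Finset.range n,
        Integrable (fun ω => (B n).indicator (1 : ℝ → ℝ) (Y n j ω)) P := by
      intro j hj
      have : (fun ω => (B n).indicator (1 : ℝ → ℝ) (Y n j ω))
          = {ω | Y n j ω ∈ B n}.indicator (fun _ => (1 : ℝ)) := by
        ext ω; by_cases hω : Y n j ω ∈ B n <;> simp [hω]
      rw [this]
      exact (integrable_const (1 : ℝ)).indicator (hY n j (Finset.mem_range.1 hj) (hB n))
    have hE : ∫ ω, ∑ j ∈ Finset.range n, (B n).indicator (1 : ℝ → ℝ) (Y n j ω) ∂P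
        = ∑ j ∈ Finset.range n, P.real {ω | Y n j ω ∈ B n} := by
      rw [integral_finsetSum _ hi]
      refine Finset.sum_congr rfl fun j hj => ?_
      rw [show {ω | Y n j ω ∈ B n} = Y n j ⁻¹' B n from rfl,
        ← integral_indicator_one (hY n j (Finset.mem_range.1 hj) (hB n))]
      refine integral_congr_ae (Eventually.of_forall fun ω => ?_)
      by_cases hω : Y n j ω ∈ B n <;> simp [hω]
    have hmk := mul_meas_ge_le_integral_of_nonneg (μ := P)
      (f := fun ω => ∑ j ∈ Finset.range n, (B n).indicator (1 : ℝ → ℝ) (Y n j ω))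
      (Eventually.of_forall fun ω => Finset.sum_nonneg fun j _ =>
        indicator_nonneg (fun _ _ => zero_le_one) (Y n j ω))
      (integrable_finsetSum _ hi) ((n : ℝ) ^ (g + η))
    rw [hE] at hmk
    have h2 := hmk.trans (h n hn1)
    have h3 : (n : ℝ) ^ η * P.real {ω | (n : ℝ) ^ (g + η) ≤
        ∑ j ∈ Finset.range n, (B n).indicator (1 : ℝ → ℝ) (Y n j ω)} ≤ C := by
      refine le_of_mul_le_mul_left ?_ (Real.rpow_pos_of_pos hn0 g)
      rwa [← mul_assoc, ← Real.rpow_add hn0, mul_comm _ C]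
    have h4 : ((2 : ℝ) ^ (-η)) ^ k = ((n : ℝ) ^ η)⁻¹ := by
      rw [hn, ← Real.rpow_natCast, ← Real.rpow_mul (by norm_num), Nat.cast_pow, Nat.cast_ofNat,
        ← Real.rpow_natCast, ← Real.rpow_mul (by norm_num), ← Real.rpow_neg (by norm_num)]
      congr 1; ring
    rw [h4, ← div_eq_mul_inv, le_div_iff₀ (Real.rpow_pos_of_pos hn0 η), mul_comm]
    exact h3

end BorelCantelli

/-! ### Independent increments with a variable stability index -/

/-- The characteristic exponent `θ ↦ ∫ |θ|^{α(v)} dv` of the increment over the `j`-th cell of the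
subdivision of `[0,1]` into `n` equal intervals. -/
noncomputable def cellExponent (α : ℝ → ℝ) (n j : ℕ) (θ : ℝ) : ℝ :=
  ∫ v in ((j : ℝ) / n)..(((j : ℝ) + 1) / n), |θ| ^ α v

section CellExponent

variable {α : ℝ → ℝ} {c d : ℝ}

theorem continuous_rpow_index (hα : Continuous α) (hpos : ∀ v, 0 < α v) (x : ℝ) :
    Continuous fun v => x ^ α v :=
  Continuous.rpow continuous_const hα fun v => Or.inr (hpos v)

theorem cell_le {n : ℕ} (j : ℕ) : (j : ℝ) / n ≤ ((j : ℝ) + 1) / n := by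
  gcongr; linarith

theorem cell_length {n : ℕ} (j : ℕ) : ((j : ℝ) + 1) / n - (j : ℝ) / n = (n : ℝ)⁻¹ := by
  rw [← sub_div, add_sub_cancel_left, one_div]

theorem isScalingExponent_cellExponent (hα : Continuous α) (hc : 0 < c) (hcα : ∀ v, c ≤ α v)
    (hαd : ∀ v, α v ≤ d) (n j : ℕ) : IsScalingExponent (cellExponent α n j) c d := by
  have hpos : ∀ v, 0 < α v := fun v => hc.trans_le (hcα v)
  have hi : ∀ x : ℝ, IntervalIntegrable (fun v => x ^ α v) volume ((j : ℝ) / n)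
      (((j : ℝ) + 1) / n) := fun x => (continuous_rpow_index hα hpos x).intervalIntegrable _ _
  constructor
  · intro θ
    exact intervalIntegral.integral_nonneg (cell_le j) fun v _ =>
      Real.rpow_nonneg (abs_nonneg _) _
  · intro θ
    simp only [cellExponent, abs_neg]
  · intro r θ hr
    rw [cellExponent, cellExponent, ← intervalIntegral.integral_const_mul]
    refine intervalIntegral.integral_mono_on (cell_le j) ((hi _).const_mul _) (hi _) fun v _ => ?_
    rw [abs_mul, Real.mul_rpow (abs_nonneg _) (abs_nonneg _), abs_of_nonneg (show 0 ≤ r by linarith)]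
    have := Real.rpow_le_rpow_of_exponent_le hr (hcα v)
    exact mul_le_mul_of_nonneg_right this (Real.rpow_nonneg (abs_nonneg _) _)
  · intro r θ hr
    rw [cellExponent, cellExponent, ← intervalIntegral.integral_const_mul]
    refine intervalIntegral.integral_mono_on (cell_le j) (hi _) ((hi _).const_mul _) fun v _ => ?_
    rw [abs_mul, Real.mul_rpow (abs_nonneg _) (abs_nonneg _), abs_of_nonneg (show 0 ≤ r by linarith)]
    have := Real.rpow_le_rpow_of_exponent_le hr (hαd v)
    exact mul_le_mul_of_nonneg_right this (Real.rpow_nonneg (abs_nonneg _) _)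

theorem cellExponent_le_of_forall (hα : Continuous α) (hpos : ∀ v, 0 < α v) {n j : ℕ} {θ K : ℝ}
    (h : ∀ v ∈ Icc ((j : ℝ) / n) (((j : ℝ) + 1) / n), |θ| ^ α v ≤ K) :
    cellExponent α n j θ ≤ (n : ℝ)⁻¹ * K := by
  have h1 := intervalIntegral.integral_mono_on (μ := volume) (cell_le j)
    ((continuous_rpow_index hα hpos |θ|).intervalIntegrable _ _)
    (intervalIntegrable_const (c := K)) h
  rwa [intervalIntegral.integral_const, cell_length, smul_eq_mul] at h1

theorem le_cellExponent_of_forall (hα : Continuous α) (hpos : ∀ v, 0 < α v) {n j : ℕ} {θ K : ℝ}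
    (h : ∀ v ∈ Icc ((j : ℝ) / n) (((j : ℝ) + 1) / n), K ≤ |θ| ^ α v) :
    (n : ℝ)⁻¹ * K ≤ cellExponent α n j θ := by
  have h1 := intervalIntegral.integral_mono_on (μ := volume) (cell_le j)
    (intervalIntegrable_const (c := K))
    ((continuous_rpow_index hα hpos |θ|).intervalIntegrable _ _) h
  rwa [intervalIntegral.integral_const, cell_length, smul_eq_mul] at h1

theorem cellExponent_le (hα : Continuous α) (hpos : ∀ v, 0 < α v) {n j : ℕ} {θ a : ℝ}
    (hθ : 1 ≤ θ) (h : ∀ v ∈ Icc ((j : ℝ) / n) (((j : ℝ) + 1) / n), α v ≤ a) :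
    cellExponent α n j θ ≤ (n : ℝ)⁻¹ * θ ^ a :=
  cellExponent_le_of_forall hα hpos fun v hv => by
    rw [abs_of_nonneg (by linarith)]
    exact Real.rpow_le_rpow_of_exponent_le hθ (h v hv)

theorem le_cellExponent (hα : Continuous α) (hpos : ∀ v, 0 < α v) {n j : ℕ} {θ a : ℝ}
    (hθ : 1 ≤ θ) (h : ∀ v ∈ Icc ((j : ℝ) / n) (((j : ℝ) + 1) / n), a ≤ α v) :
    (n : ℝ)⁻¹ * θ ^ a ≤ cellExponent α n j θ :=
  le_cellExponent_of_forall hα hpos fun v hv => by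
    rw [abs_of_nonneg (by linarith)]
    exact Real.rpow_le_rpow_of_exponent_le hθ (h v hv)

theorem cellExponent_le_of_le_one (hα : Continuous α) (hpos : ∀ v, 0 < α v)
    (hcα : ∀ v, c ≤ α v) {n j : ℕ} {θ : ℝ} (hθ0 : 0 < θ) (hθ : θ ≤ 1) :
    cellExponent α n j θ ≤ (n : ℝ)⁻¹ * θ ^ c :=
  cellExponent_le_of_forall hα hpos fun v _ => by
    rw [abs_of_pos hθ0]
    exact Real.rpow_le_rpow_of_exponent_ge hθ0 hθ (hcα v)

end CellExponent

/-- The random function `X` has independent increments over every regular subdivision of `[0,1]`,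
with characteristic exponents `θ ↦ ∫ |θ|^{α(v)} dv`. -/
structure HasMultistableIncrements {Ω : Type*} [MeasurableSpace Ω] (P : Measure Ω)
    (X : Ω → ℝ → ℝ) (α : ℝ → ℝ) : Prop where
  measurable : ∀ n, ∀ j < n, Measurable fun ω => gridIncrement (X ω) n j
  indep : ∀ n, iIndepFun (fun (j : Fin n) ω => gridIncrement (X ω) n j) P
  charFun_eq : ∀ n, ∀ j < n, ∀ θ, charFun (P.map fun ω => gridIncrement (X ω) n j) θ
    = (Real.exp (-cellExponent α n j θ) : ℝ)

section Counting

variable {Ω : Type*} [MeasurableSpace Ω] {P : Measure Ω} [IsProbabilityMeasure P]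
  {X : Ω → ℝ → ℝ} {α : ℝ → ℝ} {c d : ℝ}

theorem coarseCount_eq_sum_indicator (X : ℝ → ℝ) (ε β : ℝ) {n : ℕ} (hn : 2 ≤ n) :
    (coarseCount X ε β n : ℝ) = ∑ j ∈ Finset.range n,
      {y : ℝ | (n : ℝ) ^ (-(β + ε)) ≤ |y| ∧ |y| ≤ (n : ℝ) ^ (-(β - ε))}.indicator (1 : ℝ → ℝ)
        (gridIncrement X n j) := by
  classical
  have hn0 : (0 : ℝ) < n := by positivity
  have hlog : 0 < Real.log n := Real.log_pos (by exact_mod_cast hn)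
  set B : Set ℝ := {y : ℝ | (n : ℝ) ^ (-(β + ε)) ≤ |y| ∧ |y| ≤ (n : ℝ) ^ (-(β - ε))}
  have hset : {j : ℕ | j < n ∧ gridIncrement X n j ≠ 0 ∧
      β - ε ≤ Real.log |gridIncrement X n j| / (-Real.log n) ∧
      Real.log |gridIncrement X n j| / (-Real.log n) ≤ β + ε}
      = ((Finset.range n).filter fun j => gridIncrement X n j ∈ B : Finset ℕ) := by
    ext j
    simp only [mem_ofPred_eq, Finset.coe_filter, Finset.mem_range]
    refine and_congr_right fun _ => ?_
    have key : ∀ x : ℝ, x ≠ 0 → ((β - ε ≤ Real.log |x| / (-Real.log n) ∧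
        Real.log |x| / (-Real.log n) ≤ β + ε) ↔ x ∈ B) := by
      intro x hx
      have hx' : 0 < |x| := abs_pos.2 hx
      simp only [B, mem_ofPred_eq]
      rw [div_neg, le_neg, neg_le, div_le_iff₀ hlog, le_div_iff₀ hlog, ← Real.log_rpow hn0,
        ← Real.log_rpow hn0, Real.log_le_log_iff hx' (Real.rpow_pos_of_pos hn0 _),
        Real.log_le_log_iff (Real.rpow_pos_of_pos hn0 _) hx', and_comm]
    constructor
    · rintro ⟨h1, h2⟩
      exact (key _ h1).1 h2
    · intro h1
      have h0 : gridIncrement X n j ≠ 0 := by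
        intro h0
        have := h1.1
        rw [h0, abs_zero] at this
        exact absurd this (not_le.2 (Real.rpow_pos_of_pos hn0 _))
      exact ⟨h0, (key _ h0).2 h1⟩
  rw [coarseCount, hset, ncard_coe_finset, Finset.card_filter]
  push_cast
  refine Finset.sum_congr rfl fun j _ => ?_
  by_cases hj : gridIncrement X n j ∈ B <;> simp [hj]

/-- A nondegenerate interval near `t` on which `α` is almost constant; it lies to the right of `t`,
or to the left when `t = 1`. -/
theorem exists_Icc_abs_sub_le (hα : Continuous α) {t : ℝ} (ht : t ∈ Icc (0 : ℝ) 1) {e : ℝ}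
    (he : 0 < e) : ∃ p q : ℝ, 0 ≤ p ∧ p < q ∧ q ≤ 1 ∧ ∀ v ∈ Icc p q, |α v - α t| ≤ e := by
  obtain ⟨δ, hδ, h⟩ := Metric.continuous_iff.1 hα t e he
  rcases ht.2.lt_or_eq with h1 | h1
  · refine ⟨t, min 1 (t + δ / 2), ht.1, lt_min h1 (by linarith), min_le_left _ _, fun v hv => ?_⟩
    have h2 := hv.2.trans (min_le_right _ _)
    exact (h v (by rw [Real.dist_eq, abs_of_nonneg (by linarith [hv.1])]; linarith [hv.1])).le
  · refine ⟨max 0 (t - δ / 2), t, le_max_left _ _, max_lt (by linarith) (by linarith), ht.2,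
      fun v hv => ?_⟩
    have h2 := (le_max_right _ _).trans hv.1
    exact (h v (by rw [Real.dist_eq, abs_of_nonpos (by linarith [hv.2])]; linarith [hv.1])).le

/-- A positive proportion of the cells lies in a given subinterval. -/
theorem eventually_le_card_cells {p q : ℝ} (hp : 0 ≤ p) (hpq : p < q) (hq : q ≤ 1) :
    ∀ᶠ n : ℕ in atTop, (q - p) / 2 * n ≤ (((Finset.range n).filter fun j : ℕ =>
      p ≤ (j : ℝ) / n ∧ ((j : ℝ) + 1) / n ≤ q).card : ℝ) := by
  have h1 : ∀ᶠ n : ℕ in atTop, 4 / (q - p) ≤ (n : ℝ) :=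
    tendsto_natCast_atTop_atTop.eventually_ge_atTop _
  filter_upwards [h1, eventually_gt_atTop 0] with n hn hn0
  have hn0' : (0 : ℝ) < n := by exact_mod_cast hn0
  rw [div_le_iff₀ (by linarith)] at hn
  have hsub : Finset.Ico ⌈n * p⌉₊ ⌊n * q⌋₊ ⊆ (Finset.range n).filter fun j : ℕ =>
      p ≤ (j : ℝ) / n ∧ ((j : ℝ) + 1) / n ≤ q := by
    intro j hj
    rw [Finset.mem_Ico] at hj
    rw [Finset.mem_filter, Finset.mem_range, le_div_iff₀ hn0', div_le_iff₀ hn0']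
    have h2 : (n : ℝ) * p ≤ j := (Nat.le_ceil _).trans (by exact_mod_cast hj.1)
    have h3 : ((j : ℝ) + 1) ≤ n * q := by
      refine le_trans ?_ (Nat.floor_le (by nlinarith))
      exact_mod_cast hj.2
    refine ⟨?_, by linarith, by linarith⟩
    have : (j : ℝ) + 1 ≤ n := by nlinarith
    have : j + 1 ≤ n := by exact_mod_cast this
    omega
  have h4 := Finset.card_le_card hsub
  rw [Nat.card_Ico] at h4
  have h5 : (n : ℝ) * q - 1 < ⌊n * q⌋₊ := Nat.sub_one_lt_floor _
  have h6 : (⌈n * p⌉₊ : ℝ) < n * p + 1 := Nat.ceil_lt_add_one (by positivity)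
  have h7 : ((⌊n * q⌋₊ - ⌈n * p⌉₊ : ℕ) : ℝ) ≤ (((Finset.range n).filter fun j : ℕ =>
      p ≤ (j : ℝ) / n ∧ ((j : ℝ) + 1) / n ≤ q).card : ℝ) := by exact_mod_cast h4
  have h8 : (⌊n * q⌋₊ : ℝ) - ⌈n * p⌉₊ ≤ ((⌊n * q⌋₊ - ⌈n * p⌉₊ : ℕ) : ℝ) := by
    have h9 : ⌊n * q⌋₊ ≤ (⌊n * q⌋₊ - ⌈n * p⌉₊) + ⌈n * p⌉₊ := by omega
    rw [sub_le_iff_le_add]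
    exact_mod_cast h9
  nlinarith

namespace HasMultistableIncrements

theorem prob_gt_le (hX : HasMultistableIncrements P X α) (hα : Continuous α) (hc : 0 < c)
    (hcα : ∀ v, c ≤ α v) (hαd : ∀ v, α v ≤ d) (hd : d < 2) {n j : ℕ} (hj : j < n) {x : ℝ}
    (hx : 0 < x) :
    P.real {ω | x < |gridIncrement (X ω) n j|} ≤ 8 * cellExponent α n j x⁻¹ := by
  have hm := hX.measurable n j hj
  have := Measure.isProbabilityMeasure_map (μ := P) hm.aemeasurable
  have h := measureReal_abs_gt_le (hX.charFun_eq n j hj)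
    (isScalingExponent_cellExponent hα hc hcα hαd n j) hc hd hx
  rwa [map_measureReal_apply hm (measurableSet_lt measurable_const measurable_abs)] at h

theorem exists_le_prob_gt (hX : HasMultistableIncrements P X α) (hα : Continuous α) (hc : 0 < c)
    (hcα : ∀ v, c ≤ α v) (hαd : ∀ v, α v ≤ d) (hd : d < 2) :
    ∃ κ : ℝ, 0 < κ ∧ ∀ n, ∀ j < n, ∀ x : ℝ, 0 < x → cellExponent α n j x⁻¹ ≤ 1 →
      κ * cellExponent α n j x⁻¹ ≤ P.real {ω | x < |gridIncrement (X ω) n j|} := by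
  obtain ⟨κ, hκ, h⟩ := exists_le_measureReal_abs_gt d hd
  refine ⟨κ, hκ, fun n j hj x hx hψ => ?_⟩
  have hm := hX.measurable n j hj
  have := Measure.isProbabilityMeasure_map (μ := P) hm.aemeasurable
  have h1 := h _ c _ this (hX.charFun_eq n j hj)
    (isScalingExponent_cellExponent hα hc hcα hαd n j) hc x hx hψ
  rwa [map_measureReal_apply hm (measurableSet_lt measurable_const measurable_abs)] at h1

theorem prob_le_le (hX : HasMultistableIncrements P X α) (hα : Continuous α) (hc : 1 < c)
    (hcα : ∀ v, c ≤ α v) (hαd : ∀ v, α v ≤ d) {n j : ℕ} (hj : j < n) {x : ℝ} (hx : 0 < x) :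
    P.real {ω | |gridIncrement (X ω) n j| ≤ x} ≤ 10 * x * (n : ℝ) ^ (1 / c) := by
  have hm := hX.measurable n j hj
  have := Measure.isProbabilityMeasure_map (μ := P) hm.aemeasurable
  have hc0 : 0 < c := by linarith
  have hn : (1 : ℝ) ≤ n := by exact_mod_cast (show 1 ≤ n by omega)
  have hn0 : (0 : ℝ) < n := by linarith
  have hψ : 1 ≤ cellExponent α n j ((n : ℝ) ^ (1 / c)) := by
    have h1 := le_cellExponent hα (fun v => hc0.trans_le (hcα v)) (n := n) (j := j) (a := c)
      (Real.one_le_rpow hn (by positivity) : 1 ≤ (n : ℝ) ^ (1 / c)) fun v _ => hcα v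
    rwa [← Real.rpow_mul hn0.le, one_div_mul_cancel hc0.ne', Real.rpow_one,
      inv_mul_cancel₀ hn0.ne'] at h1
  have h := measureReal_abs_le_le (hX.charFun_eq n j hj)
    (isScalingExponent_cellExponent hα hc0 hcα hαd n j) hc.le hx (Real.rpow_pos_of_pos hn0 _) hψ
  rwa [map_measureReal_apply hm (measurableSet_le measurable_abs measurable_const)] at h

theorem le_prob_le (hX : HasMultistableIncrements P X α) (hα : Continuous α) (hc : 0 < c)
    (hcα : ∀ v, c ≤ α v) (hαd : ∀ v, α v ≤ d) {n j : ℕ} (hj : j < n) {x s a : ℝ} (hx : 0 ≤ x)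
    (ha : 0 < a) (hs : (n : ℝ) ^ (1 / a) ≤ s)
    (h : ∀ v ∈ Icc ((j : ℝ) / n) (((j : ℝ) + 1) / n), α v ≤ a) :
    (n : ℝ) ^ (1 / a) / (10 * s) - Real.exp (-(s ^ 2 * x ^ 2 / 2))
      ≤ P.real {ω | |gridIncrement (X ω) n j| ≤ x} := by
  have hm := hX.measurable n j hj
  have := Measure.isProbabilityMeasure_map (μ := P) hm.aemeasurable
  have hn : (1 : ℝ) ≤ n := by exact_mod_cast (show 1 ≤ n by omega)
  have hn0 : (0 : ℝ) < n := by linarith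
  have hψ : cellExponent α n j ((n : ℝ) ^ (1 / a)) ≤ 1 := by
    have h1 := cellExponent_le hα (fun v => hc.trans_le (hcα v)) (n := n) (j := j) (a := a)
      (Real.one_le_rpow hn (by positivity) : 1 ≤ (n : ℝ) ^ (1 / a)) h
    rwa [← Real.rpow_mul hn0.le, one_div_mul_cancel ha.ne', Real.rpow_one,
      inv_mul_cancel₀ hn0.ne'] at h1
  have h := le_measureReal_abs_le (hX.charFun_eq n j hj)
    (isScalingExponent_cellExponent hα hc hcα hαd n j) hc hx (Real.rpow_pos_of_pos hn0 _) hs hψ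
  rwa [map_measureReal_apply hm (measurableSet_le measurable_abs measurable_const)] at h

/-- Large increments along the powers of `2`: at most about `n ^ (s d)` of them exceed `n ^ (-s)`
when `s ≥ 0`, and eventually none does when `s < 0`. -/
theorem ae_eventually_card_gt_le (hX : HasMultistableIncrements P X α) (hα : Continuous α)
    (hc : 0 < c) (hcα : ∀ v, c ≤ α v) (hαd : ∀ v, α v ≤ d) (hd : d < 2) (s : ℝ) {η : ℝ}
    (hη : 0 < η) : ∀ᵐ ω ∂P, ∀ᶠ k : ℕ in atTop,
      ∑ j ∈ Finset.range (2 ^ k), {y : ℝ | ((2 ^ k : ℕ) : ℝ) ^ (-s) < |y|}.indicator (1 : ℝ → ℝ)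
        (gridIncrement (X ω) (2 ^ k) j) ≤ ((2 ^ k : ℕ) : ℝ) ^ (max (s * d) (s * c) + η) := by
  refine ae_eventually_sum_indicator_le_rpow (Y := fun n j ω => gridIncrement (X ω) n j)
    (B := fun n => {y : ℝ | (n : ℝ) ^ (-s) < |y|}) hX.measurable
    (fun n => measurableSet_lt measurable_const measurable_abs) (C := 8) hη fun n hn => ?_
  have hn1 : (1 : ℝ) ≤ n := by exact_mod_cast hn
  have hn0 : (0 : ℝ) < n := by linarith
  have hpos : ∀ v, 0 < α v := fun v => hc.trans_le (hcα v)
  have hterm : ∀ j ∈ Finset.range n,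
      P.real {ω | gridIncrement (X ω) n j ∈ {y : ℝ | (n : ℝ) ^ (-s) < |y|}}
        ≤ 8 * ((n : ℝ)⁻¹ * (n : ℝ) ^ (max (s * d) (s * c))) := by
    intro j hj
    refine (hX.prob_gt_le hα hc hcα hαd hd (Finset.mem_range.1 hj)
      (Real.rpow_pos_of_pos hn0 _)).trans ?_
    rw [← Real.rpow_neg hn0.le, neg_neg]
    gcongr
    rcases le_total 0 s with hs | hs
    · refine (cellExponent_le hα hpos (Real.one_le_rpow hn1 hs) fun v _ => hαd v).trans ?_
      rw [← Real.rpow_mul hn0.le]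
      gcongr
      exact le_max_left _ _
    · refine (cellExponent_le_of_le_one hα hpos hcα (Real.rpow_pos_of_pos hn0 _)
        (Real.rpow_le_one_of_one_le_of_nonpos hn1 hs)).trans ?_
      rw [← Real.rpow_mul hn0.le]
      gcongr
      exact le_max_right _ _
  refine (Finset.sum_le_sum hterm).trans (le_of_eq ?_)
  rw [Finset.sum_const, Finset.card_range, nsmul_eq_mul]
  field_simp

/-- Small increments along the powers of `2`: at most about `n ^ (1 + 1 / c - s)` of them are
bounded by `n ^ (-s)`. -/
theorem ae_eventually_card_le_le (hX : HasMultistableIncrements P X α) (hα : Continuous α)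
    (hc : 1 < c) (hcα : ∀ v, c ≤ α v) (hαd : ∀ v, α v ≤ d) (s : ℝ) {η : ℝ}
    (hη : 0 < η) : ∀ᵐ ω ∂P, ∀ᶠ k : ℕ in atTop,
      ∑ j ∈ Finset.range (2 ^ k), {y : ℝ | |y| ≤ ((2 ^ k : ℕ) : ℝ) ^ (-s)}.indicator (1 : ℝ → ℝ)
        (gridIncrement (X ω) (2 ^ k) j) ≤ ((2 ^ k : ℕ) : ℝ) ^ (1 + 1 / c - s + η) := by
  refine ae_eventually_sum_indicator_le_rpow (Y := fun n j ω => gridIncrement (X ω) n j)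
    (B := fun n => {y : ℝ | |y| ≤ (n : ℝ) ^ (-s)}) hX.measurable
    (fun n => measurableSet_le measurable_abs measurable_const) (C := 10) hη fun n hn => ?_
  have hn1 : (1 : ℝ) ≤ n := by exact_mod_cast hn
  have hn0 : (0 : ℝ) < n := by linarith
  refine (Finset.sum_le_sum fun j hj => hX.prob_le_le hα hc hcα hαd (Finset.mem_range.1 hj)
    (Real.rpow_pos_of_pos hn0 (-s))).trans (le_of_eq ?_)
  rw [Finset.sum_const, Finset.card_range, nsmul_eq_mul, sub_eq_add_neg, Real.rpow_add hn0,
    Real.rpow_add hn0, Real.rpow_one]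
  ring

/-- Long runs of small increments do not occur along the powers of `2`: a run of length `m` has
probability of order `n ^ (-m (l - 1 / c))`, and `m` is chosen so that this is at most `n ^ (-2)`. -/
theorem exists_ae_eventually_exists_lt (hX : HasMultistableIncrements P X α) (hα : Continuous α)
    (hc : 1 < c) (hcα : ∀ v, c ≤ α v) (hαd : ∀ v, α v ≤ d) {l : ℝ} (hl : 1 / c < l) :
    ∃ m : ℕ, ∀ᵐ ω ∂P, ∀ᶠ k : ℕ in atTop, ∀ j : ℕ, j + m ≤ 2 ^ k →
      ∃ i < m, ((2 ^ k : ℕ) : ℝ) ^ (-l) < |gridIncrement (X ω) (2 ^ k) (j + i)| := by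
  obtain ⟨m, hm⟩ := exists_nat_ge (2 / (l - 1 / c))
  rw [div_le_iff₀ (by linarith)] at hm
  refine ⟨m, ?_⟩
  have hsum : Summable fun k : ℕ => (10 : ℝ) ^ m * (1 / 2 : ℝ) ^ k :=
    (summable_geometric_of_lt_one (by norm_num) (by norm_num)).mul_left _
  have h1 := ae_eventually_notMem_of_le_summable (P := P) (s := fun k : ℕ =>
    ⋃ j ∈ Finset.range (2 ^ k - m + 1), {ω | j + m ≤ 2 ^ k ∧ ∀ i < m,
      |gridIncrement (X ω) (2 ^ k) (j + i)| ≤ ((2 ^ k : ℕ) : ℝ) ^ (-l)}) hsum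
    (Eventually.of_forall fun k => ?_)
  · filter_upwards [h1] with ω hω
    filter_upwards [hω] with k hk j hj
    by_contra! hcon
    refine hk (mem_biUnion (x := j) ?_ ⟨hj, hcon⟩)
    simp only [Finset.coe_range, mem_Iio]
    omega
  · set n : ℕ := 2 ^ k with hn
    have hn1 : 1 ≤ n := Nat.one_le_two_pow
    have hn1' : (1 : ℝ) ≤ n := by exact_mod_cast hn1
    have hn0 : (0 : ℝ) < n := by linarith
    have hm1 : 1 ≤ m := by
      rcases Nat.eq_zero_or_pos m with h0 | h0
      · rw [h0, Nat.cast_zero, zero_mul] at hm; linarith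
      · exact h0
    have hS : ∀ j, P.real {ω | j + m ≤ n ∧ ∀ i < m,
        |gridIncrement (X ω) n (j + i)| ≤ (n : ℝ) ^ (-l)} ≤ 10 ^ m * ((n : ℝ) ^ 2)⁻¹ := by
      intro j
      by_cases hj : j + m ≤ n
      · let e : Fin m → Fin n := fun i => ⟨j + i, by omega⟩
        have he : Function.Injective e := fun a b hab => by
          have := congrArg Fin.val hab
          simp only [e] at this
          exact Fin.ext (by omega)
        have hind := ((hX.indep n).precomp he).measure_inter_preimage_eq_mul Finset.univ
          (sets := fun _ => {y : ℝ | |y| ≤ (n : ℝ) ^ (-l)})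
          fun i _ => measurableSet_le measurable_abs measurable_const
        have hset : {ω | j + m ≤ n ∧ ∀ i < m,
            |gridIncrement (X ω) n (j + i)| ≤ (n : ℝ) ^ (-l)}
            = ⋂ i ∈ (Finset.univ : Finset (Fin m)),
              (fun ω => gridIncrement (X ω) n (e i)) ⁻¹' {y : ℝ | |y| ≤ (n : ℝ) ^ (-l)} := by
          ext ω
          simp only [mem_ofPred_eq, mem_iInter, Finset.mem_univ, forall_true_left, mem_preimage]
          exact ⟨fun h i => h.2 i i.2, fun h => ⟨hj, fun i hi => h ⟨i, hi⟩⟩⟩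
        rw [hset, measureReal_def, hind, ENNReal.toReal_prod]
        refine (Finset.prod_le_prod (fun i _ => measureReal_nonneg) fun i _ =>
          hX.prob_le_le hα hc hcα hαd (e i).2 (Real.rpow_pos_of_pos hn0 (-l))).trans ?_
        rw [Finset.prod_const]
        rw [Finset.card_univ, Fintype.card_fin, mul_assoc, ← Real.rpow_add hn0, mul_pow,
          ← Real.rpow_natCast ((n : ℝ) ^ (-l + 1 / c)), ← Real.rpow_mul hn0.le,
          ← Real.rpow_natCast (n : ℝ) 2, ← Real.rpow_neg hn0.le]
        gcongr
        push_cast; linarith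
      · have : {ω | j + m ≤ n ∧ ∀ i < m,
            |gridIncrement (X ω) n (j + i)| ≤ (n : ℝ) ^ (-l)} = ∅ := by
          ext ω; simp [hj]
        rw [this, measureReal_empty]
        positivity
    refine (measureReal_biUnion_finset_le _ _).trans ?_
    refine (Finset.sum_le_sum fun j _ => hS j).trans ?_
    rw [Finset.sum_const, Finset.card_range, nsmul_eq_mul]
    have h3 : ((n - m + 1 : ℕ) : ℝ) ≤ n := by
      have : n - m + 1 ≤ n := by omega
      exact_mod_cast this
    calc ((n - m + 1 : ℕ) : ℝ) * (10 ^ m * ((n : ℝ) ^ 2)⁻¹)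
        ≤ n * (10 ^ m * ((n : ℝ) ^ 2)⁻¹) := by gcongr
      _ = 10 ^ m * (n : ℝ)⁻¹ := by field_simp
      _ = 10 ^ m * (1 / 2) ^ k := by rw [hn]; simp

end HasMultistableIncrements

end Counting

/-! ### Lower bounds for the number of increments of a given order -/

section LowerCounts

variable {Ω : Type*} [MeasurableSpace Ω] {P : Measure Ω} [IsProbabilityMeasure P]
  {X : Ω → ℝ → ℝ} {α : ℝ → ℝ} {c d : ℝ}

theorem eventually_le_natCast_rpow {e : ℝ} (he : 0 < e) (K : ℝ) :
    ∀ᶠ n : ℕ in atTop, K ≤ (n : ℝ) ^ e :=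
  ((tendsto_rpow_atTop he).comp tendsto_natCast_atTop_atTop).eventually_ge_atTop K

namespace HasMultistableIncrements

/-- If every cell inside a fixed interval `[p, q]` contributes at least `K n ^ (γ' - 1)` to the
expected number of increments in the window `n ^ (-β ± ε)`, then this number is almost surely
eventually at least `n ^ γ`, for any `0 < γ < γ'`. -/
theorem ae_eventually_rpow_le_coarseCount (hX : HasMultistableIncrements P X α) {p q K γ γ' : ℝ}
    (hp : 0 ≤ p) (hpq : p < q) (hq : q ≤ 1) (hK : 0 < K) (hγ : 0 < γ) (hγ' : γ < γ') {ε β : ℝ}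
    (h : ∀ᶠ n : ℕ in atTop, ∀ j < n, p ≤ (j : ℝ) / n → ((j : ℝ) + 1) / n ≤ q →
      K * ((n : ℝ)⁻¹ * (n : ℝ) ^ γ') ≤ P.real {ω | gridIncrement (X ω) n j ∈
        {y : ℝ | (n : ℝ) ^ (-(β + ε)) ≤ |y| ∧ |y| ≤ (n : ℝ) ^ (-(β - ε))}}) :
    ∀ᵐ ω ∂P, ∀ᶠ n : ℕ in atTop, (n : ℝ) ^ γ ≤ coarseCount (X ω) ε β n := by
  have key := ae_eventually_rpow_le_sum_indicator (P := P)
    (Y := fun n j ω => gridIncrement (X ω) n j)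
    (B := fun n => {y : ℝ | (n : ℝ) ^ (-(β + ε)) ≤ |y| ∧ |y| ≤ (n : ℝ) ^ (-(β - ε))})
    hX.measurable hX.indep
    (fun n => (measurableSet_le measurable_const measurable_abs).inter
      (measurableSet_le measurable_abs measurable_const)) hγ ?_
  · filter_upwards [key] with ω hω
    filter_upwards [hω, eventually_ge_atTop 2] with n hn hn2
    rwa [coarseCount_eq_sum_indicator _ _ _ hn2]
  · filter_upwards [h, eventually_le_card_cells hp hpq hq, eventually_gt_atTop 0,
      eventually_le_natCast_rpow (sub_pos.2 hγ') (8 / (K * (q - p)))] with n hn hcard hn0 hbig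
    have hn0' : (0 : ℝ) < n := by exact_mod_cast hn0
    rw [div_le_iff₀ (mul_pos hK (by linarith))] at hbig
    set J := (Finset.range n).filter fun j : ℕ => p ≤ (j : ℝ) / n ∧ ((j : ℝ) + 1) / n ≤ q
    have hγγ : (n : ℝ) ^ γ' = (n : ℝ) ^ γ * (n : ℝ) ^ (γ' - γ) := by
      rw [← Real.rpow_add hn0']; congr 1; ring
    have hpos : 0 < (n : ℝ) ^ γ := Real.rpow_pos_of_pos hn0' _
    calc 4 * (n : ℝ) ^ γ ≤ (q - p) / 2 * K * (n : ℝ) ^ γ' := by rw [hγγ]; nlinarith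
      _ = ((q - p) / 2 * n) * (K * ((n : ℝ)⁻¹ * (n : ℝ) ^ γ')) := by field_simp
      _ ≤ J.card * (K * ((n : ℝ)⁻¹ * (n : ℝ) ^ γ')) := by gcongr
      _ = ∑ j ∈ J, K * ((n : ℝ)⁻¹ * (n : ℝ) ^ γ') := by rw [Finset.sum_const, nsmul_eq_mul]
      _ ≤ ∑ j ∈ J, P.real {ω | gridIncrement (X ω) n j ∈
          {y : ℝ | (n : ℝ) ^ (-(β + ε)) ≤ |y| ∧ |y| ≤ (n : ℝ) ^ (-(β - ε))}} := by
        refine Finset.sum_le_sum fun j hj => ?_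
        rw [Finset.mem_filter, Finset.mem_range] at hj
        exact hn j hj.1 hj.2.1 hj.2.2
      _ ≤ _ := Finset.sum_le_sum_of_subset_of_nonneg (Finset.filter_subset _ _)
        fun j _ _ => measureReal_nonneg

/-- Near a point `t`, increments of order `n ^ (-β)` with `β < 1 / α(t)` are those produced by the
jumps of that size: there are at least `n ^ (β α(t))` of them. -/
theorem ae_eventually_le_coarseCount_of_mul_lt_one (hX : HasMultistableIncrements P X α)
    (hα : Continuous α) (hc : 0 < c) (hcα : ∀ v, c ≤ α v) (hαd : ∀ v, α v ≤ d) (hd : d < 2)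
    {t β ε : ℝ} (ht : t ∈ Icc (0 : ℝ) 1) (hβ : 0 < β) (hβt : β * α t < 1) (hε : 0 < ε) :
    ∀ᵐ ω ∂P, ∀ᶠ n : ℕ in atTop, (n : ℝ) ^ (β * α t) ≤ coarseCount (X ω) ε β n := by
  have hpos : ∀ v, 0 < α v := fun v => hc.trans_le (hcα v)
  set a := α t with ha
  have ha0 : 0 < a := hpos t
  set ε₁ := min ε ((1 / a - β) / 2) with hε₁
  have hβa : β < 1 / a := by rwa [lt_div_iff₀ ha0]
  have hε₁0 : 0 < ε₁ := lt_min hε (by linarith)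
  have hε₁ε : ε₁ ≤ ε := min_le_left _ _
  set s := β + ε₁ with hs
  have hs0 : 0 < s := by linarith
  have hsa : s * a < 1 := by
    have h1 : ε₁ ≤ (1 / a - β) / 2 := min_le_right _ _
    rw [← lt_div_iff₀ ha0]
    linarith
  set e := min ((1 - s * a) / s) (ε₁ * a / (2 * s)) with he
  have he0 : 0 < e := lt_min (div_pos (by linarith) hs0) (by positivity)
  have he1 : s * (a + e) ≤ 1 := by
    have h1 : e ≤ (1 - s * a) / s := min_le_left _ _
    rw [le_div_iff₀ hs0] at h1
    linarith
  have he2 : a * (β + ε₁ / 2) ≤ s * (a - e) := by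
    have h1 : e ≤ ε₁ * a / (2 * s) := min_le_right _ _
    rw [le_div_iff₀ (by positivity)] at h1
    rw [hs] at h1 ⊢
    linarith
  obtain ⟨p, q, hp, hpq, hq, hI⟩ := exists_Icc_abs_sub_le hα ht he0
  obtain ⟨κ, hκ, hlow⟩ := hX.exists_le_prob_gt hα hc hcα hαd hd
  have key := hX.ae_eventually_rpow_le_coarseCount (ε := ε₁) (β := β) (K := κ / 2) (γ := β * a)
    (γ' := a * (β + ε₁ / 2)) hp hpq hq (by positivity) (by positivity)
    (by nlinarith [mul_pos ha0 hε₁0]) ?_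
  · filter_upwards [key] with ω hω
    filter_upwards [hω] with n hn
    exact hn.trans (by exact_mod_cast coarseCount_mono (X ω) β n hε₁ε)
  · filter_upwards [eventually_ge_atTop 1,
      eventually_le_natCast_rpow (show 0 < 2 * ε₁ * c by positivity) (16 / κ)] with n hn hbig
    intro j hj hpj hjq
    have hn1 : (1 : ℝ) ≤ n := by exact_mod_cast hn
    have hn0 : (0 : ℝ) < n := by linarith
    have hcell : ∀ v ∈ Icc ((j : ℝ) / n) (((j : ℝ) + 1) / n), |α v - a| ≤ e :=
      fun v hv => hI v ⟨hpj.trans hv.1, hv.2.trans hjq⟩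
    have hθ : 1 ≤ (n : ℝ) ^ s := Real.one_le_rpow hn1 hs0.le
    set ψ := cellExponent α n j with hψ
    have hψ1 : ψ ((n : ℝ) ^ s) ≤ 1 := by
      refine (cellExponent_le hα hpos hθ (a := a + e) fun v hv => by
        linarith [(abs_le.1 (hcell v hv)).2]).trans ?_
      rw [← Real.rpow_mul hn0.le, inv_mul_le_iff₀ hn0, mul_one]
      exact (Real.rpow_le_rpow_of_exponent_le hn1 he1).trans_eq (Real.rpow_one _)
    have hψ2 : (n : ℝ)⁻¹ * (n : ℝ) ^ (a * (β + ε₁ / 2)) ≤ ψ ((n : ℝ) ^ s) := by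
      refine le_trans ?_ (le_cellExponent hα hpos hθ (a := a - e) fun v hv => by
        linarith [(abs_le.1 (hcell v hv)).1])
      rw [← Real.rpow_mul hn0.le]
      gcongr
    have hψ3 : (n : ℝ) ^ (2 * ε₁ * c) * ψ ((n : ℝ) ^ (β - ε₁)) ≤ ψ ((n : ℝ) ^ s) := by
      have h1 := (isScalingExponent_cellExponent hα hc hcα hαd n j).lower ((n : ℝ) ^ (2 * ε₁))
        ((n : ℝ) ^ (β - ε₁)) (Real.one_le_rpow hn1 (by positivity))
      rwa [← Real.rpow_mul hn0.le, ← Real.rpow_add hn0,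
        show 2 * ε₁ + (β - ε₁) = s by rw [hs]; ring] at h1
    have h1 := hlow n j hj ((n : ℝ) ^ (-s)) (Real.rpow_pos_of_pos hn0 _)
    have h2 := hX.prob_gt_le hα hc hcα hαd hd hj (Real.rpow_pos_of_pos hn0 (-(β - ε₁)))
    rw [← Real.rpow_neg hn0.le, neg_neg] at h1 h2
    have h3 := h1 hψ1
    have h4 : P.real {ω | (n : ℝ) ^ (-s) < |gridIncrement (X ω) n j|}
        ≤ P.real {ω | gridIncrement (X ω) n j ∈
          {y : ℝ | (n : ℝ) ^ (-(β + ε₁)) ≤ |y| ∧ |y| ≤ (n : ℝ) ^ (-(β - ε₁))}}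
          + P.real {ω | (n : ℝ) ^ (-(β - ε₁)) < |gridIncrement (X ω) n j|} := by
      refine (measureReal_mono fun ω hω => ?_).trans (measureReal_union_le _ _)
      by_cases h5 : (n : ℝ) ^ (-(β - ε₁)) < |gridIncrement (X ω) n j|
      · exact Or.inr h5
      · exact Or.inl ⟨le_of_lt hω, not_lt.1 h5⟩
    have h5 := (isScalingExponent_cellExponent hα hc hcα hαd n j).nonneg ((n : ℝ) ^ (β - ε₁))
    rw [div_le_iff₀ hκ] at hbig
    have h6 : 8 * ψ ((n : ℝ) ^ (β - ε₁)) ≤ κ / 2 * ψ ((n : ℝ) ^ s) := by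
      have h7 : 16 * ψ ((n : ℝ) ^ (β - ε₁))
          ≤ (n : ℝ) ^ (2 * ε₁ * c) * κ * ψ ((n : ℝ) ^ (β - ε₁)) :=
        mul_le_mul_of_nonneg_right hbig h5
      nlinarith
    have h8 : κ / 2 * ((n : ℝ)⁻¹ * (n : ℝ) ^ (a * (β + ε₁ / 2))) ≤ κ / 2 * ψ ((n : ℝ) ^ s) := by
      gcongr
    rw [← hψ] at h2 h3
    simp only [mem_ofPred_eq] at h4 ⊢
    linarith

/-- Where `α` is minimal the increments have a density of order `n ^ (1 / c)` near `0`, so that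
there are at least `n ^ (1 + 1 / c - β)` increments of the small order `n ^ (-β)`, `β > 1 / c`. -/
theorem ae_eventually_le_coarseCount_of_one_div_lt (hX : HasMultistableIncrements P X α)
    (hα : Continuous α) (hc : 1 < c) (hcα : ∀ v, c ≤ α v) (hαd : ∀ v, α v ≤ d)
    {t β ε : ℝ} (ht : t ∈ Icc (0 : ℝ) 1) (htc : α t = c) (hβ : 1 / c < β) (hβ' : β < 1 + 1 / c)
    (hε : 0 < ε) :
    ∀ᵐ ω ∂P, ∀ᶠ n : ℕ in atTop, (n : ℝ) ^ (1 + 1 / c - β) ≤ coarseCount (X ω) ε β n := by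
  have hc0 : 0 < c := by linarith
  set ε₁ := min ε (β - 1 / c) with hε₁
  have hε₁0 : 0 < ε₁ := lt_min hε (by linarith)
  have hε₁ε : ε₁ ≤ ε := min_le_left _ _
  have hε₁β : ε₁ ≤ β - 1 / c := min_le_right _ _
  set w := 1 / c - β with hw
  set a := c + ε₁ / 4 with ha
  have ha0 : 0 < a := by positivity
  have ha1 : 1 / a ≤ 1 / c := one_div_le_one_div_of_le hc0 (by linarith)
  have ha2 : 1 / c - ε₁ / 4 ≤ 1 / a := by
    rw [sub_le_iff_le_add, div_le_iff₀ hc0]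
    have h1 : (1 / a + ε₁ / 4) * c - 1 = ε₁ / 4 * c - (a - c) / a := by field_simp; ring
    have h2 : (a - c) / a ≤ a - c := div_le_self (by linarith) (by linarith)
    nlinarith
  obtain ⟨p, q, hp, hpq, hq, hI⟩ := exists_Icc_abs_sub_le hα ht (show 0 < ε₁ / 4 by positivity)
  have key := hX.ae_eventually_rpow_le_coarseCount (ε := ε₁) (β := β) (K := 1 / 20)
    (γ := 1 + 1 / c - β) (γ' := 1 + (w + ε₁ / 4)) hp hpq hq (by positivity) (by linarith)
    (by linarith) ?_
  · filter_upwards [key] with ω hω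
    filter_upwards [hω] with n hn
    exact hn.trans (by exact_mod_cast coarseCount_mono (X ω) β n hε₁ε)
  · have hexp : ∀ᶠ n : ℕ in atTop,
        Real.exp (-((n : ℝ) ^ ε₁ / 2)) ≤ 1 / 40 * (n : ℝ) ^ (w + ε₁ / 4) := by
      have h1 := isLittleO_exp_neg_mul_rpow_atTop (show (0 : ℝ) < 1 / 2 by norm_num)
        ((w + ε₁ / 4) / ε₁)
      have h2 : Tendsto (fun n : ℕ => (n : ℝ) ^ ε₁) atTop atTop :=
        (tendsto_rpow_atTop hε₁0).comp tendsto_natCast_atTop_atTop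
      filter_upwards [(h1.comp_tendsto h2).bound (show (0 : ℝ) < 1 / 40 by norm_num)] with n hn
      simp only [Function.comp_apply, Real.norm_eq_abs, Real.abs_exp] at hn
      rw [abs_of_nonneg (by positivity), ← Real.rpow_mul (Nat.cast_nonneg n),
        mul_div_cancel₀ _ hε₁0.ne'] at hn
      refine (le_of_eq ?_).trans hn
      congr 1; ring
    filter_upwards [eventually_ge_atTop 1, hexp,
      eventually_le_natCast_rpow (show 0 < 5 * ε₁ / 4 by positivity) 400] with n hn hexp hbig
    intro j hj hpj hjq
    have hn1 : (1 : ℝ) ≤ n := by exact_mod_cast hn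
    have hn0 : (0 : ℝ) < n := by linarith
    have h1 := hX.le_prob_le hα hc0 hcα hαd hj (x := (n : ℝ) ^ (-(β - ε₁)))
      (s := (n : ℝ) ^ (β - ε₁ / 2)) (a := a) (Real.rpow_pos_of_pos hn0 _).le ha0
      (Real.rpow_le_rpow_of_exponent_le hn1 (by linarith)) fun v hv => by
        have := (abs_le.1 (hI v ⟨hpj.trans hv.1, hv.2.trans hjq⟩)).2
        linarith
    have h2 := hX.prob_le_le hα hc hcα hαd hj (Real.rpow_pos_of_pos hn0 (-(β + ε₁)))
    have e1 : ((n : ℝ) ^ (β - ε₁ / 2)) ^ 2 * ((n : ℝ) ^ (-(β - ε₁))) ^ 2 = (n : ℝ) ^ ε₁ := by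
      rw [← mul_pow, ← Real.rpow_add hn0, ← Real.rpow_natCast, ← Real.rpow_mul hn0.le]
      congr 1; push_cast; ring
    have e2 : (n : ℝ) ^ (w + ε₁ / 4) / 10 ≤ (n : ℝ) ^ (1 / a) / (10 * (n : ℝ) ^ (β - ε₁ / 2)) := by
      rw [mul_comm (10 : ℝ), ← div_div, ← Real.rpow_sub hn0]
      gcongr
      linarith
    have e3 : 10 * (n : ℝ) ^ (-(β + ε₁)) * (n : ℝ) ^ (1 / c) ≤ 1 / 40 * (n : ℝ) ^ (w + ε₁ / 4) := by
      rw [mul_assoc, ← Real.rpow_add hn0,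
        show w + ε₁ / 4 = (-(β + ε₁) + 1 / c) + 5 * ε₁ / 4 by rw [hw]; ring, Real.rpow_add hn0 _
        (5 * ε₁ / 4)]
      have := Real.rpow_pos_of_pos hn0 (-(β + ε₁) + 1 / c)
      nlinarith
    rw [e1] at h1
    have h4 : P.real {ω | |gridIncrement (X ω) n j| ≤ (n : ℝ) ^ (-(β - ε₁))}
        ≤ P.real {ω | gridIncrement (X ω) n j ∈
          {y : ℝ | (n : ℝ) ^ (-(β + ε₁)) ≤ |y| ∧ |y| ≤ (n : ℝ) ^ (-(β - ε₁))}}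
          + P.real {ω | |gridIncrement (X ω) n j| ≤ (n : ℝ) ^ (-(β + ε₁))} := by
      refine (measureReal_mono fun ω hω => ?_).trans (measureReal_union_le _ _)
      by_cases h5 : |gridIncrement (X ω) n j| ≤ (n : ℝ) ^ (-(β + ε₁))
      · exact Or.inr h5
      · exact Or.inl ⟨(not_le.1 h5).le, hω⟩
    have e4 : (n : ℝ)⁻¹ * (n : ℝ) ^ (1 + (w + ε₁ / 4)) = (n : ℝ) ^ (w + ε₁ / 4) := by
      rw [Real.rpow_add hn0, Real.rpow_one, inv_mul_cancel_left₀ hn0.ne']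
    rw [e4]
    simp only [mem_ofPred_eq] at h4 ⊢
    linarith

end HasMultistableIncrements

end LowerCounts

/-! ### From counts and power sums to the spectra -/

section LogGrowth

variable {u : ℕ → ℝ≥0∞} {y : ℝ}

theorem log_ofReal_rpow {n : ℕ} (hn : 2 ≤ n) (y : ℝ) :
    ENNReal.log (ENNReal.ofReal ((n : ℝ) ^ y)) = (y : EReal) * (Real.log n : ℝ) := by
  have hn0 : (0 : ℝ) < n := by positivity
  rw [ENNReal.log_ofReal_of_pos (Real.rpow_pos_of_pos hn0 _), Real.log_rpow hn0, EReal.coe_mul]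

theorem log_natCast_pos {n : ℕ} (hn : 2 ≤ n) : (0 : EReal) < (Real.log n : ℝ) := by
  exact_mod_cast Real.log_pos (by exact_mod_cast hn)

theorem le_liminf_log_div (h : ∀ᶠ n : ℕ in atTop, ENNReal.ofReal ((n : ℝ) ^ y) ≤ u n) :
    (y : EReal) ≤ liminf (fun n : ℕ => ENNReal.log (u n) / ((Real.log n : ℝ) : EReal)) atTop := by
  refine le_liminf_of_le (h := ?_)
  filter_upwards [h, eventually_ge_atTop 2] with n hn hn2
  rw [EReal.le_div_iff_mul_le (log_natCast_pos hn2) (EReal.coe_ne_top _), ← log_ofReal_rpow hn2]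
  exact ENNReal.log_monotone hn

theorem liminf_log_div_le (h : ∃ᶠ n : ℕ in atTop, u n ≤ ENNReal.ofReal ((n : ℝ) ^ y)) :
    liminf (fun n : ℕ => ENNReal.log (u n) / ((Real.log n : ℝ) : EReal)) atTop ≤ (y : EReal) := by
  refine liminf_le_of_frequently_le' ?_
  refine (h.and_eventually (eventually_ge_atTop 2)).mono fun n hn => ?_
  rw [EReal.div_le_iff_le_mul (log_natCast_pos hn.2) (EReal.coe_ne_top _), mul_comm,
    ← log_ofReal_rpow hn.2]
  exact ENNReal.log_monotone hn.1

theorem eventually_le_of_lt_liminf_log_div (h : (y : EReal)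
    < liminf (fun n : ℕ => ENNReal.log (u n) / ((Real.log n : ℝ) : EReal)) atTop) :
    ∀ᶠ n : ℕ in atTop, ENNReal.ofReal ((n : ℝ) ^ y) ≤ u n := by
  filter_upwards [eventually_lt_of_lt_liminf h, eventually_ge_atTop 2] with n hn hn2
  have h1 := hn.le
  rw [EReal.le_div_iff_mul_le (log_natCast_pos hn2) (EReal.coe_ne_top _), ← log_ofReal_rpow hn2]
    at h1
  exact ENNReal.log_le_log_iff.1 h1

end LogGrowth

section Spectra

variable {X : ℝ → ℝ} {c d : ℝ}

theorem le_coarseGrowth {β ε y : ℝ}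
    (h : ∀ᶠ n : ℕ in atTop, (n : ℝ) ^ y ≤ coarseCount X ε β n) :
    (y : EReal) ≤ coarseGrowth X β ε := by
  refine le_liminf_log_div (h.mono fun n hn => ?_)
  rw [← ENNReal.ofReal_natCast]
  exact ENNReal.ofReal_le_ofReal hn

theorem momentExponent_le {q y : ℝ}
    (h : ∃ᶠ n : ℕ in atTop, partitionSum X q n ≤ (n : ℝ) ^ y) :
    momentExponent X q ≤ (y : EReal) :=
  liminf_log_div_le (h.mono fun _ hn => ENNReal.ofReal_le_ofReal hn)

/-- The power sum of exponent `q` is at least the contribution of the increments of order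
`n ^ (-β)`. -/
theorem coarseCount_mul_rpow_le_partitionSum (X : ℝ → ℝ) {ε : ℝ} (β q : ℝ) {n : ℕ}
    (hn : 2 ≤ n) :
    (coarseCount X ε β n : ℝ) * (n : ℝ) ^ (-(q * β + |q| * ε)) ≤ partitionSum X q n := by
  have hn0 : (0 : ℝ) < n := by positivity
  rw [coarseCount_eq_sum_indicator X ε β hn, partitionSum, Finset.sum_mul]
  refine Finset.sum_le_sum fun j _ => ?_
  set y := gridIncrement X n j
  by_cases hy : y ∈ {y : ℝ | (n : ℝ) ^ (-(β + ε)) ≤ |y| ∧ |y| ≤ (n : ℝ) ^ (-(β - ε))}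
  · rw [indicator_of_mem hy, Pi.one_apply, one_mul]
    have h1 := Real.rpow_pos_of_pos hn0 (-(β + ε))
    have hy0 : 0 < |y| := h1.trans_le hy.1
    rw [if_neg (abs_pos.1 hy0)]
    rcases le_total 0 q with hq | hq
    · have h2 := Real.rpow_le_rpow h1.le hy.1 hq
      rw [← Real.rpow_mul hn0.le] at h2
      rw [abs_of_nonneg hq]
      refine (le_of_eq ?_).trans h2
      congr 1; ring
    · have h2 := Real.rpow_le_rpow_of_nonpos hy0 hy.2 hq
      rw [← Real.rpow_mul hn0.le] at h2
      rw [abs_of_nonpos hq]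
      refine (le_of_eq ?_).trans h2
      congr 1; ring
  · rw [indicator_of_notMem hy, zero_mul]
    split_ifs
    · exact le_rfl
    · positivity

/-- The large deviation spectrum never exceeds the Legendre spectrum. -/
theorem largeDeviationSpectrum_le_legendreSpectrum (X : ℝ → ℝ) (β : ℝ) :
    largeDeviationSpectrum X β ≤ legendreSpectrum X β := by
  refine le_iInf fun q => EReal.ge_of_forall_gt_iff_ge.1 fun z hz => ?_
  have hτ : ∀ ε : ℝ, 0 < ε → ((z - q * β - |q| * ε : ℝ) : EReal) ≤ momentExponent X q := by
    intro ε hε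
    have h1 : (z : EReal) < coarseGrowth X β ε := hz.trans_le (iInf₂_le ε hε)
    refine le_liminf_log_div ?_
    filter_upwards [eventually_le_of_lt_liminf_log_div h1, eventually_ge_atTop 2] with n hn hn2
    have hn0 : (0 : ℝ) < n := by positivity
    rw [← ENNReal.ofReal_natCast, ENNReal.ofReal_le_ofReal_iff (Nat.cast_nonneg _)] at hn
    refine ENNReal.ofReal_le_ofReal
      (le_trans ?_ (coarseCount_mul_rpow_le_partitionSum X β q hn2 (ε := ε)))
    rw [show z - q * β - |q| * ε = z + -(q * β + |q| * ε) by ring, Real.rpow_add hn0]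
    gcongr
  have h2 : ((z - q * β : ℝ) : EReal) ≤ momentExponent X q := by
    refine EReal.ge_of_forall_gt_iff_ge.1 fun z' hz' => ?_
    have hz'' : z' < z - q * β := by exact_mod_cast hz'
    have hq : 0 < |q| + 1 := by positivity
    refine le_trans ?_ (hτ ((z - q * β - z') / (|q| + 1)) (div_pos (by linarith) hq))
    rw [EReal.coe_le_coe_iff]
    have h3 : |q| * ((z - q * β - z') / (|q| + 1)) ≤ z - q * β - z' := by
      rw [← mul_div_assoc, div_le_iff₀ hq]
      nlinarith [abs_nonneg q]
    linarith
  calc (z : EReal) = ((q * β : ℝ) : EReal) + ((z - q * β : ℝ) : EReal) := by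
        rw [← EReal.coe_add]; congr 1; ring
    _ ≤ _ := add_le_add_right h2 _

theorem momentExponent_zero_le (X : ℝ → ℝ) : momentExponent X 0 ≤ 1 := by
  rw [← EReal.coe_one]
  refine momentExponent_le (Eventually.of_forall fun n => ?_).frequently
  rw [Real.rpow_one, partitionSum]
  calc ∑ j ∈ Finset.range n, (if gridIncrement X n j = 0 then (0 : ℝ)
        else |gridIncrement X n j| ^ (0 : ℝ)) ≤ ∑ _j ∈ Finset.range n, (1 : ℝ) :=
        Finset.sum_le_sum fun j _ => by split_ifs <;> simp
    _ = n := by simp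

/-- Along the powers of `2`, the number of increments exceeding `n ^ (-s)` has order at most
`n ^ max (s d) (s c)`, up to arbitrarily small powers. The exponents are rational, so that the
property is a countable intersection of events. -/
def LargeIncrementBound (X : ℝ → ℝ) (c d : ℝ) : Prop :=
  ∀ s η : ℚ, 0 < η → ∀ᶠ k : ℕ in atTop,
    ∑ j ∈ Finset.range (2 ^ k), {y : ℝ | ((2 ^ k : ℕ) : ℝ) ^ (-(s : ℝ)) < |y|}.indicator
      (1 : ℝ → ℝ) (gridIncrement X (2 ^ k) j)
        ≤ ((2 ^ k : ℕ) : ℝ) ^ (max (s * d) (s * c) + η : ℝ)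

/-- Along the powers of `2`, the number of increments bounded by `n ^ (-s)` has order at most
`n ^ (1 + 1 / c - s)`, up to arbitrarily small powers. The exponents are rational, as in
`LargeIncrementBound`. -/
def SmallIncrementBound (X : ℝ → ℝ) (c : ℝ) : Prop :=
  ∀ s η : ℚ, 0 < η → ∀ᶠ k : ℕ in atTop,
    ∑ j ∈ Finset.range (2 ^ k), {y : ℝ | |y| ≤ ((2 ^ k : ℕ) : ℝ) ^ (-(s : ℝ))}.indicator
      (1 : ℝ → ℝ) (gridIncrement X (2 ^ k) j) ≤ ((2 ^ k : ℕ) : ℝ) ^ (1 + 1 / c - s + η : ℝ)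

theorem forall_notMem_of_sum_indicator_lt_one {n : ℕ} {f : ℕ → ℝ} {B : Set ℝ}
    (h : ∑ j ∈ Finset.range n, B.indicator (1 : ℝ → ℝ) (f j) < 1) : ∀ j < n, f j ∉ B := by
  intro j hj hjB
  have h1 := Finset.single_le_sum (f := fun j => B.indicator (1 : ℝ → ℝ) (f j))
    (fun i _ => indicator_nonneg (fun _ _ => zero_le_one) _) (Finset.mem_range.2 hj)
  simp only [indicator_of_mem hjB, Pi.one_apply] at h1
  linarith

theorem eventually_two_pow {p : ℕ → Prop} (h : ∀ᶠ n in atTop, p n) :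
    ∀ᶠ k : ℕ in atTop, p (2 ^ k) :=
  (tendsto_pow_atTop_atTop_of_one_lt (one_lt_two : 1 < 2)).eventually h

theorem frequently_of_eventually_two_pow {p : ℕ → Prop} (h : ∀ᶠ k : ℕ in atTop, p (2 ^ k)) :
    ∃ᶠ n in atTop, p n :=
  (tendsto_pow_atTop_atTop_of_one_lt (one_lt_two : 1 < 2)).frequently h.frequently

theorem LargeIncrementBound.eventually_abs_le (h : LargeIncrementBound X c d) (hc : 0 < c)
    (hcd : c ≤ d) {e : ℚ} (he : 0 < e) : ∀ᶠ k : ℕ in atTop, ∀ j < 2 ^ k,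
      |gridIncrement X (2 ^ k) j| ≤ ((2 ^ k : ℕ) : ℝ) ^ (e : ℝ) := by
  have he' : (0 : ℝ) < e := by exact_mod_cast he
  obtain ⟨η, hη0, hη⟩ := exists_rat_btwn (show 0 < (e : ℝ) * c by positivity)
  filter_upwards [h (-e) η (by exact_mod_cast hη0), eventually_ge_atTop 1] with k hk hk1 j hj
  have h2 : (1 : ℝ) < ((2 ^ k : ℕ) : ℝ) := by exact_mod_cast Nat.one_lt_two_pow (by omega)
  have h3 := forall_notMem_of_sum_indicator_lt_one (hk.trans_lt
    (Real.rpow_lt_one_of_one_lt_of_neg h2 ?_)) j hj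
  · simpa using h3
  · push_cast
    rw [max_eq_right (by nlinarith)]
    linarith

theorem SmallIncrementBound.eventually_lt_abs (h : SmallIncrementBound X c) {s : ℚ}
    (hs : 1 + 1 / c < s) : ∀ᶠ k : ℕ in atTop, ∀ j < 2 ^ k,
      ((2 ^ k : ℕ) : ℝ) ^ (-(s : ℝ)) < |gridIncrement X (2 ^ k) j| := by
  obtain ⟨η, hη0, hη⟩ := exists_rat_btwn (show 0 < (s : ℝ) - (1 + 1 / c) by linarith)
  filter_upwards [h s η (by exact_mod_cast hη0), eventually_ge_atTop 1] with k hk hk1 j hj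
  have h2 : (1 : ℝ) < ((2 ^ k : ℕ) : ℝ) := by exact_mod_cast Nat.one_lt_two_pow (by omega)
  have h3 := forall_notMem_of_sum_indicator_lt_one (hk.trans_lt
    (Real.rpow_lt_one_of_one_lt_of_neg h2 (by linarith))) j hj
  simpa using h3

theorem LargeIncrementBound.legendreSpectrum_eq_bot (h : LargeIncrementBound X c d) (hc : 0 < c)
    (hcd : c ≤ d) {β : ℝ} (hβ : β < 0) : legendreSpectrum X β = ⊥ := by
  obtain ⟨e, he0, he⟩ := exists_rat_btwn (show 0 < -β by linarith)
  have he0' : 0 < e := by exact_mod_cast he0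
  rw [EReal.eq_bot_iff_forall_lt]
  intro y
  -- the moment of order `q → ∞` grows at most like `n ^ (1 + e q)`, and `e + β < 0`
  set q : ℝ := max 0 ((2 - y) / (-(β + e))) with hq
  have hq0 : 0 ≤ q := le_max_left _ _
  have hq1 : 2 - y ≤ q * (-(β + e)) := by
    rw [← div_le_iff₀ (by linarith)]; exact le_max_right _ _
  have hτ : momentExponent X q ≤ ((1 + e * q : ℝ) : EReal) := by
    refine momentExponent_le (frequently_of_eventually_two_pow ?_)
    filter_upwards [h.eventually_abs_le hc hcd he0'] with k hk
    have hn0 : (0 : ℝ) < ((2 ^ k : ℕ) : ℝ) := by positivity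
    calc partitionSum X q (2 ^ k)
        ≤ ∑ _j ∈ Finset.range (2 ^ k), ((2 ^ k : ℕ) : ℝ) ^ (e * q : ℝ) := by
          refine Finset.sum_le_sum fun j hj => ?_
          split_ifs
          · positivity
          · rw [Real.rpow_mul hn0.le]
            exact Real.rpow_le_rpow (abs_nonneg _) (hk j (Finset.mem_range.1 hj)) hq0
      _ = _ := by
          rw [Finset.sum_const, Finset.card_range, nsmul_eq_mul, Real.rpow_add hn0, Real.rpow_one]
  calc legendreSpectrum X β ≤ ((q * β : ℝ) : EReal) + momentExponent X q := iInf_le _ q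
    _ ≤ ((q * β : ℝ) : EReal) + ((1 + e * q : ℝ) : EReal) := add_le_add_right hτ _
    _ = ((q * β + (1 + e * q) : ℝ) : EReal) :=
        (EReal.coe_add _ _).symm
    _ < y := by
      rw [EReal.coe_lt_coe_iff]; linarith

theorem SmallIncrementBound.legendreSpectrum_eq_bot (h : SmallIncrementBound X c) {β : ℝ}
    (hβ : 1 + 1 / c < β) : legendreSpectrum X β = ⊥ := by
  obtain ⟨s, hs0, hs⟩ := exists_rat_btwn hβ
  rw [EReal.eq_bot_iff_forall_lt]
  intro y
  -- the moment of order `q → -∞` grows at most like `n ^ (1 - s q)`, and `s < β`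
  set q : ℝ := -max 0 ((2 - y) / (β - s)) with hq
  have hq0 : q ≤ 0 := neg_nonpos.2 (le_max_left _ _)
  have hq1 : 2 - y ≤ -q * (β - s) := by
    rw [← div_le_iff₀ (by linarith), hq, neg_neg]; exact le_max_right _ _
  have hτ : momentExponent X q ≤ ((1 + -s * q : ℝ) : EReal) := by
    refine momentExponent_le (frequently_of_eventually_two_pow ?_)
    filter_upwards [h.eventually_lt_abs hs0] with k hk
    have hn0 : (0 : ℝ) < ((2 ^ k : ℕ) : ℝ) := by positivity
    calc partitionSum X q (2 ^ k)
        ≤ ∑ _j ∈ Finset.range (2 ^ k), ((2 ^ k : ℕ) : ℝ) ^ (-s * q : ℝ) := by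
          refine Finset.sum_le_sum fun j hj => ?_
          split_ifs
          · positivity
          · rw [Real.rpow_mul hn0.le]
            exact Real.rpow_le_rpow_of_nonpos (Real.rpow_pos_of_pos hn0 _)
              (hk j (Finset.mem_range.1 hj)).le hq0
      _ = _ := by
          rw [Finset.sum_const, Finset.card_range, nsmul_eq_mul, Real.rpow_add hn0, Real.rpow_one]
  calc legendreSpectrum X β ≤ ((q * β : ℝ) : EReal) + momentExponent X q := iInf_le _ q
    _ ≤ ((q * β : ℝ) : EReal) + ((1 + -s * q : ℝ) : EReal) := add_le_add_right hτ _
    _ = ((q * β + (1 + -s * q) : ℝ) : EReal) :=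
        (EReal.coe_add _ _).symm
    _ < y := by
      rw [EReal.coe_lt_coe_iff]; linarith

/-- A pointwise bound of `|y| ^ d` by a step function with steps at the powers of `x`. -/
theorem rpow_le_sum_indicator {x e d : ℝ} (hx : 1 < x) (hd : 0 < d) {K : ℕ}
    (hK : 1 ≤ K * e * d) {y : ℝ} (hy : |y| ≤ x ^ e) :
    |y| ^ d ≤ x ^ (-1 : ℝ) + ∑ i ∈ Finset.range (K + 1),
      x ^ (-((i - 1) * e * d) : ℝ) * {y : ℝ | x ^ (-(i * e) : ℝ) < |y|}.indicator 1 y := by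
  classical
  have hx0 : 0 < x := by linarith
  have hnn : ∀ i ∈ Finset.range (K + 1), 0 ≤ x ^ (-((i - 1) * e * d) : ℝ) *
      {y : ℝ | x ^ (-(i * e) : ℝ) < |y|}.indicator (1 : ℝ → ℝ) y := fun i _ =>
    mul_nonneg (Real.rpow_nonneg hx0.le _) (indicator_nonneg (fun _ _ => zero_le_one) _)
  by_cases hex : ∃ i : ℕ, i ≤ K ∧ x ^ (-(i * e) : ℝ) < |y|
  · set m := Nat.find hex with hm
    obtain ⟨hmK, hmy⟩ := Nat.find_spec hex
    rw [← hm] at hmK hmy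
    have h1 : |y| ≤ x ^ (-((m - 1) * e) : ℝ) := by
      rcases Nat.eq_zero_or_pos m with h0 | h0
      · rw [h0]; simpa using hy
      · have h2 := Nat.find_min hex (m := m - 1) (by omega)
        rw [not_and, not_lt, Nat.cast_sub h0, Nat.cast_one] at h2
        exact h2 (by omega)
    have h3 := Real.rpow_le_rpow (abs_nonneg y) h1 hd.le
    rw [← Real.rpow_mul hx0.le, neg_mul] at h3
    have h4 := Finset.single_le_sum hnn (Finset.mem_range.2 (Nat.lt_succ_of_le hmK))
    rw [indicator_of_mem (by exact hmy), Pi.one_apply, mul_one] at h4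
    have := Real.rpow_pos_of_pos hx0 (-1)
    linarith
  · push Not at hex
    have h1 := Real.rpow_le_rpow (abs_nonneg y) (hex K le_rfl) hd.le
    rw [← Real.rpow_mul hx0.le] at h1
    have h2 : x ^ (-(K * e) * d : ℝ) ≤ x ^ (-1 : ℝ) :=
      Real.rpow_le_rpow_of_exponent_le hx.le (by linarith)
    have := Finset.sum_nonneg hnn
    linarith

/-- A pointwise bound of `|y|⁻¹` by a step function with steps at the powers of `x`. -/
theorem inv_le_sum_indicator {x e : ℝ} (hx : 1 < x) {K : ℕ} {y : ℝ}
    (hy : x ^ (-(K * e) : ℝ) < |y|) :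
    |y|⁻¹ ≤ 1 + ∑ i ∈ Finset.range K,
      x ^ ((i + 1) * e : ℝ) * {y : ℝ | |y| ≤ x ^ (-(i * e) : ℝ)}.indicator 1 y := by
  classical
  have hx0 : 0 < x := by linarith
  have hnn : ∀ i ∈ Finset.range K, 0 ≤ x ^ ((i + 1) * e : ℝ) *
      {y : ℝ | |y| ≤ x ^ (-(i * e) : ℝ)}.indicator (1 : ℝ → ℝ) y := fun i _ =>
    mul_nonneg (Real.rpow_nonneg hx0.le _) (indicator_nonneg (fun _ _ => zero_le_one) _)
  have hex : ∃ i : ℕ, x ^ (-(i * e) : ℝ) < |y| := ⟨K, hy⟩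
  set m := Nat.find hex with hm
  have hmy := Nat.find_spec hex
  have hmK : m ≤ K := Nat.find_min' hex hy
  rw [← hm] at hmy
  have hy0 : 0 < |y| := (Real.rpow_pos_of_pos hx0 _).trans hmy
  rcases Nat.eq_zero_or_pos m with h0 | h0
  · rw [h0] at hmy
    have h1 : 1 < |y| := by simpa using hmy
    have h2 := inv_le_one_of_one_le₀ h1.le
    linarith [Finset.sum_nonneg hnn]
  · have h2 := Nat.find_min hex (m := m - 1) (by omega)
    rw [not_lt] at h2
    have h4 := Finset.single_le_sum hnn (Finset.mem_range.2 (show m - 1 < K by omega))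
    rw [indicator_of_mem (by exact h2), Pi.one_apply, mul_one, Nat.cast_sub h0, Nat.cast_one,
      sub_add_cancel] at h4
    have h5 : |y|⁻¹ ≤ x ^ (m * e : ℝ) := by
      rw [← inv_inv (x ^ (m * e : ℝ)), ← Real.rpow_neg hx0.le]
      exact inv_anti₀ (Real.rpow_pos_of_pos hx0 _) hmy.le
    linarith

/-- The increments of order `n ^ (-s)`, at most about `n ^ (s d)` in number, contribute at most about
`1` to the moment of order `d`, and finitely many values of `s` suffice. -/
theorem LargeIncrementBound.momentExponent_le_zero (h : LargeIncrementBound X c d) (hc : 0 < c)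
    (hcd : c ≤ d) : momentExponent X d ≤ 0 := by
  have hd : 0 < d := hc.trans_le hcd
  refine EReal.le_of_forall_lt_iff_le.1 fun z hz => ?_
  have hz0 : 0 < z := by exact_mod_cast hz
  obtain ⟨e, he0, he⟩ := exists_rat_btwn (show 0 < z / (d + 2) by positivity)
  have he0' : 0 < e := by exact_mod_cast he0
  rw [lt_div_iff₀ (by positivity)] at he
  obtain ⟨K, hK⟩ := exists_nat_ge (1 / ((e : ℝ) * d))
  rw [div_le_iff₀ (by positivity), ← mul_assoc] at hK
  refine (momentExponent_le (y := z) (frequently_of_eventually_two_pow ?_))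
  have hall : ∀ᶠ k : ℕ in atTop, ∀ i ∈ Finset.range (K + 1),
      ∑ j ∈ Finset.range (2 ^ k), {y : ℝ | ((2 ^ k : ℕ) : ℝ) ^ (-(i * e) : ℝ) < |y|}.indicator
        (1 : ℝ → ℝ) (gridIncrement X (2 ^ k) j) ≤ ((2 ^ k : ℕ) : ℝ) ^ (i * e * d + e : ℝ) := by
    rw [Filter.eventually_all_finset]
    intro i _
    have h1 := h (i * e) e he0'
    push_cast at h1 ⊢
    filter_upwards [h1] with k hk
    refine hk.trans_eq ?_
    rw [max_eq_left]
    gcongr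
  filter_upwards [hall, h.eventually_abs_le hc hcd he0', eventually_ge_atTop 1,
    eventually_two_pow (eventually_le_natCast_rpow he0 (K + 2))] with k hk hk2 hk1 hk3
  set n : ℕ := 2 ^ k with hn
  have hn1 : (1 : ℝ) < n := by exact_mod_cast Nat.one_lt_two_pow (by omega)
  have hn0 : (0 : ℝ) < n := by linarith
  calc partitionSum X d n
      ≤ ∑ j ∈ Finset.range n, ((n : ℝ) ^ (-1 : ℝ) + ∑ i ∈ Finset.range (K + 1),
        (n : ℝ) ^ (-((i - 1) * e * d) : ℝ) * {y : ℝ | (n : ℝ) ^ (-(i * e) : ℝ) < |y|}.indicator 1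
          (gridIncrement X n j)) := by
        refine Finset.sum_le_sum fun j hj => ?_
        have h1 := rpow_le_sum_indicator hn1 hd hK (hk2 j (Finset.mem_range.1 hj))
        split_ifs
        · exact (Real.rpow_nonneg (abs_nonneg _) _).trans h1
        · exact h1
    _ = 1 + ∑ i ∈ Finset.range (K + 1), (n : ℝ) ^ (-((i - 1) * e * d) : ℝ) *
        ∑ j ∈ Finset.range n, {y : ℝ | (n : ℝ) ^ (-(i * e) : ℝ) < |y|}.indicator 1
          (gridIncrement X n j) := by
        rw [Finset.sum_add_distrib, Finset.sum_comm, Finset.sum_const, Finset.card_range,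
          nsmul_eq_mul, Real.rpow_neg_one, mul_inv_cancel₀ hn0.ne']
        simp_rw [Finset.mul_sum]
    _ ≤ 1 + ∑ i ∈ Finset.range (K + 1), (n : ℝ) ^ (-((i - 1) * e * d) : ℝ) *
        (n : ℝ) ^ (i * e * d + e : ℝ) := by
        gcongr with i hi
        exact hk i hi
    _ = 1 + (K + 1) * (n : ℝ) ^ (e * d + e : ℝ) := by
        congr 1
        have h1 : ∀ i ∈ Finset.range (K + 1), (n : ℝ) ^ (-((i - 1) * e * d) : ℝ) *
            (n : ℝ) ^ (i * e * d + e : ℝ) = (n : ℝ) ^ (e * d + e : ℝ) := fun i _ => by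
          rw [← Real.rpow_add hn0]
          congr 1; ring
        rw [Finset.sum_congr rfl h1, Finset.sum_const, Finset.card_range, nsmul_eq_mul,
          Nat.cast_succ]
    _ ≤ (K + 2) * (n : ℝ) ^ (e * d + e : ℝ) := by
        have : 1 ≤ (n : ℝ) ^ (e * d + e : ℝ) := Real.one_le_rpow hn1.le (by positivity)
        linarith
    _ ≤ (n : ℝ) ^ (e : ℝ) * (n : ℝ) ^ (e * d + e : ℝ) := by gcongr
    _ = (n : ℝ) ^ (e * (d + 2) : ℝ) := by rw [← Real.rpow_add hn0]; congr 1; ring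
    _ ≤ (n : ℝ) ^ z := Real.rpow_le_rpow_of_exponent_le hn1.le he.le

/-- The increments of order `n ^ (-s)`, at most about `n ^ (1 + 1 / c - s)` in number, contribute at
most about `n ^ (1 + 1 / c)` to the moment of order `-1`; none has an order with `s > 1 + 1 / c`. -/
theorem SmallIncrementBound.momentExponent_neg_one_le (h : SmallIncrementBound X c) (hc : 0 < c) :
    momentExponent X (-1) ≤ ((1 + 1 / c : ℝ) : EReal) := by
  refine EReal.le_of_forall_lt_iff_le.1 fun z hz => ?_
  have hz0 : 1 + 1 / c < z := by exact_mod_cast hz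
  obtain ⟨e, he0, he⟩ := exists_rat_btwn (show 0 < (z - (1 + 1 / c)) / 3 by linarith)
  have he0' : 0 < e := by exact_mod_cast he0
  obtain ⟨K, hK⟩ := exists_nat_gt ((1 + 1 / c) / (e : ℝ))
  rw [div_lt_iff₀ he0] at hK
  refine (momentExponent_le (y := z) (frequently_of_eventually_two_pow ?_))
  have hall : ∀ᶠ k : ℕ in atTop, ∀ i ∈ Finset.range K,
      ∑ j ∈ Finset.range (2 ^ k), {y : ℝ | |y| ≤ ((2 ^ k : ℕ) : ℝ) ^ (-(i * e) : ℝ)}.indicator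
        (1 : ℝ → ℝ) (gridIncrement X (2 ^ k) j)
          ≤ ((2 ^ k : ℕ) : ℝ) ^ (1 + 1 / c - i * e + e : ℝ) := by
    rw [Filter.eventually_all_finset]
    intro i _
    have h1 := h (i * e) e he0'
    push_cast at h1 ⊢
    exact h1
  have hlt := h.eventually_lt_abs (s := K * e) (by push_cast; exact hK)
  push_cast at hlt
  filter_upwards [hall, hlt, eventually_ge_atTop 1,
    eventually_two_pow (eventually_le_natCast_rpow he0 (K + 1))] with k hk hk2 hk1 hk3
  have hk2' : ∀ j < 2 ^ k, ((2 ^ k : ℕ) : ℝ) ^ (-(K * e) : ℝ) < |gridIncrement X (2 ^ k) j| := by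
    push_cast; exact hk2
  clear hk2
  set n : ℕ := 2 ^ k with hn
  have hn1 : (1 : ℝ) < n := by exact_mod_cast Nat.one_lt_two_pow (by omega)
  have hn0 : (0 : ℝ) < n := by linarith
  calc partitionSum X (-1) n
      ≤ ∑ j ∈ Finset.range n, (1 + ∑ i ∈ Finset.range K,
        (n : ℝ) ^ ((i + 1) * e : ℝ) * {y : ℝ | |y| ≤ (n : ℝ) ^ (-(i * e) : ℝ)}.indicator 1
          (gridIncrement X n j)) := by
        refine Finset.sum_le_sum fun j hj => ?_
        have h1 := inv_le_sum_indicator hn1 (hk2' j (Finset.mem_range.1 hj))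
        split_ifs
        · exact (inv_nonneg.2 (abs_nonneg _)).trans h1
        · rwa [Real.rpow_neg_one]
    _ = n + ∑ i ∈ Finset.range K, (n : ℝ) ^ ((i + 1) * e : ℝ) *
        ∑ j ∈ Finset.range n, {y : ℝ | |y| ≤ (n : ℝ) ^ (-(i * e) : ℝ)}.indicator 1
          (gridIncrement X n j) := by
        rw [Finset.sum_add_distrib, Finset.sum_comm, Finset.sum_const, Finset.card_range,
          nsmul_eq_mul, mul_one]
        simp_rw [Finset.mul_sum]
    _ ≤ n + ∑ i ∈ Finset.range K, (n : ℝ) ^ ((i + 1) * e : ℝ) *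
        (n : ℝ) ^ (1 + 1 / c - i * e + e : ℝ) := by
        gcongr with i hi
        exact hk i hi
    _ = n + K * (n : ℝ) ^ (1 + 1 / c + 2 * e : ℝ) := by
        congr 1
        have h1 : ∀ i ∈ Finset.range K, (n : ℝ) ^ ((i + 1) * e : ℝ) *
            (n : ℝ) ^ (1 + 1 / c - i * e + e : ℝ) = (n : ℝ) ^ (1 + 1 / c + 2 * e : ℝ) :=
          fun i _ => by
            rw [← Real.rpow_add hn0]
            congr 1; ring
        rw [Finset.sum_congr rfl h1, Finset.sum_const, Finset.card_range, nsmul_eq_mul]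
    _ ≤ (K + 1) * (n : ℝ) ^ (1 + 1 / c + 2 * e : ℝ) := by
        have h3 : (n : ℝ) ^ (1 : ℝ) ≤ (n : ℝ) ^ (1 + 1 / c + 2 * e : ℝ) :=
          Real.rpow_le_rpow_of_exponent_le hn1.le (by
            have : 0 < 1 / c := by positivity
            linarith)
        rw [Real.rpow_one] at h3
        linarith
    _ ≤ (n : ℝ) ^ (e : ℝ) * (n : ℝ) ^ (1 + 1 / c + 2 * e : ℝ) := by gcongr
    _ = (n : ℝ) ^ (1 + 1 / c + 3 * e : ℝ) := by rw [← Real.rpow_add hn0]; congr 1; ring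
    _ ≤ (n : ℝ) ^ z := Real.rpow_le_rpow_of_exponent_le hn1.le (by linarith)

end Spectra

/-! ### The explicit spectrum -/

section ExplicitSpectrum

variable {c d : ℝ}

theorem multistableSpectrum_eq_bot (hc : 0 < c) {β : ℝ}
    (h : β ∉ Icc (0 : ℝ) (1 + 1 / c)) (hcd : c ≤ d) : multistableSpectrum c d β = ⊥ := by
  have h1 : 1 / d ≤ 1 / c := one_div_le_one_div_of_le hc hcd
  have h2 : 0 < 1 / c := by positivity
  rw [mem_Icc, not_and_or, not_le, not_le] at h
  rw [multistableSpectrum]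
  rcases h with h | h
  · rw [if_pos h]
  · rw [if_neg (by linarith), if_neg (by linarith), if_neg (by linarith), if_neg (by linarith)]

theorem multistableSpectrum_eq_min (hc : 0 < c) (hcd : c ≤ d) {β : ℝ}
    (h : β ∈ Icc (0 : ℝ) (1 + 1 / c)) :
    multistableSpectrum c d β = ((min (β * d) (min 1 (1 + 1 / c - β)) : ℝ) : EReal) := by
  have hd : 0 < d := hc.trans_le hcd
  have h1 : 1 / d ≤ 1 / c := one_div_le_one_div_of_le hc hcd
  rw [multistableSpectrum, if_neg (not_lt.2 h.1)]
  split_ifs with h2 h3 h4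
  · have h5 : β * d ≤ 1 := by rwa [← le_div_iff₀ hd]
    rw [min_eq_left (le_min h5 (by linarith))]
  · have h5 : 1 < β * d := by rwa [← div_lt_iff₀ hd, ← not_le]
    rw [min_eq_left (a := (1 : ℝ)) (by linarith), min_eq_right h5.le, EReal.coe_one]
  · have h5 : 1 < β * d := by rwa [← div_lt_iff₀ hd, ← not_le]
    rw [min_eq_right (a := (1 : ℝ)) (by linarith), min_eq_right (by linarith)]
  · exact absurd h.2 h4

theorem isConcaveEReal_multistableSpectrum (hc : 0 < c) (hcd : c ≤ d) :
    IsConcaveEReal (multistableSpectrum c d) := by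
  have hset : {p : ℝ × ℝ | (p.2 : EReal) ≤ multistableSpectrum c d p.1}
      = {p : ℝ × ℝ | (0 ≤ p.1 ∧ p.1 ≤ 1 + 1 / c) ∧
        p.2 ≤ p.1 * d ∧ p.2 ≤ 1 ∧ p.2 ≤ 1 + 1 / c - p.1} := by
    ext ⟨x, y⟩
    simp only [mem_ofPred_eq]
    by_cases hx : x ∈ Icc (0 : ℝ) (1 + 1 / c)
    · rw [multistableSpectrum_eq_min hc hcd hx, EReal.coe_le_coe_iff, le_min_iff, le_min_iff]
      exact ⟨fun h => ⟨hx, h⟩, fun h => h.2⟩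
    · rw [multistableSpectrum_eq_bot hc hx hcd]
      simp only [le_bot_iff, EReal.coe_ne_bot, false_iff]
      exact fun h => hx h.1
  rw [IsConcaveEReal, hset]
  rintro ⟨x, y⟩ ⟨⟨h1, h2⟩, h3, h4, h5⟩ ⟨x', y'⟩ ⟨⟨h1', h2'⟩, h3', h4', h5'⟩ a b ha hb hab
  simp only [mem_ofPred_eq, Prod.smul_mk, Prod.mk_add_mk, smul_eq_mul] at *
  have hb' : b = 1 - a := by linarith
  refine ⟨⟨by positivity, ?_⟩, ?_, ?_, ?_⟩
  · nlinarith [mul_le_mul_of_nonneg_left h2 ha, mul_le_mul_of_nonneg_left h2' hb]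
  · nlinarith [mul_le_mul_of_nonneg_left h3 ha, mul_le_mul_of_nonneg_left h3' hb]
  · nlinarith [mul_le_mul_of_nonneg_left h4 ha, mul_le_mul_of_nonneg_left h4' hb]
  · nlinarith [mul_le_mul_of_nonneg_left h5 ha, mul_le_mul_of_nonneg_left h5' hb]

theorem legendreSpectrum_le_multistableSpectrum {X : ℝ → ℝ} (hc : 0 < c) (hcd : c ≤ d)
    (hL : LargeIncrementBound X c d) (hS : SmallIncrementBound X c) (β : ℝ) :
    legendreSpectrum X β ≤ multistableSpectrum c d β := by
  by_cases h : β ∈ Icc (0 : ℝ) (1 + 1 / c)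
  · rw [multistableSpectrum_eq_min hc hcd h, EReal.coe_strictMono.monotone.map_min,
      EReal.coe_strictMono.monotone.map_min]
    refine le_min ?_ (le_min ?_ ?_)
    · refine (iInf_le _ d).trans ((add_le_add_right (hL.momentExponent_le_zero hc hcd) _).trans ?_)
      rw [add_zero, mul_comm]
    · refine (iInf_le _ 0).trans ((add_le_add_right (momentExponent_zero_le X) _).trans ?_)
      simp
    · refine (iInf_le _ (-1)).trans
        ((add_le_add_right (hS.momentExponent_neg_one_le hc) _).trans ?_)
      rw [← EReal.coe_add, EReal.coe_le_coe_iff]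
      linarith
  · rw [mem_Icc, not_and_or, not_le, not_le] at h
    rcases h with h | h
    · rw [hL.legendreSpectrum_eq_bot hc hcd h]; exact bot_le
    · rw [hS.legendreSpectrum_eq_bot h]; exact bot_le

/-- The lower bound for the large deviation spectrum only has to be checked on a dense set of
exponents: the windows are nested and the bound is continuous. -/
theorem multistableSpectrum_le_largeDeviationSpectrum {X : ℝ → ℝ} (hc : 0 < c) (hcd : c ≤ d)
    {D : Set ℝ} (hD : Dense D)
    (h : ∀ β ∈ D, β ∈ Ioo (0 : ℝ) (1 + 1 / c) → ∀ ε y : ℚ, 0 < ε →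
      (y : ℝ) < min (β * d) (min 1 (1 + 1 / c - β)) →
      ∀ᶠ n : ℕ in atTop, (n : ℝ) ^ (y : ℝ) ≤ coarseCount X ε β n) (β : ℝ) :
    multistableSpectrum c d β ≤ largeDeviationSpectrum X β := by
  by_cases hβ : β ∈ Icc (0 : ℝ) (1 + 1 / c)
  · rw [multistableSpectrum_eq_min hc hcd hβ]
    refine le_iInf₂ fun ε hε => EReal.ge_of_forall_gt_iff_ge.1 fun z hz => ?_
    rw [EReal.coe_lt_coe_iff] at hz
    have hε' : (0 : ℝ) < ε := hε
    set f : ℝ → ℝ := fun b => min (b * d) (min 1 (1 + 1 / c - b))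
    have hf : Continuous f := by fun_prop
    set U : Set ℝ := {b | z < f b} ∩ Metric.ball β (ε / 2)
    have hU : IsOpen U := (isOpen_lt continuous_const hf).inter Metric.isOpen_ball
    have hne : (U ∩ Ioo (0 : ℝ) (1 + 1 / c)).Nonempty := by
      have hcl : β ∈ closure (Ioo (0 : ℝ) (1 + 1 / c)) := by
        rw [closure_Ioo (by positivity)]; exact hβ
      exact mem_closure_iff.1 hcl U hU ⟨hz, Metric.mem_ball_self (by linarith)⟩
    obtain ⟨b, ⟨⟨hb1, hb2⟩, hb3⟩, hbD⟩ := hD.inter_open_nonempty _ (hU.inter isOpen_Ioo) hne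
    obtain ⟨y, hy1, hy2⟩ := exists_rat_btwn (show z < f b from hb1)
    obtain ⟨e, he1, he2⟩ := exists_rat_btwn (show 0 < ε / 2 by linarith)
    rw [Metric.mem_ball, Real.dist_eq, abs_lt] at hb2
    refine le_coarseGrowth ?_
    filter_upwards [h b hbD hb3 e y (by exact_mod_cast he1) hy2, eventually_ge_atTop 1] with n hn hn1
    have hn1' : (1 : ℝ) ≤ n := by exact_mod_cast hn1
    refine (Real.rpow_le_rpow_of_exponent_le hn1' hy1.le).trans (hn.trans ?_)
    have hsub : coarseCount X e b n ≤ coarseCount X ε β n := by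
      refine Set.ncard_le_ncard ?_ ((Set.finite_lt_nat n).subset fun j hj => hj.1)
      rintro j ⟨h1, h2, h3, h4⟩
      exact ⟨h1, h2, by linarith, by linarith⟩
    exact_mod_cast hsub
  · rw [multistableSpectrum_eq_bot hc hβ hcd]
    exact bot_le

end ExplicitSpectrum

/-! ### The Hausdorff spectrum -/

/-- If long runs of increments smaller than `n ^ (-l)` do not occur, then no point has a pointwise
exponent strictly between `l` and `1`. -/
theorem setOf_pointwiseExponent_eq_empty {X : ℝ → ℝ} {l h : ℝ} (hl : 0 < l) (hlh : l < h)
    (hh : h < 1) {m : ℕ}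
    (hX : ∀ᶠ k : ℕ in atTop, ∀ j : ℕ, j + m ≤ 2 ^ k →
      ∃ i < m, ((2 ^ k : ℕ) : ℝ) ^ (-l) < |gridIncrement X (2 ^ k) (j + i)|) :
    {t ∈ Icc (0 : ℝ) 1 | pointwiseExponent X t = (h : EReal)} = ∅ := by
  rw [eq_empty_iff_forall_notMem]
  rintro t ⟨ht, hth⟩
  have h1 : (l : EReal) < pointwiseExponent X t := by rw [hth]; exact_mod_cast hlh
  obtain ⟨⟨r, hr0, hr⟩, hlr⟩ := lt_iSup_iff.1 h1
  have hlr' : l < r := by exact_mod_cast hlr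
  have hr1 : r < 1 := by
    have h2 : (r : EReal) ≤ pointwiseExponent X t :=
      le_iSup (fun l : {l : ℝ // 0 ≤ l ∧ PointwiseHolder X l t} => ((l : ℝ) : EReal)) ⟨r, hr0, hr⟩
    rw [hth, EReal.coe_le_coe_iff] at h2
    linarith
  obtain ⟨p, K, hp, hpK⟩ := hr
  rw [Nat.floor_eq_zero.2 hr1, Nat.le_zero] at hp
  obtain ⟨a, ha⟩ := Polynomial.natDegree_eq_zero.1 hp
  subst ha
  simp only [Polynomial.eval_C] at hpK
  obtain ⟨δ, hδ, hball⟩ := Metric.mem_nhdsWithin_iff.1 hpK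
  have hT : Tendsto (fun k : ℕ => ((2 ^ k : ℕ) : ℝ)) atTop atTop :=
    tendsto_natCast_atTop_atTop.comp (tendsto_pow_atTop_atTop_of_one_lt (one_lt_two : 1 < 2))
  obtain ⟨k, hk1, hk2, hk3, hk4⟩ := (hX.and ((hT.eventually_gt_atTop ((m + 1) / δ)).and
    ((hT.eventually_ge_atTop m).and (((tendsto_rpow_atTop (sub_pos.2 hlr')).comp hT).eventually_ge_atTop
      (2 * |K| * (m + 1) ^ r))))).exists
  simp only [Function.comp_apply] at hk4
  set n : ℕ := 2 ^ k with hn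
  have hn1 : 1 ≤ n := Nat.one_le_two_pow
  have hn0 : (0 : ℝ) < n := by exact_mod_cast hn1
  have hmn : m ≤ n := by exact_mod_cast hk3
  set j := min ⌊n * t⌋₊ (n - m) with hj
  have hjm : j + m ≤ n := by
    have := min_le_right ⌊n * t⌋₊ (n - m)
    omega
  have hj1 : (j : ℝ) ≤ n * t := by
    refine le_trans ?_ (Nat.floor_le (mul_nonneg hn0.le ht.1))
    exact_mod_cast min_le_left _ _
  have hj2 : n * t ≤ j + (m + 1) := by
    rcases min_choice ⌊n * t⌋₊ (n - m) with h2 | h2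
    · rw [hj, h2]
      have := Nat.lt_floor_add_one (n * t)
      have : (0 : ℝ) ≤ m := Nat.cast_nonneg m
      linarith
    · rw [hj, h2, Nat.cast_sub hmn]
      nlinarith [ht.2]
  have hpt : ∀ i : ℕ, i ≤ m → |X (((j + i : ℕ) : ℝ) / n) - a| ≤ |K| * ((m + 1) / n) ^ r := by
    intro i hi
    have hi' : (i : ℝ) ≤ m := by exact_mod_cast hi
    have hi0 : (0 : ℝ) ≤ i := Nat.cast_nonneg i
    have hdist : |((j + i : ℕ) : ℝ) / n - t| ≤ (m + 1) / n := by
      rw [show ((j + i : ℕ) : ℝ) / n - t = (((j + i : ℕ) : ℝ) - n * t) / n by field_simp, abs_div,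
        abs_of_pos hn0]
      gcongr
      push_cast
      exact abs_le.2 ⟨by linarith, by linarith⟩
    have hmem : ((j + i : ℕ) : ℝ) / n ∈ Metric.ball t δ ∩ Icc (0 : ℝ) 1 := by
      refine ⟨?_, by positivity, ?_⟩
      · rw [Metric.mem_ball, Real.dist_eq]
        refine hdist.trans_lt ?_
        rw [div_lt_iff₀ hδ] at hk2
        rw [div_lt_iff₀ hn0]
        linarith
      · rw [div_le_one hn0]
        exact_mod_cast (show j + i ≤ n by omega)
    have h3 : |X (((j + i : ℕ) : ℝ) / n) - a| ≤ K * |((j + i : ℕ) : ℝ) / n - t| ^ r := hball hmem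
    refine h3.trans (mul_le_mul (le_abs_self K) ?_ (Real.rpow_nonneg (abs_nonneg _) _)
      (abs_nonneg _))
    exact Real.rpow_le_rpow (abs_nonneg _) hdist hr0
  obtain ⟨i, hi, hbig⟩ := hk1 j hjm
  have h4 : |gridIncrement X n (j + i)| ≤ 2 * (|K| * ((m + 1) / n) ^ r) := by
    have h5 := hpt i hi.le
    have h6 := hpt (i + 1) hi
    rw [show ((j + (i + 1) : ℕ) : ℝ) = ((j + i : ℕ) : ℝ) + 1 by push_cast; ring] at h6
    rw [gridIncrement]
    calc _ = |(X ((((j + i : ℕ) : ℝ) + 1) / n) - a) - (X (((j + i : ℕ) : ℝ) / n) - a)| := by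
          congr 1; ring
      _ ≤ _ := (abs_sub _ _).trans (by linarith)
  have h7 : 2 * (|K| * (((m : ℝ) + 1) / n) ^ r) ≤ (n : ℝ) ^ (-l) := by
    rw [Real.div_rpow (by positivity) hn0.le, show (-l) = (r - l) + -r by ring, Real.rpow_add hn0,
      Real.rpow_neg hn0.le, ← div_eq_mul_inv]
    rw [show 2 * (|K| * (((m : ℝ) + 1) ^ r / (n : ℝ) ^ r)) = 2 * |K| * (m + 1) ^ r / (n : ℝ) ^ r by
      ring]
    gcongr
  linarith

/-! ### Spectra of functions with independent multistable increments -/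

section MultistableSpectra

variable {Ω : Type*} [MeasurableSpace Ω] {P : Measure Ω} [IsProbabilityMeasure P]
  {X : Ω → ℝ → ℝ} {α : ℝ → ℝ} {c d : ℝ}

namespace HasMultistableIncrements

theorem ae_eventually_rpow_le_coarseCount_of_lt (hX : HasMultistableIncrements P X α)
    (hα : Continuous α) (hc : 1 < c) (hcα : ∀ v, c ≤ α v) (hαd : ∀ v, α v ≤ d) (hd : d < 2)
    (hmin : ∃ t ∈ Icc (0 : ℝ) 1, α t = c) (hmax : ∃ t ∈ Icc (0 : ℝ) 1, α t = d) {β : ℝ}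
    (hβ : β ∈ Ioo (0 : ℝ) (1 + 1 / c)) (hβc : β ≠ 1 / c) {ε y : ℝ} (hε : 0 < ε)
    (hy : y < min (β * d) (min 1 (1 + 1 / c - β))) :
    ∀ᵐ ω ∂P, ∀ᶠ n : ℕ in atTop, (n : ℝ) ^ y ≤ coarseCount (X ω) ε β n := by
  have hc0 : 0 < c := by linarith
  obtain ⟨t₀, ht₀, hαt₀⟩ := hmin
  obtain ⟨t₁, ht₁, hαt₁⟩ := hmax
  rw [lt_min_iff, lt_min_iff] at hy
  have hmono : ∀ y' : ℝ, y ≤ y' → (∀ᵐ ω ∂P, ∀ᶠ n : ℕ in atTop,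
      (n : ℝ) ^ y' ≤ coarseCount (X ω) ε β n) →
      ∀ᵐ ω ∂P, ∀ᶠ n : ℕ in atTop, (n : ℝ) ^ y ≤ coarseCount (X ω) ε β n := by
    intro y' hy' h
    filter_upwards [h] with ω hω
    filter_upwards [hω, eventually_ge_atTop 1] with n hn hn1
    exact (Real.rpow_le_rpow_of_exponent_le (by exact_mod_cast hn1) hy').trans hn
  rcases lt_or_gt_of_ne hβc with h1 | h1
  · have h2 : β * c < 1 := by rwa [lt_div_iff₀ hc0] at h1
    -- it suffices to find a point `t` with `β α(t) < 1` as close to `min (β d) 1` as required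
    obtain ⟨t, ht, ht1, ht2⟩ : ∃ t ∈ Icc (0 : ℝ) 1, y ≤ β * α t ∧ β * α t < 1 := by
      rcases lt_or_ge (β * d) 1 with h3 | h3
      · exact ⟨t₁, ht₁, by rw [hαt₁]; exact hy.1.le, by rwa [hαt₁]⟩
      · set w := (max y (β * c) + 1) / 2 with hw
        have hw1 : max y (β * c) < 1 := max_lt hy.2.1 h2
        have hw2 : w / β ∈ Icc (α t₀) (α t₁) := by
          rw [hαt₀, hαt₁]
          constructor
          · rw [le_div_iff₀ hβ.1]
            linarith [le_max_right y (β * c)]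
          · rw [div_le_iff₀ hβ.1]
            linarith
        have hiv := isPreconnected_Icc.intermediate_value ht₀ ht₁ hα.continuousOn hw2
        obtain ⟨t, ht, hαt⟩ := hiv
        refine ⟨t, ht, ?_, ?_⟩ <;> rw [hαt, mul_div_cancel₀ _ hβ.1.ne']
        · linarith [le_max_left y (β * c)]
        · linarith
    exact hmono _ ht1 (hX.ae_eventually_le_coarseCount_of_mul_lt_one hα hc0 hcα hαd hd ht hβ.1
      ht2 hε)
  · exact hmono _ hy.2.2.le (hX.ae_eventually_le_coarseCount_of_one_div_lt hα hc hcα hαd ht₀ hαt₀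
      h1 hβ.2 hε)

/-- The multifractal spectra of a random function with independent multistable increments. -/
theorem ae_spectra (hX : HasMultistableIncrements P X α)
    (hα : Continuous α) (hc : 1 < c) (hcα : ∀ v, c ≤ α v) (hαd : ∀ v, α v ≤ d) (hd : d < 2)
    (hmin : ∃ t ∈ Icc (0 : ℝ) 1, α t = c) (hmax : ∃ t ∈ Icc (0 : ℝ) 1, α t = d) :
    ∀ᵐ ω ∂P, (∀ β, largeDeviationSpectrum (X ω) β = multistableSpectrum c d β) ∧
      (∀ β, legendreSpectrum (X ω) β = multistableSpectrum c d β) ∧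
      IsConcaveEReal (largeDeviationSpectrum (X ω)) ∧
      hausdorffSpectrum (X ω) ≠ largeDeviationSpectrum (X ω) := by
  have hc0 : 0 < c := by linarith
  have hcd : c ≤ d := (hcα 0).trans (hαd 0)
  have hcinv : 1 / c < 1 := by rw [div_lt_one hc0]; exact hc
  have hcinv0 : 0 < 1 / c := by positivity
  set D : Set ℝ := range ((↑) : ℚ → ℝ) \ {1 / c}
  have hDc : D.Countable := (countable_range _).mono sdiff_subset
  have hD : Dense D := Rat.denseRange_cast.sdiff_singleton _
  have hlow : ∀ᵐ ω ∂P, ∀ β ∈ D, β ∈ Ioo (0 : ℝ) (1 + 1 / c) → ∀ ε y : ℚ, 0 < ε →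
      (y : ℝ) < min (β * d) (min 1 (1 + 1 / c - β)) →
      ∀ᶠ n : ℕ in atTop, (n : ℝ) ^ (y : ℝ) ≤ coarseCount (X ω) ε β n := by
    rw [ae_ball_iff hDc]
    intro β hβ
    simp only [ae_all_iff, Filter.eventually_imp_distrib_left]
    intro hβ' ε y hε hy
    exact hX.ae_eventually_rpow_le_coarseCount_of_lt hα hc hcα hαd hd hmin hmax hβ' hβ.2
      (by exact_mod_cast hε) hy
  have hL : ∀ᵐ ω ∂P, LargeIncrementBound (X ω) c d := by
    simp only [LargeIncrementBound, ae_all_iff, Filter.eventually_imp_distrib_left]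
    intro s η hη
    exact hX.ae_eventually_card_gt_le hα hc0 hcα hαd hd s (by exact_mod_cast hη)
  have hS : ∀ᵐ ω ∂P, SmallIncrementBound (X ω) c := by
    simp only [SmallIncrementBound, ae_all_iff, Filter.eventually_imp_distrib_left]
    intro s η hη
    exact hX.ae_eventually_card_le_le hα hc hcα hαd s (by exact_mod_cast hη)
  set h := (1 / c + 1) / 2 with hh
  set l := (1 / c + h) / 2 with hl
  obtain ⟨m, hm⟩ := hX.exists_ae_eventually_exists_lt hα hc hcα hαd (show 1 / c < l by linarith)
  filter_upwards [hlow, hL, hS, hm] with ω h1 h2 h3 h4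
  have hge := multistableSpectrum_le_largeDeviationSpectrum (X := X ω) hc0 hcd hD h1
  have hle := legendreSpectrum_le_multistableSpectrum hc0 hcd h2 h3
  have hgl := largeDeviationSpectrum_le_legendreSpectrum (X ω)
  have hg : ∀ β, largeDeviationSpectrum (X ω) β = multistableSpectrum c d β := fun β =>
    le_antisymm ((hgl β).trans (hle β)) (hge β)
  refine ⟨hg, fun β => le_antisymm (hle β) ((hge β).trans (hgl β)), ?_, fun heq => ?_⟩
  · rw [show largeDeviationSpectrum (X ω) = multistableSpectrum c d from funext hg]
    exact isConcaveEReal_multistableSpectrum hc0 hcd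
  · -- at `h`, strictly between `1 / c` and `1`, the Hausdorff spectrum is `-∞`
    have h5 := congrFun heq h
    rw [hg, multistableSpectrum_eq_min hc0 hcd ⟨by linarith, by linarith⟩, hausdorffSpectrum,
      if_pos (setOf_pointwiseExponent_eq_empty (by linarith) (by linarith) (by linarith) h4)] at h5
    exact EReal.coe_ne_bot _ h5.symm

end HasMultistableIncrements

end MultistableSpectra

/-! ### The stable normalization constant -/

section StableConst

theorem integrableOn_Ioi_of_le_rpow {f : ℝ → ℝ} (hf : ContinuousOn f (Ioi 0)) {C p r : ℝ}
    (hp : -1 < p) (hr : r < -1) (h0 : ∀ x, 0 < x → x ≤ 1 → |f x| ≤ C * x ^ p)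
    (h1 : ∀ x, 1 < x → |f x| ≤ C * x ^ r) : IntegrableOn f (Ioi 0) := by
  rw [← Ioc_union_Ioi_eq_Ioi (zero_le_one (α := ℝ))]
  refine IntegrableOn.union ?_ ?_
  · have h2 : IntegrableOn (fun x : ℝ => C * x ^ p) (Ioc 0 1) :=
      ((intervalIntegrable_iff_integrableOn_Ioc_of_le zero_le_one).1
        (intervalIntegral.intervalIntegrable_rpow' hp)).const_mul C
    refine Integrable.mono' h2 ((hf.mono Ioc_subset_Ioi_self).aestronglyMeasurable
      measurableSet_Ioc) ?_
    exact (ae_restrict_iff' measurableSet_Ioc).2 (Eventually.of_forall fun x hx => h0 x hx.1 hx.2)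
  · have h2 : IntegrableOn (fun x : ℝ => C * x ^ r) (Ioi 1) :=
      (integrableOn_Ioi_rpow_of_lt hr zero_lt_one).const_mul C
    refine Integrable.mono' h2 ((hf.mono (Ioi_subset_Ioi zero_le_one)).aestronglyMeasurable
      measurableSet_Ioi) ?_
    exact (ae_restrict_iff' measurableSet_Ioi).2 (Eventually.of_forall fun x hx => h1 x hx)

theorem continuousOn_rpow_Ioi (p : ℝ) : ContinuousOn (fun x : ℝ => x ^ p) (Ioi 0) := fun x hx =>
  (Real.continuousAt_rpow_const x p (Or.inl (ne_of_gt hx))).continuousWithinAt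

theorem one_sub_cos_le_sq (x : ℝ) : 1 - Real.cos x ≤ x ^ 2 := by
  have := Real.one_sub_sq_div_two_le_cos (x := x)
  nlinarith [sq_nonneg x]

variable {s : ℝ}

theorem integrableOn_rpow_mul_sin (h1 : 1 < s) (h2 : s < 2) :
    IntegrableOn (fun x : ℝ => x ^ (-s) * Real.sin x) (Ioi 0) := by
  refine integrableOn_Ioi_of_le_rpow (C := 1) (p := 1 - s) (r := -s)
    ((continuousOn_rpow_Ioi _).mul Real.continuous_sin.continuousOn) (by linarith) (by linarith)
    (fun x hx _ => ?_) fun x hx => ?_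
  · rw [abs_mul, abs_of_nonneg (Real.rpow_nonneg hx.le _), one_mul, sub_eq_neg_add,
      Real.rpow_add hx, Real.rpow_one]
    have := Real.abs_sin_le_abs (x := x)
    rw [abs_of_pos hx] at this
    gcongr
  · have hx0 : 0 < x := by linarith
    rw [abs_mul, abs_of_nonneg (Real.rpow_nonneg hx0.le _), one_mul]
    exact mul_le_of_le_one_right (Real.rpow_nonneg hx0.le _) (Real.abs_sin_le_one x)

theorem integrableOn_rpow_mul_one_sub_cos (h1 : 1 < s) (h2 : s < 2) :
    IntegrableOn (fun x : ℝ => x ^ (-s - 1) * (1 - Real.cos x)) (Ioi 0) := by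
  refine integrableOn_Ioi_of_le_rpow (C := 2) (p := 1 - s) (r := -s - 1)
    ((continuousOn_rpow_Ioi _).mul (by fun_prop)) (by linarith) (by linarith)
    (fun x hx _ => ?_) fun x hx => ?_
  · rw [abs_of_nonneg (mul_nonneg (Real.rpow_nonneg hx.le _) (by linarith [Real.cos_le_one x])),
      show 1 - s = (-s - 1) + 2 by ring, Real.rpow_add hx]
    have h3 := one_sub_cos_le_sq x
    have h4 := Real.rpow_nonneg hx.le (-s - 1)
    have h5 : x ^ (2 : ℝ) = x ^ 2 := by norm_cast
    rw [h5]
    nlinarith [mul_le_mul_of_nonneg_left h3 h4, mul_nonneg h4 (sq_nonneg x)]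
  · have hx0 : 0 < x := by linarith
    rw [abs_of_nonneg (mul_nonneg (Real.rpow_nonneg hx0.le _) (by linarith [Real.cos_le_one x])),
      mul_comm]
    gcongr
    linarith [Real.neg_one_le_cos x]

/-- Integration by parts in the integral defining the stable constant. -/
theorem integral_rpow_mul_sin_eq (h1 : 1 < s) (h2 : s < 2) :
    ∫ x in Ioi (0 : ℝ), x ^ (-s) * Real.sin x
      = s * ∫ x in Ioi (0 : ℝ), x ^ (-s - 1) * (1 - Real.cos x) := by
  have hparts := integral_Ioi_mul_deriv_eq_deriv_mul (a := (0 : ℝ)) (a' := (0 : ℝ)) (b' := (0 : ℝ))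
    (u := fun x : ℝ => x ^ (-s)) (u' := fun x => -s * x ^ (-s - 1))
    (v := fun x => 1 - Real.cos x) (v' := fun x => Real.sin x)
    (fun x hx => Real.hasDerivAt_rpow_const (Or.inl (ne_of_gt hx)))
    (fun x _ => by simpa using (Real.hasDerivAt_cos x).const_sub 1)
    (integrableOn_rpow_mul_sin h1 h2) ?_ ?_ ?_
  · rw [hparts, ← integral_const_mul, sub_zero, zero_sub, ← integral_neg]
    refine integral_congr_ae (Eventually.of_forall fun x => ?_)
    simp only
    ring
  · have h3 := (integrableOn_rpow_mul_one_sub_cos h1 h2).const_mul (-s)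
    refine h3.congr (Eventually.of_forall fun x => ?_)
    simp only [Pi.mul_apply]
    ring
  · have h3 : Tendsto (fun x : ℝ => x ^ (2 - s)) (𝓝[>] 0) (𝓝 0) := by
      have h4 := (Real.continuousAt_rpow_const 0 (2 - s) (Or.inr (by linarith))).tendsto
      rw [Real.zero_rpow (by linarith)] at h4
      exact h4.mono_left nhdsWithin_le_nhds
    refine squeeze_zero' ?_ ?_ h3
    · filter_upwards [self_mem_nhdsWithin] with x hx
      exact mul_nonneg (Real.rpow_nonneg (le_of_lt hx) _) (by linarith [Real.cos_le_one x])
    · filter_upwards [self_mem_nhdsWithin] with x hx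
      have hx0 : 0 < x := hx
      have h5 : x ^ (2 - s) = x ^ (-s) * x ^ 2 := by
        rw [sub_eq_neg_add, Real.rpow_add hx0]; norm_cast
      rw [h5]
      exact mul_le_mul_of_nonneg_left (one_sub_cos_le_sq x) (Real.rpow_nonneg hx0.le _)
  · have h3 : Tendsto (fun x : ℝ => x ^ (-s) * 2) atTop (𝓝 0) := by
      simpa using (tendsto_rpow_neg_atTop (show 0 < s by linarith)).mul_const 2
    refine squeeze_zero' ?_ ?_ h3
    · filter_upwards [eventually_gt_atTop 0] with x hx
      exact mul_nonneg (Real.rpow_nonneg (le_of_lt hx) _) (by linarith [Real.cos_le_one x])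
    · filter_upwards [eventually_gt_atTop 0] with x hx
      exact mul_le_mul_of_nonneg_left (by linarith [Real.neg_one_le_cos x])
        (Real.rpow_nonneg hx.le _)

/-- The interval `[1, 2]` alone contributes `1 / 8 * 1 / 5` to the integral on the right of
`integral_rpow_mul_sin_eq`, whatever the index. -/
theorem inv_le_integral_rpow_mul_sin (h1 : 1 < s) (h2 : s < 2) :
    (1 / 40 : ℝ) ≤ ∫ x in Ioi (0 : ℝ), x ^ (-s) * Real.sin x := by
  have hnn : ∀ x ∈ Ioi (0 : ℝ), 0 ≤ x ^ (-s - 1) * (1 - Real.cos x) := fun x hx =>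
    mul_nonneg (Real.rpow_nonneg (le_of_lt hx) _) (by linarith [Real.cos_le_one x])
  have h3 : (1 / 40 : ℝ) ≤ ∫ x in Ioi (0 : ℝ), x ^ (-s - 1) * (1 - Real.cos x) := by
    have h4 : ∫ _x in Ioc (1 : ℝ) 2, (1 / 40 : ℝ)
        ≤ ∫ x in Ioc (1 : ℝ) 2, x ^ (-s - 1) * (1 - Real.cos x) := by
      refine setIntegral_mono_on (integrable_const _)
        ((integrableOn_rpow_mul_one_sub_cos h1 h2).mono_set fun x hx => ?_) measurableSet_Ioc
        fun x hx => ?_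
      · exact zero_lt_one.trans hx.1
      · have h5 : 1 / 5 ≤ 1 - Real.cos x := by
          have h6 := sq_le_five_mul_one_sub_cos (u := 1) (by norm_num)
          have h7 := Real.cos_le_cos_of_nonneg_of_le_pi (x := 1) (y := x) (by norm_num)
            (by linarith [hx.2, Real.pi_gt_three]) hx.1.le
          linarith
        have h6 : (1 / 8 : ℝ) ≤ x ^ (-s - 1) := by
          have h7 : (2 : ℝ) ^ (-s - 1) ≤ x ^ (-s - 1) :=
            Real.rpow_le_rpow_of_nonpos (by linarith [hx.1]) hx.2 (by linarith)
          have h8 : (2 : ℝ) ^ (-3 : ℝ) ≤ 2 ^ (-s - 1) :=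
            Real.rpow_le_rpow_of_exponent_le (by norm_num) (by linarith)
          have h9 : (2 : ℝ) ^ (-3 : ℝ) = 1 / 8 := by
            rw [Real.rpow_neg (by norm_num)]; norm_num
          exact (h9.symm.trans_le h8).trans h7
        nlinarith
    have h5 := setIntegral_mono_set (integrableOn_rpow_mul_one_sub_cos h1 h2)
      ((ae_restrict_iff' measurableSet_Ioi).2 (Eventually.of_forall hnn))
      (LE.le.eventuallyLE
        (show Ioc (1 : ℝ) 2 ⊆ Ioi 0 from fun x hx => zero_lt_one.trans hx.1))
    rw [setIntegral_const, Real.volume_real_Ioc_of_le (by norm_num)] at h4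
    norm_num at h4
    linarith
  rw [integral_rpow_mul_sin_eq h1 h2]
  nlinarith

theorem stableConst_pos (h1 : 1 < s) (h2 : s < 2) : 0 < stableConst s :=
  inv_pos.2 (lt_of_lt_of_le (by norm_num) (inv_le_integral_rpow_mul_sin h1 h2))

theorem stableConst_le (h1 : 1 < s) (h2 : s < 2) : stableConst s ≤ 40 := by
  rw [stableConst]
  refine (inv_anti₀ (by norm_num) (inv_le_integral_rpow_mul_sin h1 h2)).trans (by norm_num)

theorem measurable_stableConst : Measurable stableConst := by
  have h : Measurable fun p : ℝ × ℝ => p.2 ^ (-p.1) * Real.sin p.2 := by fun_prop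
  exact (h.stronglyMeasurable.integral_prod_right
    (ν := volume.restrict (Ioi (0 : ℝ)))).measurable.inv

/-- The Lévy–Khintchine integral of the stable jump measure. -/
theorem integral_one_sub_cos_mul_rpow (h1 : 1 < s) (h2 : s < 2) (y : ℝ) :
    ∫ t in Ioi (0 : ℝ), (1 - Real.cos (y * t ^ (-(1 / s)))) = |y| ^ s * (stableConst s)⁻¹ := by
  have hs : 0 < s := by linarith
  wlog hy : 0 ≤ y generalizing y
  · have h0 := this |y| (abs_nonneg y)
    rw [abs_abs] at h0
    rw [← h0]
    refine integral_congr_ae (Eventually.of_forall fun t => ?_)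
    simp only
    rcases abs_cases y with ⟨h, _⟩ | ⟨h, _⟩ <;> rw [h]
    rw [neg_mul, Real.cos_neg]
  rw [abs_of_nonneg hy]
  rcases hy.eq_or_lt with rfl | hy
  · simp [Real.zero_rpow hs.ne']
  rw [← integral_comp_rpow_Ioi _ (neg_ne_zero.2 hs.ne'), stableConst, inv_inv,
    integral_rpow_mul_sin_eq h1 h2]
  have h3 := integral_comp_mul_left_Ioi (fun x : ℝ => x ^ (-s - 1) * (1 - Real.cos x)) 0 hy
  rw [mul_zero, smul_eq_mul] at h3
  have h4 : ∫ x in Ioi (0 : ℝ), (|-s| * x ^ (-s - 1)) •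
      (1 - Real.cos (y * (x ^ (-s)) ^ (-(1 / s))))
      = ∫ x in Ioi (0 : ℝ), (s * y ^ (s + 1)) * ((y * x) ^ (-s - 1) * (1 - Real.cos (y * x))) := by
    refine setIntegral_congr_fun measurableSet_Ioi fun x hx => ?_
    have hx0 : 0 < x := hx
    simp only [smul_eq_mul]
    rw [abs_neg, abs_of_pos hs, ← Real.rpow_mul hx0.le, show -s * -(1 / s) = 1 by field_simp,
      Real.rpow_one, Real.mul_rpow hy.le hx0.le, show -s - 1 = -(s + 1) by ring,
      Real.rpow_neg hy.le]
    have := (Real.rpow_pos_of_pos hy (s + 1)).ne'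
    field_simp
  rw [h4, integral_const_mul, h3, Real.rpow_add hy, Real.rpow_one]
  field_simp

theorem integrableOn_one_sub_cos_mul_rpow (h1 : 1 < s) (h2 : s < 2) (y : ℝ) :
    IntegrableOn (fun t : ℝ => 1 - Real.cos (y * t ^ (-(1 / s)))) (Ioi 0) := by
  rcases eq_or_ne y 0 with rfl | hy
  · simp
  · -- a function that is not integrable has integral `0`
    by_contra hne
    have h3 := integral_one_sub_cos_mul_rpow h1 h2 y
    rw [integral_undef hne] at h3
    have h4 := Real.rpow_pos_of_pos (abs_pos.2 hy) s
    have h5 := inv_pos.2 (stableConst_pos h1 h2)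
    nlinarith [mul_pos h4 h5]

/-- With the stable normalization the exponent is exactly `|θ|^s`. -/
theorem integral_one_sub_cos_stableConst (h1 : 1 < s) (h2 : s < 2) (θ : ℝ) :
    ∫ t in Ioi (0 : ℝ), (1 - Real.cos (θ * stableConst s ^ (1 / s) * t ^ (-(1 / s))))
      = |θ| ^ s := by
  have h3 := stableConst_pos h1 h2
  rw [integral_one_sub_cos_mul_rpow h1 h2, abs_mul, Real.mul_rpow (abs_nonneg _) (abs_nonneg _),
    abs_of_nonneg (Real.rpow_nonneg h3.le _), ← Real.rpow_mul h3.le,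
    one_div_mul_cancel (by linarith), Real.rpow_one, mul_assoc, mul_inv_cancel₀ h3.ne', mul_one]

end StableConst

/-! ### The Laplace functional of the arrival times -/

section Arrival

theorem integral_expMeasure_one (f : ℝ → ℝ) :
    ∫ x, f x ∂(expMeasure 1) = ∫ x in Ioi (0 : ℝ), Real.exp (-x) * f x := by
  have h0 : expMeasure 1 =
      volume.withDensity fun x => ENNReal.ofReal (exponentialPDFReal 1 x) := rfl
  rw [h0, integral_withDensity_eq_integral_toReal_smul
    (measurable_exponentialPDFReal 1).ennreal_ofReal
    (Eventually.of_forall fun _ => ENNReal.ofReal_lt_top),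
    ← integral_Ici_eq_integral_Ioi, ← integral_indicator measurableSet_Ici]
  refine integral_congr_ae (Eventually.of_forall fun x => ?_)
  have h2 : ENNReal.ofReal (exponentialPDFReal 1 x) = _ := exponentialPDF_eq 1 x
  simp only [h2, one_mul, smul_eq_mul, indicator, mem_Ici]
  split_ifs with h
  · rw [ENNReal.toReal_ofReal (Real.exp_pos _).le]
  · simp

theorem integrable_id_expMeasure_one : Integrable (fun x : ℝ => x) (expMeasure 1) := by
  have h0 : expMeasure 1 =
      volume.withDensity fun x => ENNReal.ofReal (exponentialPDFReal 1 x) := rfl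
  rw [h0, integrable_withDensity_iff_integrable_smul'
    (measurable_exponentialPDFReal 1).ennreal_ofReal
    (Eventually.of_forall fun _ => ENNReal.ofReal_lt_top)]
  have h1 := Real.GammaIntegral_convergent (s := 2) (by norm_num)
  rw [← integrableOn_Ici_iff_integrableOn_Ioi, ← integrable_indicator_iff measurableSet_Ici] at h1
  refine h1.congr (Eventually.of_forall fun x => ?_)
  have h2 : ENNReal.ofReal (exponentialPDFReal 1 x) = _ := exponentialPDF_eq 1 x
  simp only [h2, one_mul, smul_eq_mul, indicator, mem_Ici]
  split_ifs with h
  · rw [ENNReal.toReal_ofReal (Real.exp_pos _).le]; norm_num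
  · simp

theorem integral_id_expMeasure_one : ∫ x, x ∂(expMeasure 1) = 1 := by
  rw [integral_expMeasure_one]
  have h1 := Real.Gamma_eq_integral (s := 2) (by norm_num)
  rw [Real.Gamma_two] at h1
  rw [h1]
  norm_num

theorem expMeasure_one_ae_nonneg : ∀ᵐ x ∂(expMeasure 1), 0 ≤ x := by
  have h0 : expMeasure 1 =
      volume.withDensity fun x => ENNReal.ofReal (exponentialPDFReal 1 x) := rfl
  rw [h0, ae_withDensity_iff (measurable_exponentialPDFReal 1).ennreal_ofReal]
  refine Eventually.of_forall fun x hx => ?_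
  by_contra h
  exact hx (exponentialPDF_of_neg (not_le.1 h))

/-- The discounted factor `exp (-∫_t^∞ (1 - H))` for `t ≥ 0`; it is the conditional expectation
of the product of `H` over all arrivals after time `t`. -/
noncomputable def arrivalFactor (H : ℝ → ℝ) (t : ℝ) : ℝ :=
  Real.exp (-(∫ s in Ioi (0 : ℝ), (1 - H s)) + ∫ s in (0)..t, (Ioi (0 : ℝ)).indicator (1 - H) s)

variable {H : ℝ → ℝ}

theorem intervalIntegrable_indicator_one_sub (hint : IntegrableOn (fun t => 1 - H t) (Ioi 0))
    (a b : ℝ) : IntervalIntegrable ((Ioi (0 : ℝ)).indicator (1 - H)) volume a b :=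
  ((integrable_indicator_iff measurableSet_Ioi).2 hint).intervalIntegrable

theorem continuous_arrivalFactor (hint : IntegrableOn (fun t => 1 - H t) (Ioi 0)) :
    Continuous (arrivalFactor H) := by
  have := intervalIntegral.continuous_primitive (intervalIntegrable_indicator_one_sub hint) 0
  unfold arrivalFactor
  fun_prop

theorem arrivalFactor_pos (t : ℝ) : 0 < arrivalFactor H t := Real.exp_pos _

theorem arrivalFactor_zero :
    arrivalFactor H 0 = Real.exp (-(∫ s in Ioi (0 : ℝ), (1 - H s))) := by
  simp [arrivalFactor]

theorem arrivalFactor_le_one (hH1 : ∀ t, |H t| ≤ 1)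
    (hint : IntegrableOn (fun t => 1 - H t) (Ioi 0)) (t : ℝ) : arrivalFactor H t ≤ 1 := by
  have hnn : ∀ s, 0 ≤ (Ioi (0 : ℝ)).indicator (1 - H) s := fun s =>
    indicator_nonneg (fun s _ => by
      simp only [Pi.sub_apply, Pi.one_apply]; linarith [(abs_le.1 (hH1 s)).2]) s
  have h0 : ∫ s in Ioi (0 : ℝ), (1 - H s) = ∫ s, (Ioi (0 : ℝ)).indicator (1 - H) s := by
    rw [integral_indicator measurableSet_Ioi]; rfl
  refine Real.exp_le_one_iff.2 ?_
  have h1 : ∫ s in (0)..t, (Ioi (0 : ℝ)).indicator (1 - H) s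
      ≤ ∫ s, (Ioi (0 : ℝ)).indicator (1 - H) s := by
    rcases le_total 0 t with ht | ht
    · rw [intervalIntegral.integral_of_le ht]
      exact setIntegral_le_integral ((integrable_indicator_iff measurableSet_Ioi).2 hint)
        (Eventually.of_forall hnn)
    · rw [intervalIntegral.integral_symm]
      have h2 := intervalIntegral.integral_nonneg (μ := volume) ht fun s _ => hnn s
      have h3 := integral_nonneg (μ := volume) (f := (Ioi (0 : ℝ)).indicator (1 - H)) hnn
      linarith
  linarith

theorem tendsto_arrivalFactor (hint : IntegrableOn (fun t => 1 - H t) (Ioi 0)) :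
    Tendsto (arrivalFactor H) atTop (𝓝 1) := by
  have h1 : IntegrableOn ((Ioi (0 : ℝ)).indicator (1 - H)) (Ioi 0) :=
    ((integrable_indicator_iff measurableSet_Ioi).2 hint).integrableOn
  have h2 := intervalIntegral_tendsto_integral_Ioi 0 h1 tendsto_id
  have h3 : ∫ s in Ioi (0 : ℝ), (Ioi (0 : ℝ)).indicator (1 - H) s
      = ∫ s in Ioi (0 : ℝ), (1 - H s) :=
    setIntegral_congr_fun measurableSet_Ioi fun s hs => by simp [indicator_of_mem hs]
  rw [h3] at h2
  have h4 := (Real.continuous_exp.tendsto _).comp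
    (h2.const_add (-(∫ s in Ioi (0 : ℝ), (1 - H s))))
  rw [neg_add_cancel, Real.exp_zero] at h4
  exact h4

theorem hasDerivAt_arrivalFactor (hH : ContinuousOn H (Ioi 0))
    (hint : IntegrableOn (fun t => 1 - H t) (Ioi 0)) {t : ℝ} (ht : 0 < t) :
    HasDerivAt (arrivalFactor H) (arrivalFactor H t * (1 - H t)) t := by
  have h1 : IntegrableOn ((Ioi (0 : ℝ)).indicator (1 - H)) univ :=
    ((integrable_indicator_iff measurableSet_Ioi).2 hint).integrableOn
  have hcont : ContinuousOn ((Ioi (0 : ℝ)).indicator (1 - H)) (Ioi 0) :=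
    ((continuousOn_const (c := (1 : ℝ))).sub hH).congr fun s hs => indicator_of_mem hs _
  have h2 := intervalIntegral.integral_hasDerivAt_right
    (intervalIntegrable_indicator_one_sub hint 0 t)
    (hcont.stronglyMeasurableAtFilter isOpen_Ioi t ht) (hcont.continuousAt (Ioi_mem_nhds ht))
  have h3 := (h2.const_add (-(∫ s in Ioi (0 : ℝ), (1 - H s)))).exp
  rwa [indicator_of_mem (show t ∈ Ioi (0 : ℝ) from ht)] at h3

/-- The one-step identity: the factor is harmonic for the exponential waiting time. -/
theorem integral_mul_arrivalFactor (hmeas : Measurable H) (hH : ContinuousOn H (Ioi 0))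
    (hH1 : ∀ t, |H t| ≤ 1) (hint : IntegrableOn (fun t => 1 - H t) (Ioi 0)) {t : ℝ} (ht : 0 ≤ t) :
    ∫ x, H (t + x) * arrivalFactor H (t + x) ∂(expMeasure 1) = arrivalFactor H t := by
  rw [integral_expMeasure_one]
  have hF := continuous_arrivalFactor hint
  have h1 := integral_Ioi_of_hasDerivAt_of_tendsto (a := (0 : ℝ)) (m := 0)
    (f := fun x => -(Real.exp (-x) * arrivalFactor H (t + x)))
    (f' := fun x => Real.exp (-x) * (H (t + x) * arrivalFactor H (t + x)))
    (by fun_prop) (fun x hx => ?_) ?_ ?_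
  · rw [h1]; simp
  · have hx0 : 0 < t + x := add_pos_of_nonneg_of_pos ht hx
    have h2 : HasDerivAt (fun x => arrivalFactor H (t + x)) _ x :=
      (hasDerivAt_arrivalFactor hH hint hx0).comp x ((hasDerivAt_id x).const_add t)
    have h3 : HasDerivAt (fun x : ℝ => Real.exp (-x)) _ x := (hasDerivAt_id x).neg.exp
    refine ((h3.mul h2).neg).congr_deriv ?_
    simp only [id, Pi.neg_apply]
    ring
  · refine Integrable.mono' (integrableOn_exp_neg_Ioi 0) ?_ (Eventually.of_forall fun x => ?_)
    · exact Measurable.aestronglyMeasurable (by have := hF.measurable; fun_prop)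
    · rw [Real.norm_eq_abs, abs_mul, abs_mul, abs_of_pos (Real.exp_pos _),
        abs_of_pos (arrivalFactor_pos _)]
      exact mul_le_of_le_one_right (Real.exp_pos _).le
        (mul_le_one₀ (hH1 _) (arrivalFactor_pos _).le (arrivalFactor_le_one hH1 hint _))
  · have h2 : Tendsto (fun x : ℝ => Real.exp (-x)) atTop (𝓝 0) := Real.tendsto_exp_neg_atTop_nhds_zero
    have h3 := (h2.mul ((tendsto_arrivalFactor hint).comp (tendsto_atTop_add_const_left _ t
      tendsto_id))).neg
    simpa using h3

variable {Ω : Type*} [MeasurableSpace Ω] {P : Measure Ω}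

/-- Integration of a function of two independent variables, one variable at a time. -/
theorem integral_indepFun_prodMk [IsProbabilityMeasure P] {A B : Type*} [MeasurableSpace A] [MeasurableSpace B]
    {X : Ω → A} {Y : Ω → B} (h : IndepFun X Y P) (hX : Measurable X) (hY : Measurable Y)
    {F : Type*} [NormedAddCommGroup F] [NormedSpace ℝ F] [CompleteSpace F]
    {f : A × B → F} (hf : StronglyMeasurable f) {C : ℝ} (hC : ∀ p, ‖f p‖ ≤ C) :
    ∫ ω, f (X ω, Y ω) ∂P = ∫ ω, ∫ y, f (X ω, y) ∂(P.map Y) ∂P := by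
  have := Measure.isProbabilityMeasure_map (μ := P) hX.aemeasurable
  have := Measure.isProbabilityMeasure_map (μ := P) hY.aemeasurable
  rw [← integral_map (φ := fun ω => (X ω, Y ω)) (hX.prodMk hY).aemeasurable
    hf.aestronglyMeasurable, (indepFun_iff_map_prod_eq_prod_map_map hX.aemeasurable
    hY.aemeasurable).1 h, integral_prod _ (Integrable.of_bound hf.aestronglyMeasurable C
    (Eventually.of_forall hC))]
  exact integral_map hX.aemeasurable hf.integral_prod_right'.aestronglyMeasurable

variable {E : ℕ → Ω → ℝ}

theorem ae_nonneg_of_law_exp (hm : ∀ i, Measurable (E i)) (hlaw : ∀ i, P.map (E i) = expMeasure 1) :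
    ∀ᵐ ω ∂P, ∀ i, 0 ≤ E i ω := by
  refine ae_all_iff.2 fun i => ?_
  have h := expMeasure_one_ae_nonneg
  rw [← hlaw i] at h
  exact ae_of_ae_map (hm i).aemeasurable h

theorem ae_tendsto_arrival_div (hm : ∀ i, Measurable (E i))
    (hlaw : ∀ i, P.map (E i) = expMeasure 1) (hind : iIndepFun E P) :
    ∀ᵐ ω ∂P, Tendsto (fun n : ℕ => (∑ i ∈ Finset.range n, E i ω) / n) atTop (𝓝 1) := by
  have hint : Integrable (E 0) P := by
    have h := integrable_id_expMeasure_one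
    rw [← hlaw 0] at h
    exact h.comp_measurable (hm 0)
  have h := strong_law_ae_real E hint (fun i j hij => hind.indepFun hij)
    fun i => ⟨(hm i).aemeasurable, (hm 0).aemeasurable, by rw [hlaw, hlaw]⟩
  have h1 : ∫ ω, E 0 ω ∂P = 1 := by
    rw [← integral_id_expMeasure_one, ← hlaw 0]
    exact (integral_map (hm 0).aemeasurable aestronglyMeasurable_id).symm
  rwa [h1] at h

/-- A function of the first `N` variables is independent of the next one. -/
theorem indepFun_prefix (hm : ∀ i, Measurable (E i)) (hind : iIndepFun E P) (N : ℕ)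
    {A : Type*} [MeasurableSpace A] {Ψ : (ℕ → ℝ) → A} (hΨ : Measurable Ψ)
    (hdep : ∀ e e' : ℕ → ℝ, (∀ i < N, e i = e' i) → Ψ e = Ψ e') :
    IndepFun (fun ω => Ψ fun i => E i ω) (E N) P := by
  classical
  have h1 := hind.indepFun_finset (Finset.range N) {N} (by simp) hm
  have h2 : Measurable fun y : Finset.range N → ℝ => Ψ fun k =>
      if hk : k ∈ Finset.range N then y ⟨k, hk⟩ else 0 := by
    refine hΨ.comp (measurable_pi_lambda _ fun k => ?_)
    by_cases hk : k ∈ Finset.range N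
    · simpa [hk] using measurable_pi_apply _
    · simp [hk]
  have h3 : Measurable fun z : ({N} : Finset ℕ) → ℝ => z ⟨N, by simp⟩ := measurable_pi_apply _
  convert h1.comp h2 h3 using 1
  · funext ω
    exact hdep _ _ fun i hi => by simp [hi]
  · rfl

/-- The product of `H` over the first `N` arrivals, times the factor of the remaining ones, has an
expectation that does not depend on `N`. -/
theorem integral_prod_arrival_mul_factor [IsProbabilityMeasure P] (hm : ∀ i, Measurable (E i))
    (hlaw : ∀ i, P.map (E i) = expMeasure 1) (hind : iIndepFun E P)
    (hmeas : Measurable H) (hH : ContinuousOn H (Ioi 0)) (hH1 : ∀ t, |H t| ≤ 1)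
    (hint : IntegrableOn (fun t => 1 - H t) (Ioi 0)) (N : ℕ) :
    ∫ ω, (∏ i ∈ Finset.range N, H (∑ k ∈ Finset.range (i + 1), E k ω)) *
      arrivalFactor H (∑ k ∈ Finset.range N, E k ω) ∂P = arrivalFactor H 0 := by
  have hF := continuous_arrivalFactor hint
  have hF' := hF.measurable
  have hprod : ∀ (N : ℕ) (e : ℕ → ℝ),
      |∏ i ∈ Finset.range N, H (∑ k ∈ Finset.range (i + 1), e k)| ≤ 1 := fun N e => by
    rw [Finset.abs_prod]
    exact Finset.prod_le_one (fun _ _ => abs_nonneg _) fun _ _ => hH1 _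
  induction N with
  | zero => simp
  | succ N ih =>
    set Ψ : (ℕ → ℝ) → ℝ × ℝ := fun e =>
      (∏ i ∈ Finset.range N, H (∑ k ∈ Finset.range (i + 1), e k), ∑ k ∈ Finset.range N, e k)
      with hΨ
    have hΨm : Measurable Ψ := by fun_prop
    have hindep := indepFun_prefix hm hind N hΨm fun e e' he => by
      simp only [hΨ, Prod.mk.injEq]
      refine ⟨Finset.prod_congr rfl fun i hi => ?_, Finset.sum_congr rfl fun k hk =>
        he k (Finset.mem_range.1 hk)⟩
      congr 1
      refine Finset.sum_congr rfl fun k hk => he k ?_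
      have := Finset.mem_range.1 hi
      have := Finset.mem_range.1 hk
      omega
    have hEm : Measurable fun ω => fun i => E i ω := measurable_pi_lambda _ hm
    -- truncating the first coordinate keeps the integrand bounded
    set f : (ℝ × ℝ) × ℝ → ℝ := fun q => max (-1) (min 1 q.1.1) *
      (H (q.1.2 + q.2) * arrivalFactor H (q.1.2 + q.2)) with hf
    have hfm : Measurable f := by fun_prop
    have hfb : ∀ q, ‖f q‖ ≤ 1 := fun q => by
      rw [Real.norm_eq_abs, hf, abs_mul, abs_mul, abs_of_pos (arrivalFactor_pos _)]
      refine mul_le_one₀ (abs_le.2 ⟨le_max_left _ _, max_le (by norm_num) (min_le_left _ _)⟩)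
        (by have := (arrivalFactor_pos (H := H) (q.1.2 + q.2)).le; positivity)
        (mul_le_one₀ (hH1 _) (arrivalFactor_pos _).le (arrivalFactor_le_one hH1 hint _))
    have htr : ∀ e, max (-1) (min 1 (Ψ e).1) = (Ψ e).1 := fun e => by
      have := abs_le.1 (hprod N e)
      rw [min_eq_right this.2, max_eq_right this.1]
    have h1 := integral_indepFun_prodMk hindep (hΨm.comp hEm) (hm N) hfm.stronglyMeasurable hfb
    have h2 : ∀ ω, (∏ i ∈ Finset.range (N + 1), H (∑ k ∈ Finset.range (i + 1), E k ω)) *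
        arrivalFactor H (∑ k ∈ Finset.range (N + 1), E k ω)
        = f (Ψ (fun i => E i ω), E N ω) := fun ω => by
      simp only [hf, htr]
      rw [Finset.prod_range_succ, mul_assoc, Finset.sum_range_succ]
    rw [integral_congr_ae (Eventually.of_forall h2), h1, ← ih]
    refine integral_congr_ae ?_
    filter_upwards [ae_nonneg_of_law_exp hm hlaw] with ω hω
    simp only [hf, htr]
    rw [integral_const_mul, hlaw, integral_mul_arrivalFactor hmeas hH hH1 hint
      (Finset.sum_nonneg fun i _ => hω i)]

/-- The Laplace functional of a Poisson process of unit rate. -/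
theorem tendsto_integral_prod_arrival [IsProbabilityMeasure P] (hm : ∀ i, Measurable (E i))
    (hlaw : ∀ i, P.map (E i) = expMeasure 1) (hind : iIndepFun E P)
    (hmeas : Measurable H) (hH : ContinuousOn H (Ioi 0)) (hH1 : ∀ t, |H t| ≤ 1)
    (hint : IntegrableOn (fun t => 1 - H t) (Ioi 0)) :
    Tendsto (fun N => ∫ ω, ∏ i ∈ Finset.range N, H (∑ k ∈ Finset.range (i + 1), E k ω) ∂P) atTop
      (𝓝 (Real.exp (-∫ t in Ioi (0 : ℝ), (1 - H t)))) := by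
  have hF' := (continuous_arrivalFactor hint).measurable
  have hprod : ∀ (N : ℕ) (ω : Ω),
      |∏ i ∈ Finset.range N, H (∑ k ∈ Finset.range (i + 1), E k ω)| ≤ 1 := fun N ω => by
    rw [Finset.abs_prod]
    exact Finset.prod_le_one (fun _ _ => abs_nonneg _) fun _ _ => hH1 _
  have hpm : ∀ N, Measurable fun ω => ∏ i ∈ Finset.range N, H (∑ k ∈ Finset.range (i + 1), E k ω) :=
    fun N => by fun_prop
  have hfm : ∀ N, Measurable fun ω => arrivalFactor H (∑ k ∈ Finset.range N, E k ω) :=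
    fun N => by fun_prop
  have hf1 : ∀ t, |1 - arrivalFactor H t| ≤ 1 := fun t => by
    rw [abs_le]
    constructor <;> linarith [arrivalFactor_pos (H := H) t, arrivalFactor_le_one hH1 hint t]
  have h0 : Tendsto (fun N => ∫ ω, (∏ i ∈ Finset.range N, H (∑ k ∈ Finset.range (i + 1), E k ω)) *
      (1 - arrivalFactor H (∑ k ∈ Finset.range N, E k ω)) ∂P) atTop (𝓝 (∫ _ω, (0 : ℝ) ∂P)) := by
    refine tendsto_integral_of_dominated_convergence (fun _ => 1)
      (fun N => ((hpm N).mul (measurable_const.sub (hfm N))).aestronglyMeasurable)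
      (integrable_const 1) (fun N => Eventually.of_forall fun ω => ?_) ?_
    · rw [Real.norm_eq_abs, abs_mul]
      exact mul_le_one₀ (hprod N ω) (abs_nonneg _) (hf1 _)
    · filter_upwards [ae_tendsto_arrival_div hm hlaw hind] with ω hω
      have h1 : Tendsto (fun N : ℕ => ∑ k ∈ Finset.range N, E k ω) atTop atTop := by
        have h2 := hω.pos_mul_atTop one_pos (tendsto_natCast_atTop_atTop (R := ℝ))
        refine h2.congr' ?_
        filter_upwards [eventually_ne_atTop 0] with n hn
        have : (n : ℝ) ≠ 0 := by exact_mod_cast hn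
        field_simp
      have h2 : Tendsto (fun N => 1 - arrivalFactor H (∑ k ∈ Finset.range N, E k ω)) atTop
          (𝓝 0) := by
        simpa using ((tendsto_arrivalFactor hint).comp h1).const_sub 1
      refine squeeze_zero_norm (fun N => ?_) (by simpa using h2.abs)
      rw [Real.norm_eq_abs, abs_mul]
      exact mul_le_of_le_one_left (abs_nonneg _) (hprod N ω)
  rw [integral_zero] at h0
  have h1 := h0.add_const (arrivalFactor H 0)
  rw [zero_add, arrivalFactor_zero] at h1
  refine h1.congr fun N => ?_
  rw [← arrivalFactor_zero, ← integral_prod_arrival_mul_factor hm hlaw hind hmeas hH hH1 hint N,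
    ← integral_add]
  · refine integral_congr_ae (Eventually.of_forall fun ω => ?_)
    simp only
    ring
  · exact Integrable.of_bound ((hpm N).mul (measurable_const.sub (hfm N))).aestronglyMeasurable 1
      (Eventually.of_forall fun ω => by
        rw [Real.norm_eq_abs, abs_mul]; exact mul_le_one₀ (hprod N ω) (abs_nonneg _) (hf1 _))
  · exact Integrable.of_bound ((hpm N).mul (hfm N)).aestronglyMeasurable 1
      (Eventually.of_forall fun ω => by
        rw [Real.norm_eq_abs, abs_mul, abs_of_pos (arrivalFactor_pos _)]
        exact mul_le_one₀ (hprod N ω) (arrivalFactor_pos _).le (arrivalFactor_le_one hH1 hint _))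

end Arrival

/-! ### Random signs -/

section Signs

variable {Ω : Type*} [MeasurableSpace Ω] {P : Measure Ω} [IsProbabilityMeasure P]

/-- `ξ` takes the values `1` and `-1` with probability `1/2` each. -/
structure IsFairSign (P : Measure Ω) (ξ : Ω → ℝ) : Prop where
  measurable : Measurable ξ
  pos : P {ω | ξ ω = 1} = 1 / 2
  neg : P {ω | ξ ω = -1} = 1 / 2

namespace IsFairSign

variable {ξ : Ω → ℝ}

theorem ae_eq (h : IsFairSign P ξ) : ∀ᵐ ω ∂P, ξ ω = 1 ∨ ξ ω = -1 := by
  have h1 : MeasurableSet {ω | ξ ω = 1} := h.measurable (measurableSet_singleton 1)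
  have h2 : MeasurableSet {ω | ξ ω = -1} := h.measurable (measurableSet_singleton (-1))
  have h3 : Disjoint {ω | ξ ω = 1} {ω | ξ ω = -1} := by
    refine Set.disjoint_left.2 fun ω hω hω' => ?_
    simp only [mem_ofPred_eq] at hω hω'
    linarith
  have h4 : P ({ω | ξ ω = 1} ∪ {ω | ξ ω = -1}) = 1 := by
    rw [measure_union h3 h2, h.pos, h.neg, ENNReal.add_halves]
  have h5 := (prob_compl_eq_zero_iff (h1.union h2)).2 h4
  refine measure_mono_null (fun ω hω => ?_) h5
  exact hω

theorem integral_comp (h : IsFairSign P ξ) {F : Type*} [NormedAddCommGroup F] [NormedSpace ℝ F]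
    [CompleteSpace F] (f : ℝ → F) : ∫ ω, f (ξ ω) ∂P = (1 / 2 : ℝ) • (f 1 + f (-1)) := by
  have h1 : MeasurableSet {ω | ξ ω = 1} := h.measurable (measurableSet_singleton 1)
  have h2 : MeasurableSet {ω | ξ ω = -1} := h.measurable (measurableSet_singleton (-1))
  have h3 : (fun ω => f (ξ ω)) =ᵐ[P] fun ω =>
      {ω | ξ ω = 1}.indicator (fun _ => f 1) ω + {ω | ξ ω = -1}.indicator (fun _ => f (-1)) ω := by
    filter_upwards [h.ae_eq] with ω hω
    rcases hω with hω | hω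
    · rw [indicator_of_mem (by exact hω), indicator_of_notMem, hω, add_zero]
      simp only [mem_ofPred_eq, hω]; norm_num
    · rw [indicator_of_notMem, indicator_of_mem (by exact hω), hω, zero_add]
      simp only [mem_ofPred_eq, hω]; norm_num
  have h4 : P.real {ω | ξ ω = 1} = 1 / 2 := by simp [measureReal_def, h.pos]
  have h5 : P.real {ω | ξ ω = -1} = 1 / 2 := by simp [measureReal_def, h.neg]
  rw [integral_congr_ae h3, integral_add ((integrable_const _).indicator h1)
    ((integrable_const _).indicator h2), integral_indicator_const _ h1,
    integral_indicator_const _ h2, h4, h5, smul_add]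

theorem hasSubgaussianMGF (h : IsFairSign P ξ) : HasSubgaussianMGF ξ 1 P := by
  have h1 := hasSubgaussianMGF_of_mem_Icc_of_integral_eq_zero (μ := P) (X := ξ) (a := -1) (b := 1)
    h.measurable.aemeasurable ?_ ?_
  · convert h1
    have : ‖(1 : ℝ) - -1‖₊ = 2 := by
      ext; norm_num
    rw [this]; norm_num
  · filter_upwards [h.ae_eq] with ω hω
    rcases hω with hω | hω <;> rw [hω] <;> norm_num
  · simpa using h.integral_comp fun x => x

end IsFairSign

variable {ξ : ℕ → Ω → ℝ}

/-- Hoeffding's inequality for a weighted sum of independent fair signs. -/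
theorem measureReal_lt_abs_sum_sign_le (hξ : ∀ i, IsFairSign P (ξ i)) (hind : iIndepFun ξ P)
    (w : ℕ → ℝ) (s : Finset ℕ) {B x : ℝ} (hB : ∑ i ∈ s, w i ^ 2 ≤ B) (hx : 0 < x) :
    P.real {ω | x < |∑ i ∈ s, ξ i ω * w i|} ≤ 2 * Real.exp (-(x ^ 2 / (2 * B))) := by
  have key : ∀ w : ℕ → ℝ, ∑ i ∈ s, w i ^ 2 ≤ B →
      P.real {ω | x ≤ ∑ i ∈ s, w i * ξ i ω} ≤ Real.exp (-(x ^ 2 / (2 * B))) := by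
    intro w hB
    have h1 : iIndepFun (fun i ω => w i * ξ i ω) P :=
      hind.comp (fun i y => w i * y) fun i => measurable_const_mul _
    rcases (Finset.sum_nonneg fun i (_ : i ∈ s) => sq_nonneg (w i)).eq_or_lt with h0 | h0
    · -- if all the weights vanish then the event is empty
      have h2 := (Finset.sum_eq_zero_iff_of_nonneg fun i _ => sq_nonneg (w i)).1 h0.symm
      have h3 : {ω | x ≤ ∑ i ∈ s, w i * ξ i ω} = ∅ := by
        refine eq_empty_of_forall_notMem fun ω hω => ?_
        simp only [mem_ofPred_eq] at hω
        rw [Finset.sum_eq_zero fun i hi => by rw [pow_eq_zero_iff two_ne_zero |>.1 (h2 i hi),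
          zero_mul]] at hω
        linarith
      rw [h3, measureReal_empty]
      exact (Real.exp_pos _).le
    have h2 := HasSubgaussianMGF.measure_sum_ge_le_of_iIndepFun h1 (s := s)
      (c := fun i => Real.toNNReal (w i ^ 2))
      (fun i _ => by
        have h3 := (hξ i).hasSubgaussianMGF.const_mul (w i)
        convert h3 using 1
        exact NNReal.eq ((Real.coe_toNNReal _ (sq_nonneg _)).trans (mul_one _).symm)) hx.le
    have h3 : ((∑ i ∈ s, Real.toNNReal (w i ^ 2) : NNReal) : ℝ) = ∑ i ∈ s, w i ^ 2 := by
      rw [NNReal.coe_sum]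
      exact Finset.sum_congr rfl fun i _ => Real.coe_toNNReal _ (sq_nonneg _)
    refine h2.trans ?_
    rw [h3, Real.exp_le_exp, neg_div, neg_le_neg_iff]
    gcongr
  have h1 := key w hB
  have h2 := key (fun i => -w i) (by simpa using hB)
  have h3 : {ω | x < |∑ i ∈ s, ξ i ω * w i|} ⊆
      {ω | x ≤ ∑ i ∈ s, w i * ξ i ω} ∪ {ω | x ≤ ∑ i ∈ s, -w i * ξ i ω} := by
    intro ω hω
    simp only [mem_union, mem_ofPred_eq, neg_mul, Finset.sum_neg_distrib] at hω ⊢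
    simp only [mul_comm (w _)]
    exact (lt_abs.1 hω).imp le_of_lt le_of_lt
  have h4 := (measureReal_mono (μ := P) h3).trans (measureReal_union_le _ _)
  linarith

end Signs

/-! ### Convergence of the series at all thresholds -/

section Convergence

/-- The sums of the signed weights over the `k`-th dyadic block, restricted to the indices whose
position lies to the left of one of the positions of the block, are at most `(2 ^ k) ^ (-η)`. -/
def DyadicBlockBound (η : ℝ) (b v ξ : ℕ → ℝ) (k : ℕ) : Prop :=
  ∀ N ≤ 2 ^ (k + 1), ∀ m < 2 ^ (k + 1),
    |∑ i ∈ Finset.Ico (2 ^ k) N, if v i ≤ v m then ξ i * b i else 0| ≤ ((2 : ℝ) ^ k) ^ (-η)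

/-- A threshold can be moved to the largest position to its left without changing the sum, so
finitely many thresholds control all of them. -/
theorem DyadicBlockBound.abs_sum_le {η : ℝ} {b v ξ : ℕ → ℝ} {k : ℕ}
    (h : DyadicBlockBound η b v ξ k) {N : ℕ} (hN : N ≤ 2 ^ (k + 1)) (t : ℝ) :
    |∑ i ∈ Finset.Ico (2 ^ k) N, if v i ≤ t then ξ i * b i else 0| ≤ ((2 : ℝ) ^ k) ^ (-η) := by
  rcases ((Finset.Ico (2 ^ k) N).filter fun i => v i ≤ t).eq_empty_or_nonempty with h0 | h0
  · rw [← Finset.sum_filter, h0, Finset.sum_empty, abs_zero]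
    positivity
  · obtain ⟨m, hm, hmax⟩ := Finset.exists_max_image _ v h0
    simp only [Finset.mem_filter, Finset.mem_Ico] at hm hmax
    have h1 := h N hN m (hm.1.2.trans_le hN)
    convert h1 using 2
    refine Finset.sum_congr rfl fun i hi => ?_
    have h2 : v i ≤ t ↔ v i ≤ v m :=
      ⟨fun h3 => hmax i ⟨Finset.mem_Ico.1 hi, h3⟩, fun h3 => h3.trans hm.2⟩
    simp only [h2]

theorem cauchySeq_of_dyadicBlockBound {η : ℝ} (hη : 0 < η) {b v ξ : ℕ → ℝ}
    (h : ∀ᶠ k in atTop, DyadicBlockBound η b v ξ k) (t : ℝ) :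
    CauchySeq fun N => ∑ i ∈ Finset.range N, if v i ≤ t then ξ i * b i else 0 := by
  set S : ℕ → ℝ := fun N => ∑ i ∈ Finset.range N, if v i ≤ t then ξ i * b i else 0 with hS
  set r : ℝ := (2 : ℝ) ^ (-η) with hr
  have hr0 : 0 < r := by positivity
  have hr1 : r < 1 := Real.rpow_lt_one_of_one_lt_of_neg (by norm_num) (by linarith)
  have hpow : ∀ k : ℕ, ((2 : ℝ) ^ k) ^ (-η) = r ^ k := fun k => by
    rw [hr, ← Real.rpow_natCast, ← Real.rpow_natCast, ← Real.rpow_mul (by norm_num),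
      ← Real.rpow_mul (by norm_num), mul_comm]
  obtain ⟨k₀, hk₀⟩ := eventually_atTop.1 h
  have hblock : ∀ k ≥ k₀, ∀ N, 2 ^ k ≤ N → N ≤ 2 ^ (k + 1) → |S N - S (2 ^ k)| ≤ r ^ k := by
    intro k hk N h1 h2
    have h3 := (hk₀ k hk).abs_sum_le h2 t
    rwa [Finset.sum_Ico_eq_sub _ h1, hpow] at h3
  have h1 : CauchySeq fun k => S (2 ^ (k + k₀)) := by
    refine cauchySeq_of_le_geometric r (r ^ k₀) hr1 fun k => ?_
    rw [dist_comm, Real.dist_eq, ← pow_add, add_comm k₀, show k + 1 + k₀ = k + k₀ + 1 by ring]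
    exact hblock _ (by omega) _ (Nat.pow_le_pow_right (by norm_num) (by omega)) le_rfl
  obtain ⟨L, hL⟩ := cauchySeq_tendsto_of_complete h1
  have h2 : Tendsto (fun k => S (2 ^ k)) atTop (𝓝 L) := (tendsto_add_atTop_iff_nat k₀).1 hL
  have hlog : Tendsto (fun N : ℕ => Nat.log 2 N) atTop atTop :=
    tendsto_atTop.2 fun k => by
      filter_upwards [eventually_ge_atTop (2 ^ k)] with N hN
      exact Nat.le_log_of_pow_le (by norm_num) hN
  have h3 : Tendsto (fun N : ℕ => S N - S (2 ^ Nat.log 2 N)) atTop (𝓝 0) := by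
    refine squeeze_zero_norm' ?_ ((tendsto_pow_atTop_nhds_zero_of_lt_one hr0.le hr1).comp hlog)
    filter_upwards [hlog.eventually_ge_atTop k₀, eventually_ne_atTop 0] with N hN hN0
    exact hblock _ hN N (Nat.pow_log_le_self 2 hN0) (Nat.lt_pow_succ_log_self (by norm_num) N).le
  have h4 := h3.add (h2.comp hlog)
  refine Tendsto.cauchySeq (x := 0 + L) (h4.congr fun N => ?_)
  simp [Function.comp]

/-- The bounds of the union over all pairs of a block are eventually summable in the block. -/
theorem eventually_dyadic_union_le {η K : ℝ} (hη : 0 < η) (hK : 0 < K) :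
    ∀ᶠ x : ℝ in atTop, 12 * x ^ 2 * Real.exp (-((x ^ (-η)) ^ 2 / (2 * (K ^ 2 * x ^ (-4 * η)))))
      ≤ Real.exp (-(x ^ η)) := by
  have h0 := tendsto_rpow_atTop hη
  have h1 := (tendsto_rpow_mul_exp_neg_mul_atTop_nhds_zero (2 / η) 1 one_pos).comp h0
  filter_upwards [h1.eventually_le_const (show (0 : ℝ) < 1 / 12 by norm_num),
    h0.eventually_ge_atTop (4 * K ^ 2), eventually_gt_atTop 0] with x h2 h3 hx
  set y := x ^ η with hy
  have hy0 : 0 < y := by positivity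
  have h4 : (x ^ (-η)) ^ 2 / (2 * (K ^ 2 * x ^ (-4 * η))) = y ^ 2 / (2 * K ^ 2) := by
    have e1 : x ^ (-η) = y⁻¹ := by rw [Real.rpow_neg hx.le]
    have e2 : x ^ (-4 * η) = (y ^ 4)⁻¹ := by
      rw [hy, neg_mul, Real.rpow_neg hx.le, mul_comm, Real.rpow_mul hx.le]; norm_cast
    rw [e1, e2]
    field_simp
  have h5 : 2 * y ≤ y ^ 2 / (2 * K ^ 2) := by
    rw [le_div_iff₀ (by positivity)]; nlinarith
  have h6 : x ^ 2 = y ^ (2 / η) := by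
    rw [hy, ← Real.rpow_mul hx.le, mul_div_cancel₀ _ hη.ne']; norm_cast
  have h7 : 12 * y ^ (2 / η) * Real.exp (-y) ≤ 1 := by
    simp only [Function.comp_apply, neg_mul, one_mul] at h2
    linarith
  rw [h4, h6]
  calc 12 * y ^ (2 / η) * Real.exp (-(y ^ 2 / (2 * K ^ 2)))
      ≤ 12 * y ^ (2 / η) * Real.exp (-y + -y) := by gcongr; linarith
    _ = (12 * y ^ (2 / η) * Real.exp (-y)) * Real.exp (-y) := by rw [Real.exp_add]; ring
    _ ≤ 1 * Real.exp (-y) := by gcongr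
    _ = Real.exp (-y) := one_mul _

variable {Ω : Type*} [MeasurableSpace Ω] {P : Measure Ω} [IsProbabilityMeasure P]
  {ξ : ℕ → Ω → ℝ}

/-- For deterministic weights decaying faster than `i ^ (-1/2)`, Hoeffding's inequality and the
Borel–Cantelli lemma control all dyadic blocks. -/
theorem ae_eventually_dyadicBlockBound (hξ : ∀ i, IsFairSign P (ξ i)) (hind : iIndepFun ξ P)
    {b v : ℕ → ℝ} {η K : ℝ} (hη : 0 < η) (hK : 0 < K)
    (hb : ∀ᶠ i : ℕ in atTop, |b i| ≤ K * (i : ℝ) ^ (-(1 / 2 + 2 * η))) :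
    ∀ᵐ ω ∂P, ∀ᶠ k in atTop, DyadicBlockBound η b v (fun i => ξ i ω) k := by
  have hinj : Function.Injective fun k : ℕ => 2 ^ k := Nat.pow_right_injective le_rfl
  have hsum := (summable_exp_neg_rpow hη).comp_injective hinj
  have hpowtop : Tendsto (fun k : ℕ => (2 : ℝ) ^ k) atTop atTop :=
    tendsto_pow_atTop_atTop_of_one_lt (by norm_num)
  obtain ⟨i₀, hi₀⟩ := eventually_atTop.1 hb
  have h1 := ae_eventually_notMem_of_le_summable (P := P) hsum
    (s := fun k => {ω | ¬ DyadicBlockBound η b v (fun i => ξ i ω) k}) ?_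
  · filter_upwards [h1] with ω hω
    filter_upwards [hω] with k hk
    simpa using hk
  filter_upwards [hpowtop.eventually (eventually_dyadic_union_le hη hK),
    (tendsto_pow_atTop_atTop_of_one_lt (one_lt_two (α := ℕ))).eventually_ge_atTop i₀]
    with k hk hki
  set x : ℝ := (2 : ℝ) ^ k with hx
  have hx1 : 1 ≤ x := one_le_pow₀ (by norm_num)
  have hx0 : 0 < x := by linarith
  set A : ℕ → ℕ → Set Ω := fun N m => {ω | x ^ (-η) <
    |∑ i ∈ Finset.Ico (2 ^ k) N, ξ i ω * if v i ≤ v m then b i else 0|} with hA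
  have hsub : {ω | ¬ DyadicBlockBound η b v (fun i => ξ i ω) k} ⊆
      ⋃ p ∈ Finset.range (2 ^ (k + 1) + 1) ×ˢ Finset.range (2 ^ (k + 1)), A p.1 p.2 := by
    intro ω hω
    simp only [DyadicBlockBound, mem_ofPred_eq, not_forall, not_le] at hω
    obtain ⟨N, hN, m, hm, h2⟩ := hω
    refine mem_biUnion (x := (N, m)) (by simp; omega) ?_
    simpa [hA, mul_ite] using h2
  have hterm : ∀ p ∈ Finset.range (2 ^ (k + 1) + 1) ×ˢ Finset.range (2 ^ (k + 1)),
      P.real (A p.1 p.2) ≤ 2 * Real.exp (-((x ^ (-η)) ^ 2 / (2 * (K ^ 2 * x ^ (-4 * η))))) := by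
    intro p hp
    simp only [Finset.mem_product, Finset.mem_range] at hp
    refine measureReal_lt_abs_sum_sign_le hξ hind _ _ ?_ (by positivity)
    have h2 : ∀ i ∈ Finset.Ico (2 ^ k) p.1, (if v i ≤ v p.2 then b i else 0) ^ 2
        ≤ K ^ 2 * x ^ (-1 - 4 * η) := by
      intro i hi
      have hi' : x ≤ i := by rw [hx]; exact_mod_cast (Finset.mem_Ico.1 hi).1
      have h3 : |if v i ≤ v p.2 then b i else 0| ≤ K * x ^ (-(1 / 2 + 2 * η)) := by
        have h4 : |if v i ≤ v p.2 then b i else 0| ≤ |b i| := by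
          split_ifs
          · exact le_rfl
          · simp
        refine (h4.trans (hi₀ i (hki.trans (Finset.mem_Ico.1 hi).1))).trans ?_
        exact mul_le_mul_of_nonneg_left
          (Real.rpow_le_rpow_of_nonpos hx0 hi' (by linarith)) hK.le
      rw [← sq_abs]
      refine (pow_le_pow_left₀ (abs_nonneg _) h3 2).trans (le_of_eq ?_)
      rw [mul_pow, ← Real.rpow_natCast (x ^ _), ← Real.rpow_mul hx0.le]
      congr 2
      push_cast
      ring
    refine (Finset.sum_le_card_nsmul _ _ _ h2).trans ?_
    have h3 : ((Finset.Ico (2 ^ k) p.1).card : ℝ) ≤ x := by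
      rw [Nat.card_Ico, hx]
      have : p.1 - 2 ^ k ≤ 2 ^ k := by rw [pow_succ] at hp; omega
      exact_mod_cast this
    rw [nsmul_eq_mul]
    refine (mul_le_mul_of_nonneg_right h3 (by positivity)).trans (le_of_eq ?_)
    rw [show -1 - 4 * η = -4 * η - 1 by ring, Real.rpow_sub_one hx0.ne']
    field_simp
  have h2 := (measureReal_mono (μ := P) hsub (measure_ne_top _ _)).trans
    ((measureReal_biUnion_finset_le _ _).trans (Finset.sum_le_card_nsmul _ _ _ hterm))
  refine h2.trans ?_
  rw [Finset.card_product, Finset.card_range, Finset.card_range, nsmul_eq_mul]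
  push_cast
  rw [pow_succ, ← hx]
  refine le_trans ?_ (hk.trans_eq (by simp [hx]))
  have h3 := Real.exp_pos (-((x ^ (-η)) ^ 2 / (2 * (K ^ 2 * x ^ (-4 * η)))))
  rw [← mul_assoc]
  refine mul_le_mul_of_nonneg_right ?_ h3.le
  nlinarith

end Convergence

/-! ### The jumps of the multistable motion -/

section Jumps

variable {Ω : Type*} [MeasurableSpace Ω] {P : Measure Ω} {Γ V γ : ℕ → Ω → ℝ}

/-- The size of the jump at position `v` produced by the arrival time `t`. -/
noncomputable def jumpSize (α : ℝ → ℝ) (v t : ℝ) : ℝ :=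
  stableConst (α v) ^ (1 / α v) * t ^ (-(1 / α v))

theorem measurable_jumpSize {α : ℝ → ℝ} (hα : Measurable α) :
    Measurable fun p : ℝ × ℝ => jumpSize α p.1 p.2 := by
  have h := measurable_stableConst
  unfold jumpSize
  fun_prop

theorem multistablePartialSum_eq (α : ℝ → ℝ) (Γ V γ : ℕ → ℝ) (N : ℕ) (t : ℝ) :
    multistablePartialSum α Γ V γ N t
      = ∑ i ∈ Finset.range N, if V i ≤ t then γ i * jumpSize α (V i) (Γ i) else 0 := by
  simp only [multistablePartialSum, jumpSize, mul_assoc]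

theorem abs_jumpSize_le {α : ℝ → ℝ} {c d : ℝ} (hc : 1 < c) (hd : d < 2) {v t : ℝ}
    (hcα : c ≤ α v) (hαd : α v ≤ d) (ht : 1 ≤ t) : |jumpSize α v t| ≤ 40 * t ^ (-(1 / d)) := by
  have h1 : 1 < α v := hc.trans_le hcα
  have h2 := stableConst_pos h1 (hαd.trans_lt hd)
  have h3 := stableConst_le h1 (hαd.trans_lt hd)
  have h4 : stableConst (α v) ^ (1 / α v) ≤ 40 := by
    calc stableConst (α v) ^ (1 / α v) ≤ 40 ^ (1 / α v) :=
          Real.rpow_le_rpow h2.le h3 (by positivity)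
      _ ≤ 40 ^ (1 : ℝ) := Real.rpow_le_rpow_of_exponent_le (by norm_num)
          ((div_le_one (by linarith)).2 h1.le)
      _ = 40 := Real.rpow_one _
  have h5 : t ^ (-(1 / α v)) ≤ t ^ (-(1 / d)) := by
    refine Real.rpow_le_rpow_of_exponent_le ht (neg_le_neg ?_)
    exact one_div_le_one_div_of_le (by linarith) hαd
  rw [jumpSize, abs_of_nonneg (by positivity)]
  exact mul_le_mul h4 h5 (by positivity) (by norm_num)

namespace IsMultistableInput

theorem isFairSign (h : IsMultistableInput P Γ V γ) (i : ℕ) : IsFairSign P (γ i) :=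
  ⟨h.measurable_sign i, h.sign_pos i, h.sign_neg i⟩

theorem measurable_interarrival (h : IsMultistableInput P Γ V γ) (i : ℕ) :
    Measurable (interarrival Γ i) := by
  have h1 := h.measurable_arrival
  unfold interarrival
  split_ifs
  · exact h1 0
  · exact (h1 i).sub (h1 (i - 1))

theorem sum_interarrival {Ω : Type*} (Γ : ℕ → Ω → ℝ) (i : ℕ) (ω : Ω) :
    ∑ k ∈ Finset.range (i + 1), interarrival Γ k ω = Γ i ω := by
  induction i with
  | zero => simp [interarrival]
  | succ i ih => rw [Finset.sum_range_succ, ih]; simp [interarrival]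

theorem measurable_seq {f : ℕ → Ω → ℝ} (hf : ∀ i, Measurable (f i)) :
    Measurable fun ω => fun i => f i ω := measurable_pi_lambda _ hf

theorem measurable_sequences (h : IsMultistableInput P Γ V γ) (i : Fin 3) :
    Measurable (![fun ω i => Γ i ω, fun ω i => V i ω, fun ω i => γ i ω] i : Ω → ℕ → ℝ) := by
  fin_cases i
  · exact measurable_seq h.measurable_arrival
  · exact measurable_seq h.measurable_position
  · exact measurable_seq h.measurable_sign

theorem indepFun_pair_sign (h : IsMultistableInput P Γ V γ) :
    IndepFun (fun ω => ((fun i => Γ i ω), (fun i => V i ω))) (fun ω i => γ i ω) P :=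
  h.indep_sequences.indepFun_prodMk h.measurable_sequences 0 1 2 (by decide) (by decide)

theorem indepFun_arrival_position (h : IsMultistableInput P Γ V γ) :
    IndepFun (fun ω i => Γ i ω) (fun ω i => V i ω) P :=
  h.indep_sequences.indepFun (i := 0) (j := 1) (by decide)

theorem ae_position_mem (h : IsMultistableInput P Γ V γ) :
    ∀ᵐ ω ∂P, ∀ i, V i ω ∈ Icc (0 : ℝ) 1 := by
  refine ae_all_iff.2 fun i => ?_
  have h1 : ∀ᵐ v ∂(P.map (V i)), v ∈ Icc (0 : ℝ) 1 := by
    rw [h.law_position i]; exact ae_restrict_mem measurableSet_Icc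
  exact ae_of_ae_map (h.measurable_position i).aemeasurable h1

theorem ae_eventually_half_le_arrival (h : IsMultistableInput P Γ V γ) :
    ∀ᵐ ω ∂P, ∀ᶠ i : ℕ in atTop, (i : ℝ) / 2 ≤ Γ i ω := by
  filter_upwards [ae_tendsto_arrival_div h.measurable_interarrival h.law_interarrival
    h.indep_interarrival] with ω hω
  have h1 := (tendsto_add_atTop_iff_nat 1).2 hω
  filter_upwards [h1.eventually_const_le (show (1 / 2 : ℝ) < 1 by norm_num)] with i hi
  rw [sum_interarrival, le_div_iff₀ (by positivity)] at hi
  push_cast at hi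
  linarith

end IsMultistableInput

/-- A property that holds almost surely for almost every frozen value of `X` holds almost surely
when `Y` is independent of `X`. -/
theorem ae_of_indepFun_of_ae_ae [IsFiniteMeasure P] {A B : Type*} [MeasurableSpace A]
    [MeasurableSpace B] {X : Ω → A} {Y : Ω → B} (h : IndepFun X Y P) (hX : Measurable X)
    (hY : Measurable Y) {p : A × B → Prop} (hp : MeasurableSet {z | p z})
    (hae : ∀ᵐ ω ∂P, ∀ᵐ ω' ∂P, p (X ω, Y ω')) : ∀ᵐ ω ∂P, p (X ω, Y ω) := by
  have h1 : ∀ᵐ z ∂((P.map X).prod (P.map Y)), p z := by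
    rw [Measure.ae_prod_iff_ae_ae hp]
    have h2 : ∀ x, (∀ᵐ y ∂(P.map Y), p (x, y)) ↔ ∀ᵐ ω' ∂P, p (x, Y ω') := fun x =>
      ae_map_iff hY.aemeasurable (measurable_prodMk_left hp)
    have h3 : MeasurableSet {x | ∀ᵐ y ∂(P.map Y), p (x, y)} :=
      measurable_measure_prodMk_left (ν := P.map Y) hp.compl (measurableSet_singleton 0)
    rw [ae_map_iff hX.aemeasurable h3]
    simpa only [h2] using hae
  rw [← (indepFun_iff_map_prod_eq_prod_map_map hX.aemeasurable hY.aemeasurable).1 h] at h1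
  exact ae_of_ae_map (hX.prodMk hY).aemeasurable h1

theorem measurableSet_eventually_dyadicBlockBound {α : ℝ → ℝ} (hα : Measurable α) (η : ℝ) :
    MeasurableSet {p : ((ℕ → ℝ) × (ℕ → ℝ)) × (ℕ → ℝ) | ∀ᶠ k in atTop,
      DyadicBlockBound η (fun i => jumpSize α (p.1.2 i) (p.1.1 i)) p.1.2 p.2 k} := by
  have hj := measurable_jumpSize hα
  simp only [eventually_atTop, DyadicBlockBound]
  refine measurableSet_setOfPred.2 (Measurable.exists fun k₀ => Measurable.forall fun k =>
    measurable_const.imp (Measurable.forall fun N => measurable_const.imp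
      (Measurable.forall fun m => measurable_const.imp (measurableSet_setOfPred.1
        (measurableSet_le ?_ measurable_const)))))
  refine (Finset.measurable_fun_sum _ fun i _ => Measurable.ite (measurableSet_le (by fun_prop)
    (by fun_prop)) (Measurable.mul (by fun_prop) ?_) measurable_const).abs
  exact hj.comp (f := fun p : ((ℕ → ℝ) × (ℕ → ℝ)) × (ℕ → ℝ) => (p.1.2 i, p.1.1 i)) (by fun_prop)

/-- Almost surely the series converges at every `t`. -/
theorem IsMultistableInput.ae_tendsto [IsProbabilityMeasure P] (h : IsMultistableInput P Γ V γ)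
    {α : ℝ → ℝ} (hα : Measurable α) {c d : ℝ} (hc : 1 < c) (hcα : ∀ v, c ≤ α v)
    (hαd : ∀ v, α v ≤ d) (hd : d < 2) : ∀ᵐ ω ∂P, ∀ t,
      Tendsto (fun N : ℕ =>
        multistablePartialSum α (fun i => Γ i ω) (fun i => V i ω) (fun i => γ i ω) N t)
        atTop (𝓝 (multistablePath α Γ V γ ω t)) := by
  have hd1 : 1 < d := hc.trans_le ((hcα 0).trans (hαd 0))
  have hd2 : 1 / 2 < 1 / d := one_div_lt_one_div_of_lt (by linarith) hd
  set η : ℝ := (1 / d - 1 / 2) / 2 with hη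
  have hη0 : 0 < η := by linarith
  have h1 := ae_of_indepFun_of_ae_ae h.indepFun_pair_sign
    ((IsMultistableInput.measurable_seq h.measurable_arrival).prodMk
      (IsMultistableInput.measurable_seq h.measurable_position))
    (IsMultistableInput.measurable_seq h.measurable_sign)
    (measurableSet_eventually_dyadicBlockBound hα η) ?_
  · filter_upwards [h1] with ω hω t
    refine CauchySeq.tendsto_limUnder ?_
    simp only [multistablePartialSum_eq]
    exact cauchySeq_of_dyadicBlockBound hη0 hω t
  · filter_upwards [h.ae_eventually_half_le_arrival] with ω hω
    -- the constant `80` is `40` from the size of a jump, times `2 ≥ 2 ^ (1 / d)` from `Γ i ≥ i / 2`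
    refine ae_eventually_dyadicBlockBound h.isFairSign h.indep_sign hη0
      (show (0 : ℝ) < 80 by norm_num) ?_
    filter_upwards [hω, eventually_ge_atTop 2] with i hi hi2
    have hi2' : (2 : ℝ) ≤ i := by exact_mod_cast hi2
    refine (abs_jumpSize_le hc hd (hcα _) (hαd _) (by linarith)).trans ?_
    have h2 : Γ i ω ^ (-(1 / d)) ≤ ((i : ℝ) / 2) ^ (-(1 / d)) :=
      Real.rpow_le_rpow_of_nonpos (by linarith) hi (by linarith)
    have h3 : ((i : ℝ) / 2) ^ (-(1 / d)) ≤ 2 * (i : ℝ) ^ (-(1 / d)) := by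
      rw [Real.div_rpow (by positivity) (by norm_num), div_eq_mul_inv, ← Real.rpow_neg (by norm_num),
        neg_neg, mul_comm]
      refine mul_le_mul_of_nonneg_right ?_ (by positivity)
      calc (2 : ℝ) ^ (1 / d) ≤ 2 ^ (1 : ℝ) := Real.rpow_le_rpow_of_exponent_le (by norm_num)
            ((div_le_one (by linarith)).2 hd1.le)
        _ = 2 := Real.rpow_one _
    rw [show 1 / 2 + 2 * η = 1 / d by rw [hη]; ring]
    linarith

end Jumps

/-! ### The law of the increments -/

section Law

variable {Ω : Type*} [MeasurableSpace Ω] {P : Measure Ω}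

/-- Freezing `X` in a product over an independent sequence of independent variables. -/
theorem integral_prod_comp_indepFun [IsProbabilityMeasure P] {A : Type*} [MeasurableSpace A] {X : Ω → A} {ξ : ℕ → Ω → ℝ}
    (hX : Measurable X) (hξ : ∀ i, Measurable (ξ i)) (hind : iIndepFun ξ P)
    (h : IndepFun X (fun ω i => ξ i ω) P) {𝕜 : Type*} [RCLike 𝕜] {F : ℕ → A × ℝ → 𝕜}
    (hF : ∀ i, Measurable (F i)) (hF1 : ∀ i z, ‖F i z‖ ≤ 1) (N : ℕ) :
    ∫ ω, ∏ i ∈ Finset.range N, F i (X ω, ξ i ω) ∂P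
      = ∫ ω, ∏ i ∈ Finset.range N, ∫ ω', F i (X ω, ξ i ω') ∂P ∂P := by
  have hm : Measurable fun q : A × (ℕ → ℝ) => ∏ i ∈ Finset.range N, F i (q.1, q.2 i) :=
    Finset.measurable_fun_prod _ fun i _ => (hF i).comp (by fun_prop)
  have hξ' : Measurable fun ω i => ξ i ω := measurable_pi_lambda _ hξ
  have h1 := integral_indepFun_prodMk (C := 1) h hX hξ' hm.stronglyMeasurable fun q => by
    rw [norm_prod]
    exact Finset.prod_le_one (fun _ _ => norm_nonneg _) fun i _ => hF1 i _
  rw [h1]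
  refine integral_congr_ae (Eventually.of_forall fun ω => ?_)
  have hm' : Measurable fun y : ℕ → ℝ => ∏ i ∈ Finset.range N, F i (X ω, y i) :=
    hm.comp measurable_prodMk_left
  simp only
  rw [integral_map hξ'.aemeasurable hm'.aestronglyMeasurable]
  simp only [Finset.prod_range]
  exact (hind.precomp Fin.val_injective).integral_fun_prod_comp
    (X := fun (i : Fin N) ω => ξ i ω) (f := fun (i : Fin N) y => F i (X ω, y))
    (fun i => (hξ i).aemeasurable)
    fun i => ((hF i).comp measurable_prodMk_left).aestronglyMeasurable

/-- The average over a uniform position of the characteristic function of a signed jump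
produced by the arrival time `t`, tested at the level `θ v` for a jump at `v`. -/
noncomputable def averagedCos (α θ : ℝ → ℝ) (t : ℝ) : ℝ :=
  ∫ v in Icc (0 : ℝ) 1, Real.cos (θ v * jumpSize α v t)

variable {Γ V γ : ℕ → Ω → ℝ} {α θ : ℝ → ℝ}

theorem measurable_mul_jumpSize (hα : Measurable α) (hθ : Measurable θ) :
    Measurable fun p : ℝ × ℝ => θ p.1 * jumpSize α p.1 p.2 :=
  (hθ.comp measurable_fst).mul (measurable_jumpSize hα)

theorem measurable_averagedCos (hα : Measurable α) (hθ : Measurable θ) :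
    Measurable (averagedCos α θ) := by
  have h : Measurable fun p : ℝ × ℝ => Real.cos (θ p.2 * jumpSize α p.2 p.1) :=
    Real.measurable_cos.comp ((measurable_mul_jumpSize hα hθ).comp measurable_swap)
  exact (h.stronglyMeasurable.integral_prod_right' (ν := volume.restrict (Icc (0 : ℝ) 1))).measurable

theorem abs_averagedCos_le (α θ : ℝ → ℝ) (t : ℝ) : |averagedCos α θ t| ≤ 1 := by
  have h := norm_setIntegral_le_of_norm_le_const (μ := volume) (s := Icc (0 : ℝ) 1) (C := 1)
    (f := fun v => Real.cos (θ v * jumpSize α v t)) (by simp)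
    fun v _ => Real.abs_cos_le_one _
  simpa [averagedCos] using h

theorem continuousOn_averagedCos (hα : Measurable α) (hθ : Measurable θ) :
    ContinuousOn (averagedCos α θ) (Ioi 0) := by
  refine continuousOn_of_dominated (bound := fun _ => 1) (fun t _ => ?_)
    (fun t _ => Eventually.of_forall fun v => Real.abs_cos_le_one _) (integrable_const _)
    (Eventually.of_forall fun v => ?_)
  · exact (Real.measurable_cos.comp
      ((measurable_mul_jumpSize hα hθ).comp measurable_prodMk_right)).aestronglyMeasurable
  · exact Real.continuous_cos.comp_continuousOn
      (continuousOn_const.mul (continuousOn_const.mul (continuousOn_rpow_Ioi _)))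

/-- Integrating out the signs, then the positions, leaves a function of the arrival times. -/
theorem integral_cexp_signed_sum [IsProbabilityMeasure P] (h : IsMultistableInput P Γ V γ) (hα : Measurable α)
    (hθ : Measurable θ) (N : ℕ) :
    ∫ ω, Complex.exp ((∑ i ∈ Finset.range N,
        γ i ω * (θ (V i ω) * jumpSize α (V i ω) (Γ i ω)) : ℝ) * Complex.I) ∂P
      = ((∫ ω, ∏ i ∈ Finset.range N, averagedCos α θ
          (∑ k ∈ Finset.range (i + 1), interarrival Γ k ω) ∂P : ℝ) : ℂ) := by
  have hΓ := IsMultistableInput.measurable_seq h.measurable_arrival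
  have hV := IsMultistableInput.measurable_seq h.measurable_position
  have hj := measurable_mul_jumpSize hα hθ
  have h1 := integral_prod_comp_indepFun (𝕜 := ℂ) (hΓ.prodMk hV) h.measurable_sign h.indep_sign
    h.indepFun_pair_sign (F := fun i q => Complex.exp
      ((q.2 * (θ (q.1.2 i) * jumpSize α (q.1.2 i) (q.1.1 i)) : ℝ) * Complex.I)) (fun i => by
        have : Measurable fun q : ((ℕ → ℝ) × (ℕ → ℝ)) × ℝ =>
            θ (q.1.2 i) * jumpSize α (q.1.2 i) (q.1.1 i) :=
          hj.comp (f := fun q : ((ℕ → ℝ) × (ℕ → ℝ)) × ℝ => (q.1.2 i, q.1.1 i)) (by fun_prop)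
        fun_prop) (fun i q => (Complex.norm_exp_ofReal_mul_I _).le) N
  have h2 := integral_prod_comp_indepFun (𝕜 := ℝ) hΓ h.measurable_position h.indep_position
    h.indepFun_arrival_position (F := fun i q => Real.cos (θ q.2 * jumpSize α q.2 (q.1 i)))
    (fun i => Real.measurable_cos.comp
      (hj.comp (f := fun q : (ℕ → ℝ) × ℝ => (q.2, q.1 i)) (by fun_prop)))
    (fun i q => Real.abs_cos_le_one _) N
  have e1 : ∀ ω, Complex.exp ((∑ i ∈ Finset.range N,
      γ i ω * (θ (V i ω) * jumpSize α (V i ω) (Γ i ω)) : ℝ) * Complex.I)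
      = ∏ i ∈ Finset.range N, Complex.exp
        ((γ i ω * (θ (V i ω) * jumpSize α (V i ω) (Γ i ω)) : ℝ) * Complex.I) := fun ω => by
    rw [← Complex.exp_sum, Complex.ofReal_sum, Finset.sum_mul]
  have e2 : ∀ (i : ℕ) (x : ℝ), ∫ ω', Complex.exp ((γ i ω' * x : ℝ) * Complex.I) ∂P
      = (Real.cos x : ℂ) := fun i x => by
    rw [(h.isFairSign i).integral_comp fun y => Complex.exp ((y * x : ℝ) * Complex.I),
      Complex.ofReal_cos, Complex.cos, Complex.real_smul]
    push_cast
    simp only [one_mul, neg_mul]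
    ring
  have e3 : ∀ (i : ℕ) (t : ℝ), ∫ ω', Real.cos (θ (V i ω') * jumpSize α (V i ω') t) ∂P
      = averagedCos α θ t := fun i t => by
    rw [averagedCos, ← h.law_position i, integral_map (h.measurable_position i).aemeasurable]
    exact (Real.measurable_cos.comp (hj.comp measurable_prodMk_right)).aestronglyMeasurable
  simp only [e3] at h2
  simp only [e2] at h1
  rw [integral_congr_ae (Eventually.of_forall e1), h1]
  simp only [IsMultistableInput.sum_interarrival]
  rw [← h2, ← integral_complex_ofReal]
  refine integral_congr_ae (Eventually.of_forall fun ω => ?_)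
  simp only [Complex.ofReal_prod]

variable {c d : ℝ}

theorem integrableOn_abs_rpow (hα : Measurable α) (hθ : Measurable θ) (hc : 1 < c)
    (hcα : ∀ v, c ≤ α v) (hαd : ∀ v, α v ≤ d) (hd : d < 2) {B : ℝ} (hB : ∀ v, |θ v| ≤ B)
    {s : Set ℝ} (hs : volume s ≠ ∞) : IntegrableOn (fun v => |θ v| ^ α v) s := by
  have hB0 : 0 ≤ B := (abs_nonneg _).trans (hB 0)
  have : IsFiniteMeasure (volume.restrict s) := ⟨by simpa using hs.lt_top⟩
  refine Integrable.of_bound (Measurable.aestronglyMeasurable (by fun_prop)) ((1 + B) ^ (2 : ℝ))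
    (Eventually.of_forall fun v => ?_)
  rw [Real.norm_eq_abs, abs_of_nonneg (by positivity)]
  calc |θ v| ^ α v ≤ (1 + B) ^ α v :=
        Real.rpow_le_rpow (abs_nonneg _) (by linarith [hB v]) (by linarith [hcα v])
    _ ≤ (1 + B) ^ (2 : ℝ) :=
        Real.rpow_le_rpow_of_exponent_le (by linarith) (by linarith [hαd v])

/-- Fubini's theorem and the Lévy–Khintchine integral of the stable laws of index `α v`. -/
theorem integrableOn_and_integral_one_sub_averagedCos (hα : Measurable α) (hθ : Measurable θ)
    (hc : 1 < c) (hcα : ∀ v, c ≤ α v) (hαd : ∀ v, α v ≤ d) (hd : d < 2) {B : ℝ}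
    (hB : ∀ v, |θ v| ≤ B) :
    IntegrableOn (fun t => 1 - averagedCos α θ t) (Ioi 0) ∧
      ∫ t in Ioi (0 : ℝ), (1 - averagedCos α θ t) = ∫ v in Icc (0 : ℝ) 1, |θ v| ^ α v := by
  set g : ℝ × ℝ → ℝ := fun p => 1 - Real.cos (θ p.1 * jumpSize α p.1 p.2) with hg
  have hgm : Measurable g :=
    measurable_const.sub (Real.measurable_cos.comp (measurable_mul_jumpSize hα hθ))
  have hg0 : ∀ p, 0 ≤ g p := fun p => by
    have := Real.cos_le_one (θ p.1 * jumpSize α p.1 p.2)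
    simp only [hg]; linarith
  have h1 : ∀ v, IntegrableOn (fun t => g (v, t)) (Ioi 0) := fun v => by
    have := integrableOn_one_sub_cos_mul_rpow (hc.trans_le (hcα v)) ((hαd v).trans_lt hd)
      (θ v * stableConst (α v) ^ (1 / α v))
    simpa only [hg, jumpSize, mul_assoc] using this
  have h2 : ∀ v, ∫ t in Ioi (0 : ℝ), g (v, t) = |θ v| ^ α v := fun v => by
    have := integral_one_sub_cos_stableConst (hc.trans_le (hcα v)) ((hαd v).trans_lt hd) (θ v)
    simpa only [hg, jumpSize, mul_assoc] using this
  have h3 : Integrable g ((volume.restrict (Icc (0 : ℝ) 1)).prod (volume.restrict (Ioi 0))) := by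
    refine (integrable_prod_iff hgm.aestronglyMeasurable).2
      ⟨Eventually.of_forall h1, ?_⟩
    simp only [Real.norm_eq_abs, abs_of_nonneg (hg0 _), h2]
    exact integrableOn_abs_rpow hα hθ hc hcα hαd hd hB (by simp)
  have h4 : ∀ t, 1 - averagedCos α θ t = ∫ v in Icc (0 : ℝ) 1, g (v, t) := fun t => by
    have h5 : Integrable (fun v => Real.cos (θ v * jumpSize α v t))
        (volume.restrict (Icc (0 : ℝ) 1)) :=
      Integrable.of_bound (Real.measurable_cos.comp
        ((measurable_mul_jumpSize hα hθ).comp measurable_prodMk_right)).aestronglyMeasurable 1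
        (Eventually.of_forall fun v => Real.abs_cos_le_one _)
    rw [integral_sub (integrable_const _) h5]
    simp [averagedCos]
  simp only [h4]
  refine ⟨h3.integral_prod_right, ?_⟩
  rw [← integral_integral_swap h3]
  exact integral_congr_ae (Eventually.of_forall h2)

/-- The step function with value `τ j` on the `j`-th cell of the grid. -/
noncomputable def gridStep (n : ℕ) (τ : ℕ → ℝ) (v : ℝ) : ℝ :=
  ∑ j ∈ Finset.range n, if (j : ℝ) / n < v ∧ v ≤ ((j : ℝ) + 1) / n then τ j else 0

theorem measurable_gridStep (n : ℕ) (τ : ℕ → ℝ) : Measurable (gridStep n τ) :=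
  Finset.measurable_fun_sum _ fun _ _ => Measurable.ite measurableSet_Ioc measurable_const
    measurable_const

theorem abs_gridStep_le (n : ℕ) (τ : ℕ → ℝ) (v : ℝ) :
    |gridStep n τ v| ≤ ∑ j ∈ Finset.range n, |τ j| := by
  refine (Finset.abs_sum_le_sum_abs _ _).trans (Finset.sum_le_sum fun j _ => ?_)
  split_ifs
  · exact le_rfl
  · simp

theorem gridStep_eq {n j : ℕ} (hj : j < n) (τ : ℕ → ℝ) {v : ℝ} (h1 : (j : ℝ) / n < v)
    (h2 : v ≤ ((j : ℝ) + 1) / n) : gridStep n τ v = τ j := by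
  have hn : (0 : ℝ) < n := by exact_mod_cast (Nat.zero_le j).trans_lt hj
  rw [gridStep, Finset.sum_eq_single_of_mem j (Finset.mem_range.2 hj) fun k _ hkj => ?_,
    if_pos ⟨h1, h2⟩]
  rw [if_neg]
  rintro ⟨h3, h4⟩
  have h5 := (div_lt_div_iff_of_pos_right hn).1 (h3.trans_le h2)
  have h6 := (div_lt_div_iff_of_pos_right hn).1 (h1.trans_le h4)
  have h7 : k < j + 1 := by exact_mod_cast h5
  have h8 : j < k + 1 := by exact_mod_cast h6
  omega

/-- A linear combination of grid increments weighs each jump by the coefficient of its cell. -/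
theorem sum_mul_gridIncrement_partialSum (α : ℝ → ℝ) (Γ V γ : ℕ → ℝ) (N n : ℕ) (τ : ℕ → ℝ) :
    ∑ j ∈ Finset.range n, τ j * gridIncrement (multistablePartialSum α Γ V γ N) n j
      = ∑ i ∈ Finset.range N, γ i * (gridStep n τ (V i) * jumpSize α (V i) (Γ i)) := by
  have h1 : ∀ j i : ℕ, τ j * ((if V i ≤ ((j : ℝ) + 1) / n then γ i * jumpSize α (V i) (Γ i) else 0)
      - if V i ≤ (j : ℝ) / n then γ i * jumpSize α (V i) (Γ i) else 0)
      = γ i * ((if (j : ℝ) / n < V i ∧ V i ≤ ((j : ℝ) + 1) / n then τ j else 0)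
        * jumpSize α (V i) (Γ i)) := by
    intro j i
    have h2 : (j : ℝ) / n ≤ ((j : ℝ) + 1) / n := by gcongr; linarith
    by_cases h3 : V i ≤ (j : ℝ) / n
    · rw [if_pos (h3.trans h2), if_pos h3, if_neg fun h4 => absurd h3 (not_le.2 h4.1)]
      ring
    · by_cases h4 : V i ≤ ((j : ℝ) + 1) / n
      · rw [if_pos h4, if_neg h3, if_pos ⟨not_le.1 h3, h4⟩]
        ring
      · rw [if_neg h4, if_neg h3, if_neg fun h5 => h4 h5.2]
        ring
  simp only [gridIncrement, multistablePartialSum_eq, ← Finset.sum_sub_distrib, Finset.mul_sum, h1]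
  rw [Finset.sum_comm]
  simp only [gridStep, Finset.sum_mul, Finset.mul_sum]

/-- The exponent of a step function splits into the exponents of the cells. -/
theorem integral_abs_gridStep_rpow (hα : Measurable α) (hc : 1 < c) (hcα : ∀ v, c ≤ α v)
    (hαd : ∀ v, α v ≤ d) (hd : d < 2) {n : ℕ} (hn : n ≠ 0) (τ : ℕ → ℝ) :
    ∫ v in Icc (0 : ℝ) 1, |gridStep n τ v| ^ α v
      = ∑ j ∈ Finset.range n, cellExponent α n j (τ j) := by
  have hn0 : (n : ℝ) ≠ 0 := by exact_mod_cast hn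
  have h1 := intervalIntegral.sum_integral_adjacent_intervals (μ := volume)
    (f := fun v => |gridStep n τ v| ^ α v) (a := fun k : ℕ => (k : ℝ) / n) (n := n) fun k _ => by
      refine (intervalIntegrable_iff).2 ?_
      exact integrableOn_abs_rpow hα (measurable_gridStep n τ) hc hcα hαd hd
        (abs_gridStep_le n τ) (by simp [uIoc])
  rw [Nat.cast_zero, zero_div, div_self hn0] at h1
  rw [integral_Icc_eq_integral_Ioc, ← intervalIntegral.integral_of_le zero_le_one, ← h1]
  refine Finset.sum_congr rfl fun j hj => ?_
  have h2 : (j : ℝ) / n ≤ ((j : ℝ) + 1) / n := by gcongr; linarith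
  rw [cellExponent, Nat.cast_add, Nat.cast_one]
  rw [intervalIntegral.integral_of_le h2, intervalIntegral.integral_of_le h2]
  refine setIntegral_congr_fun measurableSet_Ioc fun v hv => ?_
  rw [gridStep_eq (Finset.mem_range.1 hj) τ hv.1 hv.2]

theorem measurable_multistablePath (h : IsMultistableInput P Γ V γ) (hα : Measurable α) (t : ℝ) :
    Measurable fun ω => multistablePath α Γ V γ ω t := by
  have h1 : ∀ N : ℕ, Measurable fun ω =>
      multistablePartialSum α (fun i => Γ i ω) (fun i => V i ω) (fun i => γ i ω) N t := by
    intro N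
    simp only [multistablePartialSum_eq]
    refine Finset.measurable_fun_sum _ fun i _ => Measurable.ite
      (measurableSet_le (h.measurable_position i) measurable_const)
      ((h.measurable_sign i).mul ?_) measurable_const
    exact (measurable_jumpSize hα).comp (f := fun ω => (V i ω, Γ i ω))
      ((h.measurable_position i).prodMk (h.measurable_arrival i))
  have h2 := StronglyMeasurable.limUnder (l := atTop) fun N => (h1 N).stronglyMeasurable
  exact h2.measurable

theorem measurable_gridIncrement_multistablePath (h : IsMultistableInput P Γ V γ)
    (hα : Measurable α) (n j : ℕ) :
    Measurable fun ω => gridIncrement (multistablePath α Γ V γ ω) n j :=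
  (measurable_multistablePath h hα _).sub (measurable_multistablePath h hα _)

/-- The joint characteristic function of the increments over a grid. -/
theorem integral_cexp_sum_gridIncrement [IsProbabilityMeasure P] (h : IsMultistableInput P Γ V γ) (hα : Measurable α)
    (hc : 1 < c) (hcα : ∀ v, c ≤ α v) (hαd : ∀ v, α v ≤ d) (hd : d < 2) {n : ℕ} (hn : n ≠ 0)
    (τ : ℕ → ℝ) :
    ∫ ω, Complex.exp ((∑ j ∈ Finset.range n,
        τ j * gridIncrement (multistablePath α Γ V γ ω) n j : ℝ) * Complex.I) ∂P
      = ((∏ j ∈ Finset.range n, Real.exp (-cellExponent α n j (τ j)) : ℝ) : ℂ) := by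
  have hθ := measurable_gridStep n τ
  obtain ⟨h1, h2⟩ := integrableOn_and_integral_one_sub_averagedCos hα hθ hc hcα hαd hd
    (abs_gridStep_le n τ)
  have h3 := tendsto_integral_prod_arrival h.measurable_interarrival h.law_interarrival
    h.indep_interarrival (measurable_averagedCos hα hθ) (continuousOn_averagedCos hα hθ)
    (abs_averagedCos_le α _) h1
  rw [h2, integral_abs_gridStep_rpow hα hc hcα hαd hd hn, ← Finset.sum_neg_distrib,
    Real.exp_sum] at h3
  have h4 := (Complex.continuous_ofReal.tendsto _).comp h3
  refine tendsto_nhds_unique ?_ h4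
  have h5 : ∀ N, (Complex.ofReal ∘ fun N => ∫ ω, ∏ i ∈ Finset.range N, averagedCos α (gridStep n τ)
      (∑ k ∈ Finset.range (i + 1), interarrival Γ k ω) ∂P) N
      = ∫ ω, Complex.exp ((∑ i ∈ Finset.range N,
        γ i ω * (gridStep n τ (V i ω) * jumpSize α (V i ω) (Γ i ω)) : ℝ) * Complex.I) ∂P := fun N =>
    (integral_cexp_signed_sum h hα hθ N).symm
  refine Tendsto.congr (fun N => (h5 N).symm) ?_
  refine tendsto_integral_of_dominated_convergence (fun _ => 1) (fun N => ?_) (integrable_const _)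
    (fun N => Eventually.of_forall fun ω => (Complex.norm_exp_ofReal_mul_I _).le) ?_
  · have h6 : ∀ i, Measurable fun ω => gridStep n τ (V i ω) * jumpSize α (V i ω) (Γ i ω) :=
      fun i => (measurable_mul_jumpSize hα hθ).comp
        ((h.measurable_position i).prodMk (h.measurable_arrival i))
    have h7 := h.measurable_sign
    exact Measurable.aestronglyMeasurable (by fun_prop)
  · filter_upwards [h.ae_tendsto hα hc hcα hαd hd] with ω hω
    have h6 : Tendsto (fun N => ∑ j ∈ Finset.range n, τ j * gridIncrement (multistablePartialSum α
        (fun i => Γ i ω) (fun i => V i ω) (fun i => γ i ω) N) n j) atTop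
        (𝓝 (∑ j ∈ Finset.range n, τ j * gridIncrement (multistablePath α Γ V γ ω) n j)) :=
      tendsto_finsetSum _ fun j _ => ((hω _).sub (hω _)).const_mul _
    simp only [sum_mul_gridIncrement_partialSum] at h6
    exact (((Complex.continuous_ofReal.mul continuous_const).cexp).tendsto _).comp h6

/-- The increments of the multistable motion over a grid are independent, with the expected
characteristic functions. -/
theorem IsMultistableInput.hasMultistableIncrements [IsProbabilityMeasure P] (h : IsMultistableInput P Γ V γ)
    (hα : Measurable α) (hc : 1 < c) (hcα : ∀ v, c ≤ α v) (hαd : ∀ v, α v ≤ d) (hd : d < 2) :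
    HasMultistableIncrements P (multistablePath α Γ V γ) α := by
  have hmeas := measurable_gridIncrement_multistablePath h hα
  have hzero : ∀ n j, cellExponent α n j 0 = 0 := fun n j => by
    have h1 : ∀ v, (0 : ℝ) ^ α v = 0 := fun v => Real.zero_rpow (by linarith [hcα v])
    simp [cellExponent, h1]
  have hchar : ∀ n, ∀ j < n, ∀ θ,
      charFun (P.map fun ω => gridIncrement (multistablePath α Γ V γ ω) n j) θ
        = (Real.exp (-cellExponent α n j θ) : ℝ) := by
    intro n j hj θ
    rw [charFun_apply_real, integral_map (hmeas n j).aemeasurable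
      (Measurable.aestronglyMeasurable (by fun_prop))]
    have h1 := integral_cexp_sum_gridIncrement h hα hc hcα hαd hd (Nat.ne_zero_of_lt hj)
      (Pi.single j θ)
    rw [Finset.prod_eq_single_of_mem j (Finset.mem_range.2 hj) fun k _ hk => by
      rw [Pi.single_eq_of_ne hk, hzero, neg_zero, Real.exp_zero], Pi.single_eq_same] at h1
    rw [← h1]
    refine integral_congr_ae (Eventually.of_forall fun ω => ?_)
    simp only
    rw [Finset.sum_eq_single_of_mem j (Finset.mem_range.2 hj) fun k _ hk => by
      rw [Pi.single_eq_of_ne hk, zero_mul], Pi.single_eq_same]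
    push_cast
    rfl
  refine ⟨fun n j _ => hmeas n j, fun n => ?_, hchar⟩
  rcases eq_or_ne n 0 with rfl | hn
  · exact iIndepFun.of_subsingleton
  rw [iIndepFun_iff_charFun_pi (X := fun (j : Fin n) ω =>
    gridIncrement (multistablePath α Γ V γ ω) n j) fun j => (hmeas n j).aemeasurable]
  intro t
  have h1 := integral_cexp_sum_gridIncrement h hα hc hcα hαd hd hn
    (fun j => if hj : j < n then t ⟨j, hj⟩ else 0)
  rw [charFun_apply, integral_map (Measurable.aemeasurable ?_) (by fun_prop)]
  · simp only [Finset.sum_range, Finset.prod_range, Fin.is_lt, dite_true] at h1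
    rw [Finset.prod_congr rfl fun (j : Fin n) _ => hchar n j j.2 (t j), ← Complex.ofReal_prod, ← h1]
    refine integral_congr_ae (Eventually.of_forall fun ω => ?_)
    simp only [PiLp.inner_apply, RCLike.inner_apply, conj_trivial]
  · exact (WithLp.measurable_toLp 2 _).comp (measurable_pi_lambda _ fun j => hmeas n j)

end Law

/-! ### The spectra of the multistable motion -/

theorem multistablePartialSum_congr {α α' : ℝ → ℝ} {V : ℕ → ℝ} (h : ∀ i, α (V i) = α' (V i))
    (Γ γ : ℕ → ℝ) : multistablePartialSum α Γ V γ = multistablePartialSum α' Γ V γ := by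
  funext N t
  simp only [multistablePartialSum, h]

theorem theorem2 {Ω : Type*} [MeasurableSpace Ω] (P : Measure Ω) [IsProbabilityMeasure P]
    (α : ℝ → ℝ) (hα : ContDiffOn ℝ 1 α (Icc (0 : ℝ) 1))
    (hα_range : ∀ u ∈ Icc (0 : ℝ) 1, 1 < α u ∧ α u < 2)
    (c d : ℝ) (hc : c = sInf (α '' Icc (0 : ℝ) 1)) (hd : d = sSup (α '' Icc (0 : ℝ) 1))
    (Γ V γ : ℕ → Ω → ℝ) (hinput : IsMultistableInput P Γ V γ) :
    ∀ᵐ ω ∂P,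
      (∀ t ∈ Icc (0 : ℝ) 1,
        Tendsto (fun N : ℕ =>
            multistablePartialSum α (fun i => Γ i ω) (fun i => V i ω) (fun i => γ i ω) N t)
          atTop (𝓝 (multistablePath α Γ V γ ω t))) ∧
      (∀ β : ℝ, largeDeviationSpectrum (multistablePath α Γ V γ ω) β =
        multistableSpectrum c d β) ∧
      (∀ β : ℝ, legendreSpectrum (multistablePath α Γ V γ ω) β =
        multistableSpectrum c d β) ∧
      IsConcaveEReal (largeDeviationSpectrum (multistablePath α Γ V γ ω)) ∧
      hausdorffSpectrum (multistablePath α Γ V γ ω) ≠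
        largeDeviationSpectrum (multistablePath α Γ V γ ω) := by
  have hcont := hα.continuousOn
  have hcomp := isCompact_Icc.image_of_continuousOn hcont
  have hne : (α '' Icc (0 : ℝ) 1).Nonempty := (nonempty_Icc.2 zero_le_one).image α
  obtain ⟨tc, htc, hαc⟩ := hcomp.sInf_mem hne
  obtain ⟨td, htd, hαd⟩ := hcomp.sSup_mem hne
  rw [← hc] at hαc
  rw [← hd] at hαd
  have hc1 : 1 < c := hαc ▸ (hα_range tc htc).1
  have hd2 : d < 2 := hαd ▸ (hα_range td htd).2
  -- only the values of `α` on the unit interval matter, so `α` can be extended continuously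
  set α' : ℝ → ℝ := fun v => α (projIcc (0 : ℝ) 1 zero_le_one v) with hα'
  have hα'_eq : ∀ v ∈ Icc (0 : ℝ) 1, α' v = α v := fun v hv => by
    simp only [hα', projIcc_of_mem zero_le_one hv]
  have hα'_cont : Continuous α' := hcont.comp_continuous
    (continuous_subtype_val.comp continuous_projIcc) fun v => Subtype.property _
  have hα'_ge : ∀ v, c ≤ α' v := fun v =>
    hc ▸ csInf_le hcomp.bddBelow (mem_image_of_mem α (Subtype.property _))
  have hα'_le : ∀ v, α' v ≤ d := fun v =>
    hd ▸ le_csSup hcomp.bddAbove (mem_image_of_mem α (Subtype.property _))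
  have hinc := hinput.hasMultistableIncrements hα'_cont.measurable hc1 hα'_ge hα'_le hd2
  have hspec := hinc.ae_spectra hα'_cont hc1 hα'_ge hα'_le hd2
    ⟨tc, htc, (hα'_eq tc htc).trans hαc⟩ ⟨td, htd, (hα'_eq td htd).trans hαd⟩
  filter_upwards [hspec, hinput.ae_position_mem,
    hinput.ae_tendsto hα'_cont.measurable hc1 hα'_ge hα'_le hd2] with ω h1 h2 h3
  have h4 := multistablePartialSum_congr (fun i => (hα'_eq _ (h2 i)).symm)
    (fun i => Γ i ω) (fun i => γ i ω)
  have h5 : multistablePath α Γ V γ ω = multistablePath α' Γ V γ ω := by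
    funext t
    simp only [multistablePath, multistableMotion, h4]
  rw [h4, h5]
  exact ⟨fun t _ => h3 t, h1⟩
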